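/- Let $R$ be a commutative ring, let $n,k\ge 1$ be integers, let $f_1,\dots,f_n\in R$ and $J=(f_1,\dots,f_n)$. Let $\overline{J^{n+k-1}}$ denote the integral closure of the ideal $J^{n+k-1}$ (the ideal of all $h\in R$ satisfying $h^d+a_1h^{d-1}+\dots+a_d=0$ for some $d\ge 1$ and $a_i\in (J^{n+k-1})^i$), and let $\pi\colon Y\to\operatorname{Spec}R$ be the blowup of $\overline{J^{n+k-1}}$, i.e. $Y=\operatorname{Proj}$ of its Rees algebra. Then the ideal sheaf $J\mathcal O_Y$ is invertible, $J\mathcal O_Y=\mathcal O_Y(-E)$ for an effective Cartier divisor $E$; put $\mathcal O_Y(-mE)=J^m\mathcal O_Y\subseteq\mathcal O_Y$ for $m\ge 0$. Let $F=R^n$ with basis $e_1,\dots,e_n$, and let $L^k(\underline f)$ be the Buchsbaum–Eisenbud complex $$0\to L_n^k(F)\to\cdots\to L_2^k(F)\to L_1^k(F)\to R\to 0,$$ where $R$ is placed in degree $0$; for $i\ge 1$, $L_i^k(F)$ is the image of the natural (Koszul) map $\bigwedge^iF\otimes_R S_{k-1}F\to\bigwedge^{i-1}F\otimes_R S_kF$;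 the differentials $L_{i+1}^k(F)\to L_i^k(F)$, $i\ge1$, are induced by contraction of the exterior factor with the linear form $F\to R$, $e_i\mapsto f_i$; and $L_1^k(F)=S_kF\to R$ is the evaluation $e_i\mapsto f_i$. Then: (1) the canonical map $$R\Gamma(Y,\mathcal O_Y(-(n+k-1)E))\to R\Gamma(Y,\mathcal O_Y)\to L^k(\underline f)\otimes_R^{L}R\Gamma(Y,\mathcal O_Y),$$ induced by the inclusion $\mathcal O_Y(-(n+k-1)E)\subseteq\mathcal O_Y$ and by the inclusion $R\to L^k(\underline f)$ of the degree $0$ term, is zero in the derived category of $R$-modules; (2) already the canonical map $\mathcal O_Y(-(n+k-1)E)\to\mathcal O_Y\to L^k(\underline f)\otimes_R\mathcal O_Y$ is zero in the derived category of $\mathcal O_Y$-modules. -/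

import Mathlib

universe u w w' w''

open CategoryTheory Limits AlgebraicGeometry
open scoped TensorProduct

namespace BrianconSkoda

section IntegralClosure

variable {A : Type u} [CommRing A]

/-- `h` is integral over the ideal `I`: it satisfies an equation
`h ^ d + a₁ h ^ (d - 1) + ⋯ + a_d = 0` with `d ≥ 1` and `a_i ∈ I ^ i`. -/
def IsIntegralOverIdeal (I : Ideal A) (h : A) : Prop :=
  ∃ (d : ℕ) (a : ℕ → A), 1 ≤ d ∧ (∀ i, a i ∈ I ^ i) ∧
    h ^ d + ∑ i ∈ Finset.Icc 1 d, a i * h ^ (d - i) = 0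

theorem isIntegralOverIdeal_iff (I : Ideal A) (h : A) :
    IsIntegralOverIdeal I h ↔
      IsIntegral (reesAlgebra I) (Polynomial.monomial 1 h : Polynomial A) := by
  constructor
  · rintro ⟨d, a, hd, ha, he⟩
    let c : ℕ → reesAlgebra I := fun i =>
      ⟨Polynomial.monomial i (a i), reesAlgebra.monomial_mem.mpr (ha i)⟩
    have hdeg : (∑ i ∈ Finset.Icc 1 d,
        Polynomial.C (c i) * Polynomial.X ^ (d - i)).degree < (d : WithBot ℕ) := by
      refine (Polynomial.degree_sum_le _ _).trans_lt ?_
      rw [Finset.sup_lt_iff (by exact_mod_cast WithBot.bot_lt_coe d)]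
      intro i hi
      rw [Finset.mem_Icc] at hi
      refine (Polynomial.degree_C_mul_X_pow_le _ _).trans_lt ?_
      have hlt : d - i < d := by omega
      exact WithBot.coe_lt_coe.mpr hlt
    refine ⟨_, Polynomial.monic_X_pow_add hdeg, ?_⟩
    have hc : ∀ i ∈ Finset.Icc 1 d,
        (Polynomial.monomial i (a i) : Polynomial A) * (Polynomial.monomial 1 h) ^ (d - i) =
          Polynomial.monomial d (a i * h ^ (d - i)) := by
      intro i hi
      rw [Finset.mem_Icc] at hi
      rw [Polynomial.monomial_pow, Polynomial.monomial_mul_monomial, one_mul,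
        show i + (d - i) = d by omega]
    have hh : Polynomial.eval₂ (algebraMap (reesAlgebra I) (Polynomial A))
        (Polynomial.monomial 1 h) (Polynomial.X ^ d +
          ∑ i ∈ Finset.Icc 1 d, Polynomial.C (c i) * Polynomial.X ^ (d - i)) =
        Polynomial.monomial d (h ^ d + ∑ i ∈ Finset.Icc 1 d, a i * h ^ (d - i)) := by
      rw [Polynomial.eval₂_add, Polynomial.eval₂_finsetSum, map_add, map_sum,
        ← Finset.sum_congr rfl hc]
      simp only [Polynomial.eval₂_pow, Polynomial.eval₂_X, Polynomial.eval₂_mul,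
        Polynomial.eval₂_C]
      congr 1
      rw [Polynomial.monomial_pow, one_mul]
    rw [hh, he, map_zero]
  · rintro ⟨p, hp, he⟩
    rcases subsingleton_or_nontrivial A with hA | hA
    · exact ⟨1, 0, le_rfl, fun i => Ideal.zero_mem _, Subsingleton.elim _ _⟩
    by_cases hd : p.natDegree = 0
    · rw [hp.natDegree_eq_zero.mp hd, Polynomial.eval₂_one] at he
      exact absurd he one_ne_zero
    · refine ⟨p.natDegree, fun i => (p.coeff (p.natDegree - i) : Polynomial A).coeff i,
        by omega, fun i => (p.coeff (p.natDegree - i)).2 i, ?_⟩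
      rw [Polynomial.eval₂_eq_sum_range] at he
      have := congrArg (fun q => Polynomial.coeff q p.natDegree) he
      simp only [Polynomial.finsetSum_coeff, Polynomial.monomial_pow, one_mul,
        Polynomial.coeff_zero] at this
      rw [Finset.sum_range_succ, Polynomial.Monic.coeff_natDegree hp, map_one, one_mul,
        Polynomial.coeff_monomial_same, add_comm] at this
      rw [← this]
      congr 1
      refine Finset.sum_bij' (fun i _ => p.natDegree - i) (fun i _ => p.natDegree - i)
        ?_ ?_ ?_ ?_ ?_
      · intro i hi; simp only [Finset.mem_Icc, Finset.mem_range] at *; omega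
      · intro i hi; simp only [Finset.mem_Icc, Finset.mem_range] at *; omega
      · intro i hi; simp only [Finset.mem_Icc] at hi; omega
      · intro i hi; simp only [Finset.mem_range] at hi; omega
      · intro i hi
        rw [Finset.mem_Icc] at hi
        have := Polynomial.coeff_mul_monomial (p.coeff (p.natDegree - i) : Polynomial A)
          (p.natDegree - i) i (h ^ (p.natDegree - i))
        rw [show i + (p.natDegree - i) = p.natDegree by omega] at this
        exact this.symm

/-- The integral closure of the ideal `I`. -/
def integralClosureIdeal (I : Ideal A) : Ideal A where
  carrier := {h | IsIntegralOverIdeal I h}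
  add_mem' {a b} ha hb := by
    simp only [Set.mem_ofPred_eq, isIntegralOverIdeal_iff] at *
    rw [map_add]
    exact ha.add hb
  zero_mem' := by
    simp only [Set.mem_ofPred_eq, isIntegralOverIdeal_iff, map_zero]
    exact isIntegral_zero
  smul_mem' c x hx := by
    simp only [Set.mem_ofPred_eq, isIntegralOverIdeal_iff] at *
    have : (Polynomial.monomial 1 (c • x) : Polynomial A) =
        algebraMap (reesAlgebra I) (Polynomial A) (algebraMap A _ c) *
          Polynomial.monomial 1 x := by
      rw [← IsScalarTower.algebraMap_apply, Polynomial.algebraMap_apply, Algebra.algebraMap_self,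
        RingHom.id_apply, Polynomial.C_mul_monomial, smul_eq_mul]
    rw [this]
    exact isIntegral_algebraMap.mul hx

theorem mem_integralClosureIdeal (I : Ideal A) (h : A) :
    h ∈ integralClosureIdeal I ↔ IsIntegralOverIdeal I h := Iff.rfl

/-- The grading of the Rees algebra `⨁ᵢ I ^ i tⁱ`: the piece of degree `i` is `I ^ i tⁱ`. -/
noncomputable def reesGrading (I : Ideal A) (i : ℕ) : Submodule A (reesAlgebra I) :=
  (LinearMap.range (Polynomial.monomial i : A →ₗ[A] Polynomial A)).comap
    (reesAlgebra I).val.toLinearMap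

theorem mem_reesGrading {I : Ideal A} {i : ℕ} {p : reesAlgebra I} :
    p ∈ reesGrading I i ↔ ∃ a, Polynomial.monomial i a = (p : Polynomial A) := Iff.rfl

/-- The homogeneous component of degree `i` of an element of the Rees algebra. -/
noncomputable def reesComponent (I : Ideal A) (p : reesAlgebra I) (i : ℕ) : reesGrading I i :=
  ⟨⟨Polynomial.monomial i ((p : Polynomial A).coeff i), reesAlgebra.monomial_mem.mpr (p.2 i)⟩,
    ⟨_, rfl⟩⟩

open scoped DirectSum in
noncomputable instance (I : Ideal A) : GradedAlgebra (reesGrading I) where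
  one_mem := ⟨1, rfl⟩
  mul_mem := by
    rintro i j p q ⟨a, ha⟩ ⟨b, hb⟩
    refine ⟨a * b, ?_⟩
    rw [← Polynomial.monomial_mul_monomial, ha, hb]
    rfl
  decompose' p := ∑ i ∈ (p : Polynomial A).support,
    DirectSum.of (fun i => reesGrading I i) i (reesComponent I p i)
  left_inv p := by
    apply Subtype.ext
    rw [map_sum, AddSubmonoidClass.coe_finsetSum]
    simp only [DirectSum.coeAddMonoidHom_of]
    exact (Polynomial.as_sum_support (p : Polynomial A)).symm
  right_inv x := by
    have key : ∀ p : reesAlgebra I, ∀ j : ℕ,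
        ((∑ i ∈ (p : Polynomial A).support,
          DirectSum.of (fun i => reesGrading I i) i (reesComponent I p i) :
            ⨁ i, reesGrading I i) j) = reesComponent I p j := by
      intro p j
      rw [DFinsupp.finsetSum_apply]
      by_cases hj : j ∈ (p : Polynomial A).support
      · rw [Finset.sum_eq_single j, DirectSum.of_eq_same]
        · intro b _ hb
          exact DirectSum.of_eq_of_ne _ _ _ hb.symm
        · exact fun h => absurd hj h
      · rw [Finset.sum_eq_zero]
        · apply Subtype.ext
          apply Subtype.ext
          simp [reesComponent, Polynomial.notMem_support_iff.mp hj]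
        · intro b hb
          refine DirectSum.of_eq_of_ne _ _ _ ?_
          rintro rfl
          exact hj hb
    refine DFinsupp.ext fun j => ?_
    refine (key _ j).trans ?_
    apply Subtype.ext
    apply Subtype.ext
    change Polynomial.monomial j
      (((DirectSum.coeAddMonoidHom (reesGrading I) x : reesAlgebra I) : Polynomial A).coeff j) =
        ((x j : reesAlgebra I) : Polynomial A)
    induction x using DirectSum.induction_on with
    | zero => simp
    | of i x =>
      rw [DirectSum.coeAddMonoidHom_of]
      obtain ⟨a, ha⟩ := x.2
      have ha' : (Polynomial.monomial i a : Polynomial A) = ((x : reesAlgebra I) : Polynomial A) :=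
        ha
      by_cases hij : i = j
      · subst hij
        rw [DirectSum.of_eq_same, ← ha', Polynomial.coeff_monomial_same]
      · rw [DirectSum.of_eq_of_ne _ _ _ (fun h => hij h.symm), ← ha',
          Polynomial.coeff_monomial_of_ne _ (fun h => hij h.symm)]
        simp
    | add x y hx hy =>
      rw [map_add, DirectSum.add_apply]
      push_cast
      rw [Polynomial.coeff_add, map_add, hx, hy]

end IntegralClosure

section Blowup

variable {R : CommRingCat.{u}}

/-- The blowup of `Spec R` in the ideal `I`: the `Proj` of the Rees algebra of `I`. -/
noncomputable def blowup (I : Ideal R) : Scheme.{u} := Proj (reesGrading I)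

/-- The structure morphism of the blowup. -/
noncomputable def blowupMap (I : Ideal R) : blowup I ⟶ Spec R :=
  Proj.toSpecZero (reesGrading I) ≫
    Spec.map (CommRingCat.ofHom (algebraMap R (reesGrading I 0)))

end Blowup

section BuchsbaumEisenbud

variable (R : Type u) [CommRing R] (n : ℕ)

/-- The bigraded module `⋀F ⊗ S(F)` for `F = Rⁿ`, where the symmetric algebra of `F` is the
polynomial ring in the basis `X_1, …, X_n`. -/
abbrev KoszulModule : Type u :=
  ExteriorAlgebra R (Fin n → R) ⊗[R] MvPolynomial (Fin n) R

/-- The part `⋀ⁱF ⊗ S_j F`. -/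
noncomputable def bidegree (i j : ℕ) : Submodule R (KoszulModule R n) :=
  LinearMap.range (TensorProduct.mapIncl (⋀[R]^i (Fin n → R))
    (MvPolynomial.homogeneousSubmodule (Fin n) R j))

/-- The natural (Koszul) map `⋀ⁱF ⊗ S_j F → ⋀ⁱ⁻¹F ⊗ S_{j+1} F`,
`w ⊗ s ↦ ∑ₐ (eₐ* ⌋ w) ⊗ Xₐ s`. -/
noncomputable def koszul : KoszulModule R n →ₗ[R] KoszulModule R n :=
  ∑ a : Fin n, TensorProduct.map
    (CliffordAlgebra.contractLeft (Q := (0 : QuadraticForm R (Fin n → R)))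
      (LinearMap.proj a : (Fin n → R) →ₗ[R] R))
    (LinearMap.mulLeft R (MvPolynomial.X a : MvPolynomial (Fin n) R))

variable {R n} (f : Fin n → R)

/-- Contraction of the exterior factor with the linear form `F → R`, `e_i ↦ f_i`. -/
noncomputable def contraction : KoszulModule R n →ₗ[R] KoszulModule R n :=
  TensorProduct.map
    (CliffordAlgebra.contractLeft (Q := (0 : QuadraticForm R (Fin n → R)))
      (Fintype.linearCombination R f))
    LinearMap.id

/-- On `⋀⁰F ⊗ S_k F = S_k F` this is the evaluation `X_i ↦ f_i`
(and it vanishes on `⋀ⁱF ⊗ S(F)` for `i > 0`). -/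
noncomputable def polyEval : KoszulModule R n →ₗ[R] R :=
  LinearMap.mul' R R ∘ₗ TensorProduct.map
    (ExteriorAlgebra.algebraMapInv (R := R) (M := Fin n → R)).toLinearMap
    (MvPolynomial.aeval f).toLinearMap

theorem contraction_koszul (x : KoszulModule R n) :
    contraction f (koszul R n x) = - koszul R n (contraction f x) := by
  induction x using TensorProduct.induction_on with
  | zero => simp
  | add x y hx hy => rw [map_add, map_add, hx, hy, map_add, map_add, neg_add]
  | tmul w s =>
    simp only [koszul, contraction, LinearMap.sum_apply, TensorProduct.map_tmul, map_sum,
      LinearMap.id_apply, ← Finset.sum_neg_distrib]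
    refine Finset.sum_congr rfl fun a _ => ?_
    rw [CliffordAlgebra.contractLeft_comm, TensorProduct.neg_tmul]

theorem contraction_contraction (x : KoszulModule R n) :
    contraction f (contraction f x) = 0 := by
  induction x using TensorProduct.induction_on with
  | zero => simp
  | add x y hx hy => rw [map_add, map_add, hx, hy, add_zero]
  | tmul w s =>
    simp only [contraction, TensorProduct.map_tmul, CliffordAlgebra.contractLeft_contractLeft,
      TensorProduct.zero_tmul]

theorem polyEval_koszul (x : KoszulModule R n) :
    polyEval f (koszul R n x) = polyEval f (contraction f x) := by
  induction x using TensorProduct.induction_on with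
  | zero => simp
  | add x y hx hy => simp only [map_add, hx, hy]
  | tmul w s =>
    have hf : Fintype.linearCombination R f =
        ∑ a, f a • (LinearMap.proj a : (Fin n → R) →ₗ[R] R) := by
      ext i
      simp [Fintype.linearCombination_apply, mul_comm]
    simp only [koszul, contraction, polyEval, LinearMap.sum_apply, TensorProduct.map_tmul,
      map_sum, LinearMap.coe_comp, Function.comp_apply, LinearMap.mul'_apply, hf,
      LinearMap.id_apply, LinearMap.mulLeft_apply, AlgHom.toLinearMap_apply, map_mul,
      MvPolynomial.aeval_X, Finset.sum_mul, map_smul, LinearMap.smul_apply, smul_eq_mul]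
    refine Finset.sum_congr rfl fun a _ => ?_
    ring

theorem contractLeft_mem (d : Module.Dual R (Fin n → R)) (i : ℕ)
    (w : ExteriorAlgebra R (Fin n → R)) (hw : w ∈ ⋀[R]^(i + 1) (Fin n → R)) :
    CliffordAlgebra.contractLeft (Q := (0 : QuadraticForm R (Fin n → R))) d w ∈
      ⋀[R]^i (Fin n → R) := by
  induction i generalizing w with
  | zero =>
    rw [ExteriorAlgebra.exteriorPower, zero_add, pow_one] at hw
    obtain ⟨v, rfl⟩ := hw
    rw [ExteriorAlgebra.exteriorPower, pow_zero]
    have := CliffordAlgebra.contractLeft_ι (Q := (0 : QuadraticForm R (Fin n → R))) d v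
    exact this ▸ Submodule.algebraMap_mem _
  | succ i ih =>
    rw [ExteriorAlgebra.exteriorPower, pow_succ'] at hw
    refine Submodule.mul_induction_on hw ?_ ?_
    · rintro _ ⟨v, rfl⟩ b hb
      have := CliffordAlgebra.contractLeft_ι_mul (Q := (0 : QuadraticForm R (Fin n → R))) d v b
      refine this ▸ Submodule.sub_mem _ (Submodule.smul_mem _ _ hb) ?_
      rw [ExteriorAlgebra.exteriorPower, pow_succ']
      exact Submodule.mul_mem_mul ⟨v, rfl⟩ (ih b hb)
    · intro x y hx hy
      rw [map_add]
      exact Submodule.add_mem _ hx hy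

theorem contraction_mem_bidegree (i j : ℕ) (x : KoszulModule R n)
    (hx : x ∈ bidegree R n (i + 1) j) : contraction f x ∈ bidegree R n i j := by
  obtain ⟨y, rfl⟩ := hx
  induction y using TensorProduct.induction_on with
  | zero => simp
  | add x y hx hy =>
    rw [map_add, map_add]
    exact Submodule.add_mem _ hx hy
  | tmul w s =>
    exact ⟨⟨_, contractLeft_mem (Fintype.linearCombination R f) i w.1 w.2⟩ ⊗ₜ s, rfl⟩

variable (R n) in
/-- `L_i^k(F)`, for `i ≥ 1`: the image of `⋀ⁱF ⊗ S_{k-1} F → ⋀ⁱ⁻¹F ⊗ S_k F`. -/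
noncomputable def beTerm (k i : ℕ) : Submodule R (KoszulModule R n) :=
  (bidegree R n i (k - 1)).map (koszul R n)

theorem contraction_mem_beTerm (k i : ℕ) (x : KoszulModule R n)
    (hx : x ∈ beTerm R n k (i + 1)) : contraction f x ∈ beTerm R n k i := by
  obtain ⟨y, hy, rfl⟩ := hx
  rw [contraction_koszul]
  exact Submodule.neg_mem _ ⟨_, contraction_mem_bidegree f _ _ _ hy, rfl⟩

variable (R n) in
/-- The terms `L_0 = R` and `L_i = L_i^k(F)` for `i ≥ 1` of the Buchsbaum-Eisenbud complex. -/
noncomputable def beX (k : ℕ) : ℕ → ModuleCat.{u} R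
  | 0 => ModuleCat.of R R
  | i + 1 => ModuleCat.of R (beTerm R n k (i + 1))

/-- The differentials of the Buchsbaum-Eisenbud complex. -/
noncomputable def beD (k : ℕ) : ∀ i : ℕ, beX R n k (i + 1) ⟶ beX R n k i
  | 0 => ModuleCat.ofHom (polyEval f ∘ₗ (beTerm R n k 1).subtype)
  | i + 1 => ModuleCat.ofHom ((contraction f).restrict (contraction_mem_beTerm f k (i + 1)))

theorem beD_comp (k i : ℕ) : beD f k (i + 1) ≫ beD f k i = 0 := by
  cases i with
  | zero =>
    ext ⟨x, hx⟩
    obtain ⟨y, hy, rfl⟩ := hx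
    change polyEval f (contraction f (koszul R n y)) = 0
    rw [contraction_koszul, map_neg, polyEval_koszul, contraction_contraction, map_zero, neg_zero]
  | succ i =>
    ext ⟨x, hx⟩
    exact Subtype.ext (contraction_contraction f x)

/-- The Buchsbaum-Eisenbud complex `L^k(f)`: `0 → L_n → ⋯ → L_2 → L_1 → R → 0`. -/
noncomputable def beChain (k : ℕ) : ChainComplex (ModuleCat.{u} R) ℕ :=
  ChainComplex.of (beX R n k) (beD f k) (beD_comp f k)

/-- The Buchsbaum-Eisenbud complex as a cochain complex, with `L_i` in degree `-i`. -/
noncomputable def beComplex (k : ℕ) : CochainComplex (ModuleCat.{u} R) ℤ :=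
  (beChain f k).extend ComplexShape.embeddingDownNat

/-- The inclusion `R → L^k(f)` of the term of degree `0`. -/
noncomputable def beUnit (k : ℕ) :
    (HomologicalComplex.single (ModuleCat.{u} R) (ComplexShape.up ℤ) 0).obj (ModuleCat.of R R) ⟶
      beComplex f k :=
  HomologicalComplex.mkHomFromSingle
    ((beChain f k).extendXIso ComplexShape.embeddingDownNat (i := 0) (i' := 0) (by simp)).inv
    (fun j hj => ((beChain f k).isZero_extend_X ComplexShape.embeddingDownNat j (fun i hi => by
      simp at hi hj
      omega)).eq_of_tgt _ _)

end BuchsbaumEisenbud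

section IdealSheaf

variable {R : CommRingCat.{u}} {Y : Scheme.{u}} (p : Y ⟶ Spec R)

/-- The ring homomorphism `R → Γ(Y, U)`. -/
noncomputable def toSections (U : Y.Opens) : R →+* Γ(Y, U) :=
  ((Scheme.ΓSpecIso R).inv ≫ p.appTop ≫ Y.presheaf.map (homOfLE le_top).op).hom

/-- The ring homomorphism `R → Γ(Y, 𝒪_Y)`. -/
noncomputable def toGlobalSections : R →+* Y.ringCatSheaf.obj.obj (.op ⊤) := toSections p ⊤

/-- The ring homomorphism `R → 𝒪_{Y,y}`. -/
noncomputable def toStalk (y : Y) : R →+* Y.presheaf.stalk y :=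
  ((Scheme.ΓSpecIso R).inv ≫ p.appTop ≫ Y.presheaf.germ ⊤ y trivial).hom

/-- The sections over `U` of the ideal sheaf `I·𝒪_Y`: the sections of `𝒪_Y` whose germ at each
point `y` lies in `I·𝒪_{Y,y}`. -/
noncomputable def idealSections (I : Ideal R) (U : Y.Opens) : Ideal Γ(Y, U) where
  carrier := {s | ∀ (y : Y) (hy : y ∈ U), Y.presheaf.germ U y hy s ∈ I.map (toStalk p y)}
  add_mem' ha hb y hy := by
    rw [map_add]
    exact Ideal.add_mem _ (ha y hy) (hb y hy)
  zero_mem' y hy := by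
    rw [map_zero]
    exact Ideal.zero_mem _
  smul_mem' c s hs y hy := by
    rw [smul_eq_mul, map_mul]
    exact Ideal.mul_mem_left _ _ (hs y hy)

/-- `I·𝒪_Y` as a sub-presheaf of modules of `𝒪_Y`. -/
noncomputable def idealSubmodule (I : Ideal R) :
    PresheafOfModules.Submodule (PresheafOfModules.unit Y.ringCatSheaf.obj) where
  obj U := idealSections p I U.unop
  map {U V} i s hs y hy := by
    have := TopCat.Presheaf.germ_res_apply' Y.presheaf i y hy s
    exact this ▸ hs y (i.unop.le hy)

theorem isSheaf_idealSubmodule (I : Ideal R) :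
    TopCat.Presheaf.IsSheaf (X := Y.toTopCat)
      (idealSubmodule p I).toPresheafOfModules.presheaf := by
  rw [TopCat.Presheaf.isSheaf_iff_isSheafUniqueGluing]
  intro ι U sf hsf
  obtain ⟨s, hs, huniq⟩ := TopCat.Sheaf.existsUnique_gluing Y.sheaf U (fun i => (sf i).1)
    (fun i j => congrArg Subtype.val (hsf i j))
  have hmem : s ∈ idealSections p I (iSup U) := by
    intro y hy
    obtain ⟨i, hi⟩ := TopologicalSpace.Opens.mem_iSup.mp hy
    have h1 := TopCat.Presheaf.germ_res_apply Y.presheaf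
      (TopologicalSpace.Opens.leSupr U i) y hi s
    have h2 : Y.presheaf.map (TopologicalSpace.Opens.leSupr U i).op s = (sf i).1 := hs i
    rw [h2] at h1
    exact h1 ▸ (sf i).2 y hi
  refine ⟨⟨s, hmem⟩, fun i => Subtype.ext (hs i), fun t ht => Subtype.ext ?_⟩
  exact huniq t.1 fun i => congrArg Subtype.val (ht i)

/-- The ideal sheaf `I·𝒪_Y`, as a sheaf of `𝒪_Y`-modules. -/
noncomputable def idealSheaf (I : Ideal R) : Y.Modules where
  val := (idealSubmodule p I).toPresheafOfModules
  isSheaf := isSheaf_idealSubmodule p I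

/-- The structure sheaf of `Y` as a sheaf of modules over itself. -/
noncomputable abbrev structureSheaf (Y : Scheme.{u}) : Y.Modules :=
  SheafOfModules.unit Y.ringCatSheaf

/-- The inclusion `I·𝒪_Y → 𝒪_Y`. -/
noncomputable def idealSheafι (I : Ideal R) : idealSheaf p I ⟶ structureSheaf Y :=
  SheafOfModules.Hom.mk (idealSubmodule p I).ι

/-- `I·𝒪_Y` is the ideal sheaf `𝒪_Y(-E)` of an effective Cartier divisor `E`: locally, it is
generated by one nonzerodivisor. -/
def IsEffectiveCartier (I : Ideal R) : Prop :=
  ∀ y : Y, ∃ U : Y.affineOpens, y ∈ U.1 ∧ ∃ g ∈ nonZeroDivisors Γ(Y, U.1),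
    I.map (toSections p U.1) = Ideal.span {g}

/-- `𝒪_Y(-m E)`, where `E` is the effective Cartier divisor with `J·𝒪_Y = 𝒪_Y(-E)`:
this is the power `(J·𝒪_Y) ^ m = J ^ m·𝒪_Y`. -/
noncomputable abbrev minusTwist (J : Ideal R) (m : ℕ) : Y.Modules := idealSheaf p (J ^ m)

/-- The canonical inclusion `𝒪_Y(-m E) → 𝒪_Y`. -/
noncomputable abbrev minusTwistι (J : Ideal R) (m : ℕ) : minusTwist p J m ⟶ structureSheaf Y :=
  idealSheafι p (J ^ m)

end IdealSheaf

section SheafLevel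

variable {R : CommRingCat.{u}} {Y : Scheme.{u}} (p : Y ⟶ Spec R)

/-- The functor `M ↦ M ⊗_R 𝒪_Y = p^*(M~)`. -/
noncomputable def tensorStructureSheaf : ModuleCat.{u} R ⥤ Y.Modules :=
  tilde.functor R ⋙ Scheme.Modules.pullback p

instance : (tensorStructureSheaf p).Additive := by
  unfold tensorStructureSheaf
  infer_instance

theorem opensMap_final {X Z : Scheme.{u}} (g : X ⟶ Z) :
    (TopologicalSpace.Opens.map g.base).Final where
  out U := by
    have : Nonempty (StructuredArrow U (TopologicalSpace.Opens.map g.base)) :=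
      ⟨StructuredArrow.mk (Y := ⊤) (homOfLE le_top)⟩
    refine zigzag_isConnected fun a b => ?_
    have h (c : StructuredArrow U (TopologicalSpace.Opens.map g.base)) :
        c ⟶ StructuredArrow.mk (Y := ⊤) (homOfLE le_top) :=
      StructuredArrow.homMk (homOfLE le_top) (Subsingleton.elim _ _)
    exact (Zigzag.of_hom (h a)).trans (Zigzag.of_inv (h b))

/-- The canonical isomorphism `R ⊗_R 𝒪_Y ≅ 𝒪_Y`. -/
noncomputable def tensorStructureSheafSelf :
    (tensorStructureSheaf p).obj (ModuleCat.of R R) ≅ structureSheaf Y :=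
  haveI : (SheafOfModules.pushforward.{u} p.toRingCatSheafHom).IsRightAdjoint :=
    inferInstanceAs (Scheme.Modules.pushforward p).IsRightAdjoint
  haveI := opensMap_final p
  (Scheme.Modules.pullback p).mapIso tildeSelf ≪≫
    (@asIso _ _ _ _ (SheafOfModules.pullbackObjUnitToUnit p.toRingCatSheafHom)
      (@SheafOfModules.instIsIsoPullbackObjUnitToUnitOfFinal
        _ _ _ _ _ _ _ _ _ _ p.toRingCatSheafHom _ _) :)

/-- The complex `L ⊗_R 𝒪_Y` of sheaves of modules, for a complex of `R`-modules `L`. -/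
noncomputable def complexTensorStructureSheaf (L : CochainComplex (ModuleCat.{u} R) ℤ) :
    CochainComplex Y.Modules ℤ :=
  ((tensorStructureSheaf p).mapHomologicalComplex (ComplexShape.up ℤ)).obj L

/-- For a map `e : R → L` of complexes, the composite `F → 𝒪_Y ≅ R ⊗ 𝒪_Y → L ⊗ 𝒪_Y`, where `F` is
placed in degree `0`. -/
noncomputable def sheafLevelMap {L : CochainComplex (ModuleCat.{u} R) ℤ}
    (e : (HomologicalComplex.single (ModuleCat.{u} R) (ComplexShape.up ℤ) 0).obj
      (ModuleCat.of R R) ⟶ L) {F : Y.Modules} (i : F ⟶ structureSheaf Y) :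
    (HomologicalComplex.single Y.Modules (ComplexShape.up ℤ) 0).obj F ⟶
      complexTensorStructureSheaf p L :=
  (HomologicalComplex.single Y.Modules (ComplexShape.up ℤ) 0).map
      (i ≫ (tensorStructureSheafSelf p).inv) ≫
    (HomologicalComplex.singleMapHomologicalComplex (tensorStructureSheaf p)
      (ComplexShape.up ℤ) 0).inv.app (ModuleCat.of R R) ≫
    ((tensorStructureSheaf p).mapHomologicalComplex (ComplexShape.up ℤ)).map e

end SheafLevel

section DerivedGlobalSections

variable {R : CommRingCat.{u}} {Y : Scheme.{u}} (p : Y ⟶ Spec R)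

/-- A sheaf of `𝒪_Y`-modules, seen as a sheaf of `R`-modules. -/
noncomputable def toSheafOfRModules : Y.Modules ⥤ TopCat.Sheaf (ModuleCat.{u} R) Y :=
  SheafOfModules.forgetToSheafModuleCat Y.ringCatSheaf (.op ⊤)
    (initialOpOfTerminal isTerminalTop) ⋙
  sheafCompose _ (ModuleCat.restrictScalars.{u}
    (toGlobalSections p))

/-- The global sections functor `Γ(Y, -)` on sheaves of `R`-modules. -/
noncomputable def globalSections (R : CommRingCat.{u}) (Y : Scheme.{u}) :
    TopCat.Sheaf (ModuleCat.{u} R) Y ⥤ ModuleCat.{u} R :=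
  TopCat.Sheaf.forget _ _ ⋙ (CategoryTheory.evaluation _ _).obj (.op ⊤)

instance (R : CommRingCat.{u}) (Y : Scheme.{u}) : (globalSections R Y).Additive where
  map_add := rfl

variable [HasDerivedCategory.{w} (ModuleCat.{u} R)]
  [HasDerivedCategory.{w'} (TopCat.Sheaf (ModuleCat.{u} R) Y)]

/-- `RΓ(Y, F)` in the derived category of `R`-modules, for a sheaf of `𝒪_Y`-modules `F`: the total
right derived functor of the global sections functor, applied to `F` in degree `0`. -/
noncomputable def RΓ : Y.Modules ⥤ DerivedCategory (ModuleCat.{u} R) :=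
  toSheafOfRModules p ⋙ DerivedCategory.Plus.singleFunctor _ 0 ⋙
    (globalSections R Y).rightDerivedFunctorPlus ⋙ DerivedCategory.Plus.ι

end DerivedGlobalSections

section DerivedTensor

open MonoidalCategory

variable {R : CommRingCat.{u}} [HasDerivedCategory.{w} (ModuleCat.{u} R)]
  (L : CochainComplex (ModuleCat.{u} R) ℤ)

/-- The functor `C ↦ L ⊗_R C` from complexes to the derived category. -/
noncomputable def tensorComplex :
    CochainComplex (ModuleCat.{u} R) ℤ ⥤ DerivedCategory (ModuleCat.{u} R) :=
  tensorLeft L ⋙ DerivedCategory.Q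

/-- The total left derived functor of `C ↦ L ⊗_R C` exists. -/
abbrev HasDerivedTensor : Prop :=
  (tensorComplex L).HasLeftDerivedFunctor
    (HomologicalComplex.quasiIso (ModuleCat.{u} R) (ComplexShape.up ℤ))

variable [HasDerivedTensor L]

/-- The derived tensor product `L ⊗ᴸ_R -`, as the total left derived functor of `L ⊗_R -`. -/
noncomputable def derivedTensor :
    DerivedCategory (ModuleCat.{u} R) ⥤ DerivedCategory (ModuleCat.{u} R) :=
  (tensorComplex L).totalLeftDerived DerivedCategory.Q
    (HomologicalComplex.quasiIso (ModuleCat.{u} R) (ComplexShape.up ℤ))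

variable {L} in
/-- For a map `e : R → L` of complexes, the canonical map
`X = R ⊗ᴸ_R X → L ⊗ᴸ_R X`. It is the natural transformation
induced by the maps of complexes `C ≅ R ⊗_R C → L ⊗_R C`. -/
noncomputable def toDerivedTensor (e : 𝟙_ (CochainComplex (ModuleCat.{u} R) ℤ) ⟶ L) :
    𝟭 (DerivedCategory (ModuleCat.{u} R)) ⟶ derivedTensor L :=
  Functor.leftDerivedLift _
    ((tensorComplex L).totalLeftDerivedCounit DerivedCategory.Q
      (HomologicalComplex.quasiIso (ModuleCat.{u} R) (ComplexShape.up ℤ)))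
    (HomologicalComplex.quasiIso (ModuleCat.{u} R) (ComplexShape.up ℤ)) _
    (Functor.whiskerRight ((leftUnitorNatIso _).inv ≫ (curriedTensor _).map e) DerivedCategory.Q)

end DerivedTensor

section CanonicalMap

variable {R : CommRingCat.{u}} {Y : Scheme.{u}} (p : Y ⟶ Spec R)
  [HasDerivedCategory.{w} (ModuleCat.{u} R)]
  [HasDerivedCategory.{w'} (TopCat.Sheaf (ModuleCat.{u} R) Y)]

/-- For maps `e : R → L` and `i : F → 𝒪_Y`, the composite
`RΓ(Y, F) → RΓ(Y, 𝒪_Y) → L ⊗ᴸ_R RΓ(Y, 𝒪_Y)`. -/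
noncomputable def derivedMap {L : CochainComplex (ModuleCat.{u} R) ℤ} [HasDerivedTensor L]
    (e : (HomologicalComplex.single (ModuleCat.{u} R) (ComplexShape.up ℤ) 0).obj
      (ModuleCat.of R R) ⟶ L) {F : Y.Modules} (i : F ⟶ structureSheaf Y) :
    (RΓ p).obj F ⟶ (derivedTensor L).obj ((RΓ p).obj (structureSheaf Y)) :=
  (RΓ p).map i ≫ (toDerivedTensor e).app _

end CanonicalMap

section Main

variable {R : CommRingCat.{u}} {n : ℕ} (f : Fin n → R) (k : ℕ)

/-- The ideal `J = (f_1, …, f_n)`. -/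
abbrev idealJ : Ideal R := Ideal.span (Set.range f)

/-- `Y`: the blowup of the integral closure of `J ^ (n + k - 1)`. -/
noncomputable abbrev schemeY : Scheme.{u} :=
  blowup (integralClosureIdeal (idealJ f ^ (n + k - 1)))

/-- The structure morphism `π : Y → Spec R`. -/
noncomputable abbrev mapπ : schemeY f k ⟶ Spec R :=
  blowupMap (integralClosureIdeal (idealJ f ^ (n + k - 1)))

end Main

end BrianconSkoda

open BrianconSkoda

/-! Write L for the Buchsbaum–Eisenbud complex and give it the weights w(0) = n+k-1 and w(-i) = n-i
for 1 ≤ i ≤ n. The differential L_1 → R has values in J^k and the other differentials have values in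
J times their targets, so the modules J^{w(q)} L^q form a subcomplex. Let M be its image in L ⊗ 𝒪_Y.
In degree 0 it is J^{n+k-1}𝒪_Y = 𝒪_Y(-(n+k-1)E), so the map in question factors through M. An
acyclic complex is zero in the derived category; hence everything rests on the acyclicity of M.

Acyclicity is local, and Y is covered by charts on which one f_a is a nonzerodivisor dividing every
f_j. There one has to write a cycle f_a^{w(q)} z as d(f_a^{w(q-1)} y). It suffices that some power
f_a^c on L^q equals ds + td with s in J^e Hom and c + w(q-1) ≤ e + w(q): then f_a^c z = d(sz), sz is
divisible by f_a^e, and f_a^c can be cancelled. This is `IsWeightedContractible`, used in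
`IsWeightedContractible.exists_eq_d` and `IsWeightedContractible.exactAt_of_factorization`.

The homotopies come from explicit operators on ⋀F ⊗ S(F). By exactness of the Koszul complex, the
terms of L are kernels of the Koszul differential κ (`mem_beTerm_iff`). For b ≠ a there is an
operator s_a with f_b - [d, s_a] = f_b·(projection omitting X_a and e_a) + f_a·(substitution of b
for a) on ker κ, where [d, s] = ds + sd. The left side has coefficients in J, and the substitution
is nilpotent. Taking k+2 such factors for each a ≠ b gives an operator homotopic to f_b^r, with
coefficients in J^r, whose values involve the index b only. Inside ker κ such values vanish in
positive exterior degree and are multiples of X_b^k in exterior degree 0. The homotopy loses a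
single power of J, which is what the weights allow (`exists_homotopy_wordOp`,
`beHomotopy_succ_succ`, `beHomotopy_one`).

For RΓ the same factorization is made in sheaves of R-modules. Since L is a bounded complex of
finite projectives, L ⊗ - preserves quasi-isomorphisms, so the derived tensor product exists and is
the naive one. If I is an injective resolution of 𝒪_Y, then L ⊗ I is again a bounded below complex
of injective sheaves with sections L ⊗ I(V). The map 𝒪_Y(-(n+k-1)E) → L ⊗ I factors through an
acyclic complex by comparison with L ⊗ 𝒪_Y, and its vanishing passes through the right derived
functor of Γ (`exists_iso_rightDerivedFunctorPlus`, `IsChartCover.derivedMap_eq_zero`). -/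

namespace BrianconSkoda

/-! ### Operator calculus of the Koszul complex, from generators and relations -/

section KoszulRelations

variable {A : Type*} [Ring A] {n : ℕ}

/-- The relations between contractions `D`, exterior multiplications `E`, multiplications by
variables `X` and divisions by variables `Q`. -/
structure KoszulRel (D E X Q : Fin n → A) : Prop where
  dd a b : D a * D b = -(D b * D a)
  -- Not a consequence of `dd`, which only gives twice this relation; the same holds for `e_sq` and
  -- `ee`.
  d_sq a : D a * D a = 0
  ee a b : E a * E b = -(E b * E a)
  e_sq a : E a * E a = 0
  de_same a : D a * E a = 1 - E a * D a
  de_ne a b : a ≠ b → D a * E b = -(E b * D a)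
  dx a b : Commute (D a) (X b)
  dq a b : Commute (D a) (Q b)
  ex a b : Commute (E a) (X b)
  eq a b : Commute (E a) (Q b)
  xx a b : Commute (X a) (X b)
  qq a b : Commute (Q a) (Q b)
  qx_same a : Q a * X a = 1
  qx_ne a b : a ≠ b → Commute (Q a) (X b)

namespace KoszulRel

variable {D E X Q : Fin n → A}

/-- The Koszul differential. -/
abbrev kap (D X : Fin n → A) : A := ∑ a, D a * X a

/-- The projection omitting an exterior basis vector. -/
abbrev rho (D E : Fin n → A) (a : Fin n) : A := D a * E a

/-- The remainder of the division by a variable. -/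
abbrev tau (X Q : Fin n → A) (a : Fin n) : A := 1 - X a * Q a

/-- The projection omitting a variable of the Koszul complex. -/
abbrev prj (D E X Q : Fin n → A) (a : Fin n) : A := rho D E a * tau X Q a

variable (h : KoszulRel D E X Q)
include h

theorem tau_x (a) : tau X Q a * X a = 0 := by
  rw [tau, sub_mul, one_mul, mul_assoc, h.qx_same, mul_one, sub_self]

theorem q_tau (a) : Q a * tau X Q a = 0 := by
  rw [tau, mul_sub, mul_one, ← mul_assoc, h.qx_same, one_mul, sub_self]

theorem tau_sq (a) : tau X Q a * tau X Q a = tau X Q a := by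
  nth_rw 2 [tau]
  rw [mul_sub, ← mul_assoc, h.tau_x, mul_one, zero_mul, sub_zero]

theorem rho_d (a) : rho D E a * D a = D a := by
  rw [rho, h.de_same, sub_mul, one_mul, mul_assoc, h.d_sq, mul_zero, sub_zero]

theorem d_rho (a) : D a * rho D E a = 0 := by
  rw [rho, ← mul_assoc, h.d_sq, zero_mul]

theorem rho_e (a) : rho D E a * E a = 0 := by
  rw [rho, mul_assoc, h.e_sq, mul_zero]

theorem rho_sq (a) : rho D E a * rho D E a = rho D E a := by
  nth_rw 2 [rho]
  rw [← mul_assoc, h.rho_d]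

theorem commute_rho_d {a b : Fin n} (hab : a ≠ b) : Commute (rho D E a) (D b) := by
  have h1 := h.de_ne b a hab.symm
  rw [commute_iff_eq, rho, mul_assoc, ← neg_eq_iff_eq_neg.mpr h1, mul_neg, ← mul_assoc,
    ← mul_assoc, h.dd a b, neg_mul, neg_neg]

theorem commute_rho_e {a b : Fin n} (hab : a ≠ b) : Commute (rho D E a) (E b) := by
  rw [commute_iff_eq, rho, mul_assoc, h.ee a b, mul_neg, ← mul_assoc, h.de_ne a b hab, neg_mul,
    neg_neg, mul_assoc]

theorem commute_rho_rho (a b : Fin n) : Commute (rho D E a) (rho D E b) := by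
  by_cases hab : a = b
  · rw [hab]
  · exact (h.commute_rho_d hab).mul_right (h.commute_rho_e hab)

theorem commute_tau_x {a b : Fin n} (hab : a ≠ b) : Commute (tau X Q a) (X b) :=
  (Commute.one_left _).sub_left ((h.xx a b).mul_left (h.qx_ne a b hab))

theorem commute_tau_q {a b : Fin n} (hab : a ≠ b) : Commute (tau X Q a) (Q b) :=
  (Commute.one_left _).sub_left ((h.qx_ne b a hab.symm).symm.mul_left (h.qq a b))

theorem commute_tau_tau (a b : Fin n) : Commute (tau X Q a) (tau X Q b) := by
  by_cases hab : a = b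
  · rw [hab]
  · exact (Commute.one_right _).sub_right ((h.commute_tau_x hab).mul_right (h.commute_tau_q hab))

theorem commute_d_tau (a b : Fin n) : Commute (D a) (tau X Q b) :=
  (Commute.one_right _).sub_right ((h.dx a b).mul_right (h.dq a b))

theorem commute_e_tau (a b : Fin n) : Commute (E a) (tau X Q b) :=
  (Commute.one_right _).sub_right ((h.ex a b).mul_right (h.eq a b))

theorem commute_rho_tau (a b : Fin n) : Commute (rho D E a) (tau X Q b) :=
  (h.commute_d_tau a b).mul_left (h.commute_e_tau a b)

theorem commute_rho_x (a b : Fin n) : Commute (rho D E a) (X b) :=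
  (h.dx a b).mul_left (h.ex a b)

theorem commute_rho_q (a b : Fin n) : Commute (rho D E a) (Q b) :=
  (h.dq a b).mul_left (h.eq a b)

theorem prj_sq (a) : prj D E X Q a * prj D E X Q a = prj D E X Q a := by
  rw [prj, (h.commute_rho_tau a a).symm.mul_mul_mul_comm, h.rho_sq, h.tau_sq]

theorem commute_prj (a b : Fin n) : Commute (prj D E X Q a) (prj D E X Q b) :=
  ((h.commute_rho_rho a b).mul_right (h.commute_rho_tau a b)).mul_left
    ((h.commute_rho_tau b a).symm.mul_right (h.commute_tau_tau a b))

theorem kap_sq : kap D X * kap D X = 0 := by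
  have anti (a b : Fin n) : D a * X a * (D b * X b) = - (D b * X b * (D a * X a)) := by
    rw [(h.dx b a).symm.mul_mul_mul_comm, (h.dx a b).symm.mul_mul_mul_comm, h.dd a b,
      (h.xx a b).eq, neg_mul]
  have key (s : Finset (Fin n)) : (∑ a ∈ s, D a * X a) * (∑ a ∈ s, D a * X a) = 0 := by
    induction s using Finset.induction_on with
    | empty => simp
    | insert a s ha ih =>
      rw [Finset.sum_insert ha, add_mul, mul_add, mul_add, ih, Finset.mul_sum, Finset.sum_mul,
        (h.dx a a).symm.mul_mul_mul_comm, h.d_sq, Finset.sum_congr rfl fun b _ => anti a b,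
        Finset.sum_neg_distrib, zero_mul]
      abel
  exact key _

theorem kap_e (a) : kap D X * E a + E a * kap D X = X a := by
  rw [kap, Finset.sum_mul, Finset.mul_sum, ← Finset.sum_add_distrib, Finset.sum_eq_single a]
  · rw [mul_assoc, ← (h.ex a a).eq, ← mul_assoc, ← mul_assoc, ← add_mul, h.de_same,
      sub_add_cancel, one_mul]
  · intro b _ hb
    rw [mul_assoc, ← (h.ex a b).eq, ← mul_assoc, ← mul_assoc, ← add_mul, h.de_ne b a hb,
      neg_add_cancel, zero_mul]
  · simp

theorem kap_q (a) : kap D X * Q a = Q a * kap D X - D a * tau X Q a := by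
  rw [eq_sub_iff_add_eq, ← eq_sub_iff_add_eq', kap, Finset.sum_mul, Finset.mul_sum,
    ← Finset.sum_sub_distrib, Finset.sum_eq_single a]
  · rw [← mul_assoc, ← (h.dq a a).eq, mul_assoc, mul_assoc, h.qx_same, tau, mul_sub]
  · intro b _ hb
    rw [← mul_assoc, ← (h.dq b a).eq, mul_assoc, mul_assoc, (h.qx_ne a b hb.symm).eq, sub_self]
  · simp

/-- The Koszul complex is a tensor product of one-variable complexes. Dividing by X_a and wedging
with e_a contracts the a-th factor onto its part without X_a and e_a. -/
theorem kap_eq (a) : kap D X * (E a * Q a) + E a * Q a * kap D X = 1 - prj D E X Q a := by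
  have h1 := h.kap_e a
  rw [← mul_assoc, eq_sub_of_add_eq h1, sub_mul, mul_assoc, h.kap_q, prj, rho, h.de_same, tau]
  have h2 := (h.commute_d_tau a a).eq
  have h3 : X a * Q a = 1 - tau X Q a := by rw [tau, sub_sub_cancel]
  rw [h3]
  simp only [tau]
  noncomm_ring

/-- The projection is homotopic to the identity and κ² = 0. -/
theorem commute_prj_kap (a : Fin n) : Commute (prj D E X Q a) (kap D X) := by
  have h0 := h.kap_eq a
  have h1 := congrArg (kap D X * ·) h0
  have h2 := congrArg (· * kap D X) h0
  simp only [mul_add, add_mul, ← mul_assoc, h.kap_sq, zero_mul, zero_add] at h1 h2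
  rw [mul_assoc _ (kap D X) (kap D X), h.kap_sq, mul_zero, add_zero] at h2
  rw [h1, mul_sub, sub_mul, mul_one, one_mul] at h2
  exact (sub_right_injective h2).symm

omit h in
/-- A homotopy of the Koszul complex in several variables. -/
def hty (D E X Q : Fin n → A) : List (Fin n) → A
  | [] => 0
  | a :: l => E a * Q a + prj D E X Q a * hty D E X Q l

/-- The one-variable contractions are performed one after the other; they fit together because each
projection commutes with κ. For the list of all variables this gives exactness in positive
polynomial degree. -/
theorem kap_hty (l : List (Fin n)) :
    kap D X * hty D E X Q l + hty D E X Q l * kap D X = 1 - (l.map (prj D E X Q)).prod := by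
  induction l with
  | nil => simp [hty]
  | cons a l ih =>
    have h1 : kap D X * (prj D E X Q a * hty D E X Q l) =
        prj D E X Q a * (kap D X * hty D E X Q l) := by
      rw [← mul_assoc, ← (h.commute_prj_kap a).eq, mul_assoc]
    rw [hty, mul_add, add_mul, h1, List.map_cons, List.prod_cons, mul_assoc (prj D E X Q a),
      add_add_add_comm, h.kap_eq, ← mul_add, ih, mul_sub, mul_one]
    abel

omit h in
/-- The operator which substitutes the variable `b` for the variable `a` once. -/
abbrev sbt (D E X Q : Fin n → A) (b a : Fin n) : A := X b * Q a + E b * D a * tau X Q a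

/-- Both summands of the substitution start by looking for X_a or e_a, and the projection leaves
neither. -/
theorem sbt_prj {a b : Fin n} : sbt D E X Q b a * prj D E X Q a = 0 := by
  have h1 : Q a * (rho D E a * tau X Q a) = 0 := by
    rw [← mul_assoc, ← (h.commute_rho_q a a).eq, mul_assoc, h.q_tau, mul_zero]
  have h2 : D a * tau X Q a * (rho D E a * tau X Q a) = 0 := by
    rw [(h.commute_rho_tau a a).symm.mul_mul_mul_comm, h.d_rho, zero_mul]
  rw [add_mul, mul_assoc, h1, mul_assoc (E b), mul_assoc (E b), h2, mul_zero, mul_zero, add_zero]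

/-- Write the substitution as x + y with x = X_b Q_a and y = E_b D_a τ_a. Then y² = 0, since e_a can
be replaced only once, and xy = 0, since Q_a τ_a = 0. So the (m+1)-st power is x^{m+1} + y x^m, and
both terms begin with m divisions by X_a. -/
theorem sbt_pow {a b : Fin n} (hab : a ≠ b) (m : ℕ) :
    ∃ y, sbt D E X Q b a ^ (m + 1) = y * Q a ^ m := by
  have hx : Commute (X b) (Q a) := (h.qx_ne a b hab).symm
  set x := X b * Q a with hx0
  set y := E b * D a * tau X Q a with hy0
  have hy2 : y * y = 0 := by
    have e1 : Commute (E b * D a) (tau X Q a) := (h.commute_e_tau b a).mul_left (h.commute_d_tau a a)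
    rw [hy0, e1.symm.mul_mul_mul_comm, mul_assoc (E b), ← mul_assoc (D a), h.de_ne a b hab,
      neg_mul, mul_assoc (E b) (D a) (D a), h.d_sq]
    simp
  have hxy : x * y = 0 := by
    have e1 : Commute (Q a) (E b * D a) := (h.eq b a).symm.mul_right (h.dq a a).symm
    rw [hx0, hy0, mul_assoc (X b), ← mul_assoc (Q a), e1.eq, mul_assoc (E b * D a), h.q_tau]
    simp
  have key (m : ℕ) : (x + y) ^ (m + 1) = x ^ (m + 1) + y * x ^ m := by
    induction m with
    | zero => simp
    | succ m ih =>
      rw [pow_succ', ih, add_mul, mul_add, mul_add, ← mul_assoc x y, hxy, ← mul_assoc y y, hy2,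
        ← pow_succ']
      simp
  refine ⟨X b ^ (m + 1) * Q a + y * X b ^ m, ?_⟩
  rw [key, hx0, hx.mul_pow, hx.mul_pow, add_mul, mul_assoc _ (Q a), ← pow_succ', mul_assoc y]

theorem commute_prj_sbt {a b c : Fin n} (hca : c ≠ a) (hcb : c ≠ b) :
    Commute (prj D E X Q c) (sbt D E X Q b a) := by
  have hr : Commute (rho D E c) (sbt D E X Q b a) :=
    ((h.commute_rho_x c b).mul_right (h.commute_rho_q c a)).add_right
      (((h.commute_rho_e hcb).mul_right (h.commute_rho_d hca)).mul_right (h.commute_rho_tau c a))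
  have ht : Commute (tau X Q c) (sbt D E X Q b a) :=
    ((h.commute_tau_x hcb).mul_right (h.commute_tau_q hca)).add_right
      (((h.commute_e_tau b c).symm.mul_right (h.commute_d_tau a c).symm).mul_right
        (h.commute_tau_tau c a))
  exact hr.mul_left ht

section Contraction

variable {S : Type*} [CommRing S] [Algebra S A] (f : Fin n → S)

omit h in
/-- Contraction with the linear form with coefficients `f`. -/
abbrev ctr (D : Fin n → A) (f : Fin n → S) : A := ∑ a, f a • D a

theorem ctr_e (a) : ctr D f * E a = algebraMap S A (f a) - E a * ctr D f := by
  rw [eq_sub_iff_add_eq, ctr, Finset.sum_mul, Finset.mul_sum, ← Finset.sum_add_distrib,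
    Finset.sum_eq_single a]
  · rw [smul_mul_assoc, mul_smul_comm, ← smul_add, h.de_same, sub_add_cancel,
      Algebra.algebraMap_eq_smul_one]
  · intro b _ hb
    rw [smul_mul_assoc, mul_smul_comm, ← smul_add, h.de_ne b a hb, neg_add_cancel, smul_zero]
  · simp

theorem commute_ctr_x (a) : Commute (ctr D f) (X a) :=
  Commute.sum_left _ _ _ fun b _ => (h.dx b a).smul_left _

theorem commute_ctr_q (a) : Commute (ctr D f) (Q a) :=
  Commute.sum_left _ _ _ fun b _ => (h.dq b a).smul_left _

theorem ctr_kap : ctr D f * kap D X = - (kap D X * ctr D f) := by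
  have hd (a : Fin n) : ctr D f * D a = - (D a * ctr D f) := by
    rw [ctr, Finset.sum_mul, Finset.mul_sum, ← Finset.sum_neg_distrib]
    refine Finset.sum_congr rfl fun b _ => ?_
    rw [smul_mul_assoc, mul_smul_comm, h.dd b a, smul_neg]
  rw [kap, Finset.mul_sum, Finset.sum_mul, ← Finset.sum_neg_distrib]
  refine Finset.sum_congr rfl fun b _ => ?_
  rw [← mul_assoc, hd, mul_assoc, ← (h.commute_ctr_x f b).eq, neg_mul, mul_assoc]

omit h in
/-- The homotopy which substitutes the variable `b` for the variable `a`. -/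
abbrev sht (D E X Q : Fin n → A) (b a : Fin n) : A := -(kap D X * E b * (E a * Q a))

/-- The homotopy relation for the substitution of the variable `b` for the variable `a`. -/
theorem ctr_sht (b a : Fin n) :
    ctr D f * sht D E X Q b a + sht D E X Q b a * ctr D f =
      algebraMap S A (f b) * (kap D X * (E a * Q a)) -
        algebraMap S A (f a) * (kap D X * (E b * Q a)) := by
  have h1 : ctr D f * (E a * Q a) + E a * Q a * ctr D f = algebraMap S A (f a) * Q a := by
    rw [← mul_assoc, h.ctr_e f a, sub_mul, mul_assoc, (h.commute_ctr_q f a).eq, mul_assoc,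
      sub_add_cancel]
  have cb := fun x : A => (Algebra.commutes (f b) x)
  have ca := fun x : A => (Algebra.commutes (f a) x)
  have h2 : ctr D f * (kap D X * E b * (E a * Q a)) = -(kap D X * (algebraMap S A (f b) * (E a * Q a)))
      + kap D X * E b * (ctr D f * (E a * Q a)) := by
    rw [mul_assoc (kap D X), ← mul_assoc (ctr D f), h.ctr_kap f, neg_mul,
      mul_assoc (kap D X) (ctr D f), ← mul_assoc (ctr D f), h.ctr_e f b]
    noncomm_ring
  rw [sht, mul_neg, neg_mul, h2, eq_sub_of_add_eq h1, mul_assoc (kap D X * E b) _ (ctr D f), mul_sub,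
    mul_assoc (kap D X), ← mul_assoc (E b), ← ca (E b), ← mul_assoc (kap D X),
    ← mul_assoc (kap D X) (algebraMap S A (f a) * E b), ← mul_assoc (kap D X), ← ca (kap D X),
    ← cb (kap D X)]
  noncomm_ring

end Contraction

end KoszulRel

end KoszulRelations


/-! ### The operators on ⋀F ⊗ S(F) -/

section KoszulOperators

variable (R : Type u) [CommRing R] {n : ℕ}

/-- Contraction of the exterior algebra of `Rⁿ` with the coordinate `a`. -/
noncomputable def extD (a : Fin n) : Module.End R (ExteriorAlgebra R (Fin n → R)) :=
  CliffordAlgebra.contractLeft (Q := (0 : QuadraticForm R (Fin n → R)))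
    (LinearMap.proj a : (Fin n → R) →ₗ[R] R)

/-- Exterior multiplication by the basis vector `a`. -/
noncomputable def extE (a : Fin n) : Module.End R (ExteriorAlgebra R (Fin n → R)) :=
  LinearMap.mulLeft R (ExteriorAlgebra.ι R (Pi.single a 1))

/-- Multiplication by a variable. -/
noncomputable def polX (a : Fin n) : Module.End R (MvPolynomial (Fin n) R) :=
  LinearMap.mulLeft R (MvPolynomial.X a : MvPolynomial (Fin n) R)

/-- Division with remainder by a variable. -/
noncomputable def polQ (a : Fin n) : Module.End R (MvPolynomial (Fin n) R) where
  toFun p := p.divMonomial (Finsupp.single a 1)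
  map_add' p q := MvPolynomial.add_divMonomial p q _
  map_smul' c p := by
    ext s
    simp [MvPolynomial.coeff_divMonomial]

variable {R}

theorem extD_extE_same (a : Fin n) (w : ExteriorAlgebra R (Fin n → R)) :
    extD R a (extE R a w) = w - extE R a (extD R a w) := by
  have := CliffordAlgebra.contractLeft_ι_mul (Q := (0 : QuadraticForm R (Fin n → R)))
    (LinearMap.proj a : (Fin n → R) →ₗ[R] R) (Pi.single a 1) w
  refine this.trans ?_
  simp only [LinearMap.proj_apply, Pi.single_eq_same, one_smul]
  rfl

theorem extD_extE_ne {a b : Fin n} (h : a ≠ b) (w : ExteriorAlgebra R (Fin n → R)) :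
    extD R a (extE R b w) = - (extE R b (extD R a w)) := by
  have := CliffordAlgebra.contractLeft_ι_mul (Q := (0 : QuadraticForm R (Fin n → R)))
    (LinearMap.proj a : (Fin n → R) →ₗ[R] R) (Pi.single b 1) w
  refine this.trans ?_
  simp only [LinearMap.proj_apply, Pi.single_eq_of_ne h, zero_smul, zero_sub]
  rfl

theorem extD_extD (a b : Fin n) (w : ExteriorAlgebra R (Fin n → R)) :
    extD R a (extD R b w) = - (extD R b (extD R a w)) :=
  CliffordAlgebra.contractLeft_comm (Q := (0 : QuadraticForm R (Fin n → R))) _ _ _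

theorem extD_sq (a : Fin n) (w : ExteriorAlgebra R (Fin n → R)) : extD R a (extD R a w) = 0 :=
  CliffordAlgebra.contractLeft_contractLeft (Q := (0 : QuadraticForm R (Fin n → R))) _ _

theorem extE_sq (a : Fin n) (w : ExteriorAlgebra R (Fin n → R)) : extE R a (extE R a w) = 0 := by
  change ExteriorAlgebra.ι R (Pi.single a 1) * (ExteriorAlgebra.ι R (Pi.single a 1) * w) = 0
  rw [← mul_assoc, ExteriorAlgebra.ι_sq_zero, zero_mul]

theorem extE_extE (a b : Fin n) (w : ExteriorAlgebra R (Fin n → R)) :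
    extE R a (extE R b w) = - (extE R b (extE R a w)) := by
  change ExteriorAlgebra.ι R (Pi.single a 1) * (ExteriorAlgebra.ι R (Pi.single b 1) * w) =
    - (ExteriorAlgebra.ι R (Pi.single b 1) * (ExteriorAlgebra.ι R (Pi.single a 1) * w))
  rw [← mul_assoc, ← mul_assoc, eq_neg_iff_add_eq_zero, ← add_mul,
    ExteriorAlgebra.ι_add_mul_swap, zero_mul]

theorem polQ_polX_same (a : Fin n) (p : MvPolynomial (Fin n) R) : polQ R a (polX R a p) = p :=
  MvPolynomial.X_mul_divMonomial a _

theorem polX_polX (a b : Fin n) (p : MvPolynomial (Fin n) R) :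
    polX R a (polX R b p) = polX R b (polX R a p) :=
  mul_left_comm (MvPolynomial.X a) (MvPolynomial.X b) _

theorem polQ_polQ (a b : Fin n) (p : MvPolynomial (Fin n) R) :
    polQ R a (polQ R b p) = polQ R b (polQ R a p) := by
  change (p.divMonomial _).divMonomial _ = (p.divMonomial _).divMonomial _
  rw [← MvPolynomial.divMonomial_add, ← MvPolynomial.divMonomial_add, add_comm]

theorem coeff_polQ (a : Fin n) (p : MvPolynomial (Fin n) R) (s : Fin n →₀ ℕ) :
    (polQ R a p).coeff s = p.coeff (Finsupp.single a 1 + s) :=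
  MvPolynomial.coeff_divMonomial _ _ _

theorem polQ_polX_ne {a b : Fin n} (h : a ≠ b) (p : MvPolynomial (Fin n) R) :
    polQ R a (polX R b p) = polX R b (polQ R a p) := by
  refine MvPolynomial.ext _ _ fun s => ?_
  rw [coeff_polQ]
  change (MvPolynomial.X b * p).coeff _ = (MvPolynomial.X b * polQ R a p).coeff s
  rw [MvPolynomial.coeff_X_mul', MvPolynomial.coeff_X_mul', coeff_polQ]
  have : b ∈ (Finsupp.single a 1 + s).support ↔ b ∈ s.support := by
    simp [h]
  simp only [this]
  split_ifs with hs
  · congr 1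
    refine (add_tsub_assoc_of_le ?_ _)
    rw [Finsupp.single_le_iff]
    rw [Finsupp.mem_support_iff] at hs
    omega
  · rfl

variable (R)

/-- An operator on the exterior algebra, acting on the Koszul module. -/
noncomputable abbrev opL (u : Module.End R (ExteriorAlgebra R (Fin n → R))) :
    Module.End R (KoszulModule R n) :=
  TensorProduct.map u LinearMap.id

/-- An operator on the symmetric algebra, acting on the Koszul module. -/
noncomputable abbrev opR (v : Module.End R (MvPolynomial (Fin n) R)) :
    Module.End R (KoszulModule R n) :=
  TensorProduct.map LinearMap.id v

theorem koszulRel : KoszulRel (n := n) (fun a => opL R (extD R a)) (fun a => opL R (extE R a))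
    (fun a => opR R (polX R a)) (fun a => opR R (polQ R a)) where
  dd a b := by
    refine TensorProduct.ext' fun w s => ?_
    change extD R a (extD R b w) ⊗ₜ[R] s = -(extD R b (extD R a w) ⊗ₜ[R] s)
    rw [extD_extD, TensorProduct.neg_tmul]
  d_sq a := by
    refine TensorProduct.ext' fun w s => ?_
    change extD R a (extD R a w) ⊗ₜ[R] s = 0
    rw [extD_sq, TensorProduct.zero_tmul]
  ee a b := by
    refine TensorProduct.ext' fun w s => ?_
    change extE R a (extE R b w) ⊗ₜ[R] s = -(extE R b (extE R a w) ⊗ₜ[R] s)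
    rw [extE_extE, TensorProduct.neg_tmul]
  e_sq a := by
    refine TensorProduct.ext' fun w s => ?_
    change extE R a (extE R a w) ⊗ₜ[R] s = 0
    rw [extE_sq, TensorProduct.zero_tmul]
  de_same a := by
    refine TensorProduct.ext' fun w s => ?_
    change extD R a (extE R a w) ⊗ₜ[R] s = w ⊗ₜ[R] s - extE R a (extD R a w) ⊗ₜ[R] s
    rw [extD_extE_same, TensorProduct.sub_tmul]
  de_ne a b hab := by
    refine TensorProduct.ext' fun w s => ?_
    change extD R a (extE R b w) ⊗ₜ[R] s = -(extE R b (extD R a w) ⊗ₜ[R] s)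
    rw [extD_extE_ne hab, TensorProduct.neg_tmul]
  dx a b := TensorProduct.ext' fun w s => rfl
  dq a b := TensorProduct.ext' fun w s => rfl
  ex a b := TensorProduct.ext' fun w s => rfl
  eq a b := TensorProduct.ext' fun w s => rfl
  xx a b := by
    refine TensorProduct.ext' fun w s => ?_
    change w ⊗ₜ[R] polX R a (polX R b s) = w ⊗ₜ[R] polX R b (polX R a s)
    rw [polX_polX]
  qq a b := by
    refine TensorProduct.ext' fun w s => ?_
    change w ⊗ₜ[R] polQ R a (polQ R b s) = w ⊗ₜ[R] polQ R b (polQ R a s)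
    rw [polQ_polQ]
  qx_same a := by
    refine TensorProduct.ext' fun w s => ?_
    change w ⊗ₜ[R] polQ R a (polX R a s) = w ⊗ₜ[R] s
    rw [polQ_polX_same]
  qx_ne a b hab := by
    refine TensorProduct.ext' fun w s => ?_
    change w ⊗ₜ[R] polQ R a (polX R b s) = w ⊗ₜ[R] polX R b (polQ R a s)
    rw [polQ_polX_ne hab]

theorem koszul_eq : koszul R n = KoszulRel.kap (fun a => opL R (extD R a))
    (fun a => opR R (polX R a)) := by
  refine TensorProduct.ext' fun w s => ?_
  simp only [koszul, KoszulRel.kap, LinearMap.sum_apply]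
  rfl

theorem contraction_eq (f : Fin n → R) :
    contraction f = KoszulRel.ctr (fun a => opL R (extD R a)) f := by
  refine TensorProduct.ext' fun w s => ?_
  have hf : Fintype.linearCombination R f =
      ∑ a, f a • (LinearMap.proj a : (Fin n → R) →ₗ[R] R) := by
    ext i
    simp [Fintype.linearCombination_apply, mul_comm]
  simp only [contraction, KoszulRel.ctr, LinearMap.sum_apply, TensorProduct.map_tmul, hf,
    map_sum, map_smul, LinearMap.smul_apply, TensorProduct.sum_tmul, LinearMap.id_apply]
  rfl

end KoszulOperators

/-! ### Effect of the operators on bidegrees -/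

section Bidegree

variable {R : Type u} [CommRing R] {n : ℕ}

theorem tmul_mem_bidegree {i j : ℕ} {w : ExteriorAlgebra R (Fin n → R)}
    {s : MvPolynomial (Fin n) R} (hw : w ∈ ⋀[R]^i (Fin n → R)) (hs : s.IsHomogeneous j) :
    w ⊗ₜ[R] s ∈ bidegree R n i j :=
  ⟨⟨w, hw⟩ ⊗ₜ ⟨s, hs⟩, rfl⟩

theorem bidegree_le {i j : ℕ} {W : Submodule R (KoszulModule R n)}
    (h : ∀ w ∈ ⋀[R]^i (Fin n → R), ∀ s : MvPolynomial (Fin n) R, s.IsHomogeneous j →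
      w ⊗ₜ[R] s ∈ W) : bidegree R n i j ≤ W := by
  rintro _ ⟨y, rfl⟩
  induction y using TensorProduct.induction_on with
  | zero => rw [map_zero]; exact W.zero_mem
  | add x y hx hy => rw [map_add]; exact W.add_mem hx hy
  | tmul w s => exact h w.1 w.2 s.1 s.2

theorem extE_mem {i : ℕ} (a : Fin n) {w : ExteriorAlgebra R (Fin n → R)}
    (hw : w ∈ ⋀[R]^i (Fin n → R)) : extE R a w ∈ ⋀[R]^(i + 1) (Fin n → R) := by
  rw [ExteriorAlgebra.exteriorPower, pow_succ']
  exact Submodule.mul_mem_mul ⟨_, rfl⟩ hw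

theorem extD_mem {i : ℕ} (a : Fin n) {w : ExteriorAlgebra R (Fin n → R)}
    (hw : w ∈ ⋀[R]^(i + 1) (Fin n → R)) : extD R a w ∈ ⋀[R]^i (Fin n → R) :=
  contractLeft_mem _ i w hw

theorem mem_exteriorPower_zero {w : ExteriorAlgebra R (Fin n → R)}
    (hw : w ∈ ⋀[R]^0 (Fin n → R)) : ∃ c : R, w = algebraMap R _ c := by
  rw [ExteriorAlgebra.exteriorPower, pow_zero, Submodule.mem_one] at hw
  obtain ⟨c, rfl⟩ := hw
  exact ⟨c, rfl⟩

theorem extD_eq_zero (a : Fin n) {w : ExteriorAlgebra R (Fin n → R)}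
    (hw : w ∈ ⋀[R]^0 (Fin n → R)) : extD R a w = 0 := by
  obtain ⟨c, rfl⟩ := mem_exteriorPower_zero hw
  exact CliffordAlgebra.contractLeft_algebraMap (Q := (0 : QuadraticForm R (Fin n → R))) _ _

theorem polX_mem {j : ℕ} (a : Fin n) {s : MvPolynomial (Fin n) R} (hs : s.IsHomogeneous j) :
    (polX R a s).IsHomogeneous (j + 1) := by
  rw [add_comm]
  exact (MvPolynomial.isHomogeneous_X R a).mul hs

theorem polQ_mem {j : ℕ} (a : Fin n) {s : MvPolynomial (Fin n) R} (hs : s.IsHomogeneous (j + 1)) :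
    (polQ R a s).IsHomogeneous j := by
  intro d hd
  rw [coeff_polQ] at hd
  have := hs hd
  rw [map_add, Finsupp.weight_single] at this
  simp only [Pi.one_apply, smul_eq_mul, mul_one] at this
  omega

theorem polQ_eq_zero (a : Fin n) {s : MvPolynomial (Fin n) R} (hs : s.IsHomogeneous 0) :
    polQ R a s = 0 := by
  ext d
  rw [coeff_polQ, MvPolynomial.coeff_zero]
  by_contra hd
  have := hs hd
  rw [map_add, Finsupp.weight_single] at this
  simp only [Pi.one_apply, smul_eq_mul, mul_one] at this
  omega

theorem opL_extE_mem {i j : ℕ} (a : Fin n) {x : KoszulModule R n} (hx : x ∈ bidegree R n i j) :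
    opL R (extE R a) x ∈ bidegree R n (i + 1) j :=
  bidegree_le (W := (bidegree R n (i + 1) j).comap (opL R (extE R a)))
    (fun _ hw _ hs => tmul_mem_bidegree (extE_mem a hw) hs) hx

theorem opR_polQ_mem {i j : ℕ} (a : Fin n) {x : KoszulModule R n}
    (hx : x ∈ bidegree R n i (j + 1)) : opR R (polQ R a) x ∈ bidegree R n i j :=
  bidegree_le (W := (bidegree R n i j).comap (opR R (polQ R a)))
    (fun _ hw _ hs => tmul_mem_bidegree hw (polQ_mem a hs)) hx

theorem opR_polQ_eq_zero {i : ℕ} (a : Fin n) {x : KoszulModule R n}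
    (hx : x ∈ bidegree R n i 0) : opR R (polQ R a) x = 0 :=
  bidegree_le (W := LinearMap.ker (opR R (polQ R a)))
    (fun w _ s hs => by
      change w ⊗ₜ[R] polQ R a s = 0
      rw [polQ_eq_zero a hs, TensorProduct.tmul_zero]) hx

theorem opR_polQ_pow_eq_zero {i j : ℕ} (a : Fin n) {x : KoszulModule R n}
    (hx : x ∈ bidegree R n i j) : (opR R (polQ R a) ^ (j + 1)) x = 0 := by
  induction j generalizing x with
  | zero =>
    rw [zero_add, pow_one]
    exact opR_polQ_eq_zero a hx
  | succ j ih =>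
    rw [pow_succ]
    exact ih (opR_polQ_mem a hx)

theorem opL_extD_eq_zero {j : ℕ} (a : Fin n) {x : KoszulModule R n}
    (hx : x ∈ bidegree R n 0 j) : opL R (extD R a) x = 0 :=
  bidegree_le (W := LinearMap.ker (opL R (extD R a)))
    (fun w hw s _ => by
      change extD R a w ⊗ₜ[R] s = 0
      rw [extD_eq_zero a hw, TensorProduct.zero_tmul]) hx

theorem koszul_mem_bidegree {i j : ℕ} {x : KoszulModule R n}
    (hx : x ∈ bidegree R n (i + 1) j) : koszul R n x ∈ bidegree R n i (j + 1) := by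
  rw [koszul, LinearMap.sum_apply]
  refine Submodule.sum_mem _ fun a _ => ?_
  exact bidegree_le (W := (bidegree R n i (j + 1)).comap (TensorProduct.map (extD R a) (polX R a)))
    (fun _ hw _ hs => tmul_mem_bidegree (extD_mem a hw) (polX_mem a hs)) hx

/-- The projection of the Koszul module omitting the variable `a`. -/
noncomputable abbrev kprj (R : Type u) [CommRing R] (a : Fin n) : Module.End R (KoszulModule R n) :=
  KoszulRel.prj (fun a => opL R (extD R a)) (fun a => opL R (extE R a))
    (fun a => opR R (polX R a)) (fun a => opR R (polQ R a)) a

theorem kprj_tmul (a : Fin n) (w : ExteriorAlgebra R (Fin n → R)) (s : MvPolynomial (Fin n) R) :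
    kprj R a (w ⊗ₜ s) = extD R a (extE R a w) ⊗ₜ[R] (s - polX R a (polQ R a s)) := by
  rw [TensorProduct.tmul_sub]
  change opL R (extD R a) (opL R (extE R a) (w ⊗ₜ[R] s - w ⊗ₜ[R] polX R a (polQ R a s))) = _
  rw [map_sub, map_sub]
  rfl

theorem polT_mem {j : ℕ} (a : Fin n) {s : MvPolynomial (Fin n) R} (hs : s.IsHomogeneous j) :
    (s - polX R a (polQ R a s)).IsHomogeneous j := by
  cases j with
  | zero =>
    rw [polQ_eq_zero a hs, map_zero, sub_zero]
    exact hs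
  | succ j => exact hs.sub (polX_mem a (polQ_mem a hs))

theorem kprj_mem {i j : ℕ} (a : Fin n) {x : KoszulModule R n} (hx : x ∈ bidegree R n i j) :
    kprj R a x ∈ bidegree R n i j := by
  refine bidegree_le (W := (bidegree R n i j).comap (kprj R a)) (fun w hw s hs => ?_) hx
  rw [Submodule.mem_comap, kprj_tmul]
  exact tmul_mem_bidegree (extD_mem a (extE_mem a hw)) (polT_mem a hs)

theorem coeff_polT (a : Fin n) (p : MvPolynomial (Fin n) R) (s : Fin n →₀ ℕ) :
    (p - polX R a (polQ R a p)).coeff s = if s a = 0 then p.coeff s else 0 := by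
  change (p - MvPolynomial.X a * polQ R a p).coeff s = _
  rw [MvPolynomial.coeff_sub, MvPolynomial.coeff_X_mul']
  by_cases hs : s a = 0
  · rw [if_neg (by simpa using hs), if_pos hs, sub_zero]
  · rw [if_pos (by simpa using hs), if_neg hs, coeff_polQ, add_tsub_cancel_of_le, sub_self]
    rw [Finsupp.single_le_iff]
    omega

/-- Only the polynomial factor is tracked: the projections remove exactly the monomials divisible by
a variable from the list. -/
theorem prod_kprj_tmul (l : List (Fin n)) (w : ExteriorAlgebra R (Fin n → R))
    (s : MvPolynomial (Fin n) R) : ∃ w' s', (l.map (kprj R)).prod (w ⊗ₜ s) = w' ⊗ₜ s' ∧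
      ∀ d, s'.coeff d = if ∀ a ∈ l, d a = 0 then s.coeff d else 0 := by
  induction l with
  | nil => exact ⟨w, s, rfl, by simp⟩
  | cons a l ih =>
    obtain ⟨w', s', h, hs⟩ := ih
    refine ⟨extD R a (extE R a w'), s' - polX R a (polQ R a s'), ?_, fun d => ?_⟩
    · rw [List.map_cons, List.prod_cons, Module.End.mul_apply, h, kprj_tmul]
    · rw [coeff_polT, hs]
      simp only [List.forall_mem_cons]
      split_ifs <;> tauto

/-- Omitting all variables leaves the constant term, which is zero in positive degree. -/
theorem prod_kprj_eq_zero {i j : ℕ} {l : List (Fin n)} (hl : ∀ a, a ∈ l) {x : KoszulModule R n}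
    (hx : x ∈ bidegree R n i (j + 1)) : (l.map (kprj R)).prod x = 0 := by
  refine bidegree_le (W := LinearMap.ker (l.map (kprj R)).prod) (fun w _ s hs => ?_) hx
  obtain ⟨w', s', h, hc⟩ := prod_kprj_tmul l w s
  rw [LinearMap.mem_ker, h]
  have : s' = 0 := by
    ext d
    rw [hc, MvPolynomial.coeff_zero]
    split_ifs with hd
    · by_contra h0
      have hd0 : d = 0 := Finsupp.ext fun a => hd a (hl a)
      have := hs h0
      rw [hd0, map_zero] at this
      omega
    · rfl
  rw [this, TensorProduct.tmul_zero]

end Bidegree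

/-! ### Exactness of the Koszul complex and the terms of L as kernels -/

section Terms

variable {R : Type u} [CommRing R] {n : ℕ}

/-- The homotopy of the Koszul complex. -/
noncomputable def khty (R : Type u) [CommRing R] (n : ℕ) : Module.End R (KoszulModule R n) :=
  KoszulRel.hty (fun a => opL R (extD R a)) (fun a => opL R (extE R a))
    (fun a => opR R (polX R a)) (fun a => opR R (polQ R a)) (List.finRange n)

theorem koszul_koszul (x : KoszulModule R n) : koszul R n (koszul R n x) = 0 := by
  have := (koszulRel R (n := n)).kap_sq
  rw [← koszul_eq] at this
  exact LinearMap.congr_fun this x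

theorem koszul_khty {i j : ℕ} {x : KoszulModule R n} (hx : x ∈ bidegree R n i (j + 1))
    (h0 : koszul R n x = 0) : koszul R n (khty R n x) = x := by
  have h1 := (koszulRel R (n := n)).kap_hty (List.finRange n)
  rw [← koszul_eq] at h1
  have h2 := LinearMap.congr_fun h1 x
  have h3 : ((List.finRange n).map (kprj R)).prod x = 0 :=
    prod_kprj_eq_zero (fun a => List.mem_finRange a) hx
  change koszul R n (khty R n x) + khty R n (koszul R n x) =
    x - ((List.finRange n).map (kprj R)).prod x at h2
  rw [h0, h3, map_zero, add_zero, sub_zero] at h2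
  exact h2

theorem khty_mem {i j : ℕ} {x : KoszulModule R n} (hx : x ∈ bidegree R n i (j + 1)) :
    khty R n x ∈ bidegree R n (i + 1) j := by
  rw [khty]
  generalize List.finRange n = l
  induction l with
  | nil => exact Submodule.zero_mem _
  | cons a l ih =>
    refine Submodule.add_mem _ ?_ ?_
    · exact opL_extE_mem a (opR_polQ_mem a hx)
    · exact kprj_mem a ih

theorem koszul_eq_zero_of_mem {k i : ℕ} {x : KoszulModule R n} (hx : x ∈ beTerm R n k i) :
    koszul R n x = 0 := by
  obtain ⟨y, _, rfl⟩ := hx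
  exact koszul_koszul y

theorem mem_bidegree_of_mem {k i : ℕ} (hk : 1 ≤ k) {x : KoszulModule R n}
    (hx : x ∈ beTerm R n k (i + 1)) : x ∈ bidegree R n i k := by
  obtain ⟨y, hy, rfl⟩ := hx
  have := koszul_mem_bidegree hy
  rwa [Nat.sub_add_cancel hk] at this

/-- Image equals kernel in the Koszul complex at polynomial degree k ≥ 1. The kernel description is
the one under which the substitution operators become simple. -/
theorem mem_beTerm_iff {k i : ℕ} (hk : 1 ≤ k) {x : KoszulModule R n} :
    x ∈ beTerm R n k (i + 1) ↔ x ∈ bidegree R n i k ∧ koszul R n x = 0 := by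
  refine ⟨fun h => ⟨mem_bidegree_of_mem hk h, koszul_eq_zero_of_mem h⟩, fun ⟨h, h0⟩ => ?_⟩
  obtain ⟨j, rfl⟩ : ∃ j, k = j + 1 := ⟨k - 1, by omega⟩
  exact ⟨khty R n x, khty_mem h, koszul_khty h h0⟩

end Terms


/-! ### Products of operators homotopic to scalars, measured by powers of J -/

theorem homotopy_succ {R A : Type*} [CommRing R] [Ring A] [Algebra R A] {d s w S : A} {r : R}
    {m : ℕ} (h2 : Commute d w) (h4 : r ^ m • 1 - w = d * S + S * d) :
    r ^ (m + 1) • 1 - (r • 1 - (d * s + s * d)) * w =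
      d * (r • S + s * w) + (r • S + s * w) * d := by
  have h6 : r ^ (m + 1) • 1 - (r • 1 - (d * s + s * d)) * w =
      r • (r ^ m • 1 - w) + (d * s + s * d) * w := by
    rw [smul_sub, sub_mul, smul_mul_assoc, one_mul, pow_succ', mul_smul]
    abel
  rw [h6, h4, add_mul, mul_add, add_mul, smul_add, mul_smul_comm, smul_mul_assoc,
    mul_assoc s d, h2.eq]
  simp only [mul_assoc]
  abel

section ShiftHom

variable {R V : Type*} [CommRing R] [AddCommGroup V] [Module R V] (T : ℕ → Submodule R V)

/-- The operators which map `T i` to `T (i + m)` for all `i`. -/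
def shiftHom (m : ℕ) : Submodule R (Module.End R V) where
  carrier := {φ | ∀ i, ∀ x ∈ T i, φ x ∈ T (i + m)}
  add_mem' h h' i x hx := Submodule.add_mem _ (h i x hx) (h' i x hx)
  zero_mem' _ _ _ := Submodule.zero_mem _
  smul_mem' c _ h i x hx := Submodule.smul_mem _ c (h i x hx)

variable {T}

theorem one_mem_shiftHom : 1 ∈ shiftHom T 0 := fun _ _ hx => hx

theorem mul_mem_shiftHom {m m' : ℕ} {φ ψ : Module.End R V}
    (hφ : φ ∈ shiftHom T m) (hψ : ψ ∈ shiftHom T m') : φ * ψ ∈ shiftHom T (m + m') := by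
  intro i x hx
  have := hφ _ _ (hψ i x hx)
  rwa [show i + m' + m = i + (m + m') by omega] at this

theorem mul_mem_smul_shiftHom {m m' : ℕ} {I I' : Ideal R} {φ ψ : Module.End R V}
    (hφ : φ ∈ I • shiftHom T m) (hψ : ψ ∈ I' • shiftHom T m') :
    φ * ψ ∈ (I * I') • shiftHom T (m + m') := by
  refine Submodule.smul_induction_on hφ (fun r hr φ' hφ' => ?_) fun x y hx hy => ?_
  · refine Submodule.smul_induction_on hψ (fun r' hr' ψ' hψ' => ?_) fun x y hx hy => ?_
    · rw [smul_mul_smul_comm]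
      exact Submodule.smul_mem_smul (Ideal.mul_mem_mul hr hr') (mul_mem_shiftHom hφ' hψ')
    · rw [mul_add]
      exact Submodule.add_mem _ hx hy
  · rw [add_mul]
    exact Submodule.add_mem _ hx hy

theorem mem_of_mem_smul_shiftHom {m : ℕ} {I : Ideal R} {φ : Module.End R V}
    (hφ : φ ∈ I • shiftHom T m) : φ ∈ shiftHom T m :=
  Submodule.smul_le_right hφ

theorem exists_restrict_shiftHom {m : ℕ} {I : Ideal R} {φ : Module.End R V}
    (hφ : φ ∈ I • shiftHom T m) (i : ℕ) :
    ∃ s ∈ I • (⊤ : Submodule R (T i →ₗ[R] T (i + m))), ∀ x, (s x : V) = φ x := by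
  refine Submodule.smul_induction_on hφ (fun r hr φ' hφ' => ?_) ?_
  · exact ⟨r • φ'.restrict (hφ' i), Submodule.smul_mem_smul hr trivial, fun x => rfl⟩
  · rintro x y ⟨s, hs, hs'⟩ ⟨t, ht, ht'⟩
    refine ⟨s + t, Submodule.add_mem _ hs ht, fun z => ?_⟩
    rw [LinearMap.add_apply, LinearMap.add_apply, Submodule.coe_add, hs', ht']

/-- The endomorphism `r - [d, s]`. -/
def subOp (d s : Module.End R V) (r : R) : Module.End R V := r • 1 - (d * s + s * d)

theorem commute_subOp {d : Module.End R V} (hd : d * d = 0) (s : Module.End R V) (r : R) :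
    Commute d (subOp d s r) := by
  refine Commute.sub_right ((Commute.one_right _).smul_right _) ?_
  rw [commute_iff_eq, mul_add, add_mul, ← mul_assoc, ← mul_assoc, hd, mul_assoc s, hd, zero_mul,
    mul_zero, zero_add, add_zero]

/-- Since d = ∑ f_c D_c, the anticommutator [d, s] is ∑ f_c [D_c, s], and each [D_c, s] preserves
the degree; the scalar f_b lies in J as well. -/
theorem subOp_mem {n : ℕ} {f : Fin n → R} {D : Fin n → Module.End R V} {d s : Module.End R V}
    (hd : d = ∑ c, f c • D c) (hs : s ∈ shiftHom T 1)
    (hD : ∀ c i, ∀ x ∈ T (i + 1), D c x ∈ T i) (hD0 : ∀ c, ∀ x ∈ T 0, D c x = 0) (b : Fin n) :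
    subOp d s (f b) ∈ Ideal.span (Set.range f) • shiftHom T 0 := by
  have h1 : d * s + s * d = ∑ c, f c • (D c * s + s * D c) := by
    rw [hd, Finset.sum_mul, Finset.mul_sum, ← Finset.sum_add_distrib]
    refine Finset.sum_congr rfl fun c _ => ?_
    rw [smul_mul_assoc, mul_smul_comm, smul_add]
  rw [subOp, h1]
  refine Submodule.sub_mem _ (Submodule.smul_mem_smul (Ideal.subset_span (Set.mem_range_self b))
    one_mem_shiftHom) (Submodule.sum_mem _ fun c _ =>
      Submodule.smul_mem_smul (Ideal.subset_span (Set.mem_range_self c)) ?_)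
  intro i x hx
  refine Submodule.add_mem _ (hD c i _ (hs i x hx)) ?_
  cases i with
  -- In the lowest degree s ∘ D_c would pass through a missing term, so D_c has to vanish there.
  | zero =>
    change s (D c x) ∈ _
    rw [hD0 c x hx, map_zero]
    exact Submodule.zero_mem _
  | succ i => exact hs i _ (hD c i x hx)

/-- The product of the operators `r - [d, s_a]` along a word. -/
def wordOp {ι : Type*} (d : Module.End R V) (s : ι → Module.End R V) (r : R) (l : List ι) :
    Module.End R V :=
  (l.map fun a => subOp d (s a) r).prod

/-- Each letter contributes a factor in J. The homotopy is assembled from words that are one letter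
short, so one power of J is missing from it: only f_b • S, rather than S itself, lies in the full
power. This loss of one is matched by the unit steps of the weights. -/
theorem exists_homotopy_wordOp {n : ℕ} {f : Fin n → R} {D s : Fin n → Module.End R V}
    {d : Module.End R V} (hd : d = ∑ c, f c • D c) (hdd : d * d = 0)
    (hs : ∀ a, s a ∈ shiftHom T 1) (hD : ∀ c i, ∀ x ∈ T (i + 1), D c x ∈ T i)
    (hD0 : ∀ c, ∀ x ∈ T 0, D c x = 0) (b : Fin n) (l : List (Fin n)) :
    wordOp d s (f b) l ∈ Ideal.span (Set.range f) ^ l.length • shiftHom T 0 ∧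
    Commute d (wordOp d s (f b) l) ∧
    ∃ S : Module.End R V,
      f b • S ∈ Ideal.span (Set.range f) ^ l.length • shiftHom T 1 ∧
      f b ^ l.length • 1 - wordOp d s (f b) l = d * S + S * d := by
  have hb : f b ∈ Ideal.span (Set.range f) := Ideal.subset_span (Set.mem_range_self b)
  induction l with
  | nil =>
    refine ⟨?_, Commute.one_right _, 0, ?_, ?_⟩
    · rw [List.length_nil, pow_zero, Ideal.one_eq_top, Submodule.top_smul]
      exact one_mem_shiftHom
    · rw [smul_zero]
      exact Submodule.zero_mem _
    · rw [List.length_nil, pow_zero, one_smul, mul_zero, zero_mul, add_zero]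
      exact sub_self 1
  | cons a l ih =>
    obtain ⟨h1, h2, S, h3, h4⟩ := ih
    have hw : wordOp d s (f b) (a :: l) = subOp d (s a) (f b) * wordOp d s (f b) l := rfl
    rw [hw, List.length_cons]
    refine ⟨?_, (commute_subOp hdd (s a) (f b)).mul_right h2,
      -- If w is homotopic to r^m through S and commutes with d, then (r - [d, s])w is homotopic to
      -- r^{m+1} through rS + sw.
      f b • S + s a * wordOp d s (f b) l, ?_, ?_⟩
    · have h5 := mul_mem_smul_shiftHom (subOp_mem hd (hs a) hD hD0 b) h1
      rw [pow_succ']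
      exact h5
    · rw [smul_add, pow_succ']
      refine Submodule.add_mem _ ?_ ?_
      · rw [Submodule.mul_smul]
        exact Submodule.smul_mem_smul hb h3
      · have h5 : s a ∈ (1 : Ideal R) • shiftHom T 1 := by
          rw [Ideal.one_eq_top, Submodule.top_smul]
          exact hs a
        have h6 := mul_mem_smul_shiftHom h5 h1
        rw [one_mul] at h6
        rw [Submodule.mul_smul]
        exact Submodule.smul_mem_smul hb h6
    · exact homotopy_succ h2 h4

/-- Expand (r p + r' M)^{m+1}: as M p = 0, every word vanishes or begins on the left with p, except
the pure power of M. -/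
theorem exists_pow_subOp_apply {N p M : Module.End R V} {r r' : R} {W : Submodule R V}
    (hW : ∀ x ∈ W, N x ∈ W) (hN : ∀ x ∈ W, N x = r • p x + r' • M x)
    (hMp : ∀ x, M (p x) = 0) (m : ℕ) (x : V) (hx : x ∈ W) :
    ∃ z, (N ^ (m + 1)) x = p z + r' ^ (m + 1) • (M ^ (m + 1)) x := by
  induction m generalizing x with
  | zero => exact ⟨r • x, by rw [zero_add, pow_one, pow_one, pow_one, hN x hx, map_smul]⟩
  | succ m ih =>
    obtain ⟨z, hz⟩ := ih (N x) (hW x hx)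
    refine ⟨z, ?_⟩
    rw [pow_succ N, Module.End.mul_apply, hz, hN x hx, pow_succ M (m + 1), Module.End.mul_apply,
      map_add, map_smul, map_smul, pow_succ M m, Module.End.mul_apply, hMp, map_zero, smul_zero,
      zero_add, smul_smul, ← pow_succ]

end ShiftHom

/-! ### Finiteness and projectivity of the terms; the substitution homotopy -/

section Terms

variable {R : Type u} [CommRing R] {n : ℕ}

theorem exteriorPower_eq_bot {i : ℕ} (hi : n < i) : ⋀[R]^i (Fin n → R) = ⊥ := by
  let b := Module.Basis.exteriorPower i (Pi.basisFun R (Fin n))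
  have : IsEmpty (Set.powersetCard (Fin n) i) := by
    refine ⟨fun s => ?_⟩
    have h1 := Finset.card_le_univ s.1
    have h2 : s.1.card = i := s.2
    rw [Fintype.card_fin] at h1
    omega
  have h3 : Subsingleton (⋀[R]^i (Fin n → R)) := b.repr.injective.subsingleton
  exact (Submodule.subsingleton_iff_eq_bot).mp h3

theorem beTerm_eq_bot {k i : ℕ} (hi : n < i) : beTerm R n k i = ⊥ := by
  have : bidegree R n i (k - 1) = ⊥ := by
    refine eq_bot_iff.mpr (bidegree_le fun w hw s _ => ?_)
    rw [exteriorPower_eq_bot hi, Submodule.mem_bot] at hw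
    rw [hw, TensorProduct.zero_tmul]
    exact Submodule.zero_mem _
  rw [beTerm, this, Submodule.map_bot]

instance finite_bidegree (i j : ℕ) : Module.Finite R (bidegree R n i j) := by
  have : Module.Finite R (MvPolynomial.homogeneousSubmodule (Fin n) R j) :=
    Module.Finite.iff_fg.mpr (MvPolynomial.homogeneousSubmodule_fg _ _ j)
  exact Module.Finite.range _

instance finite_beTerm (k i : ℕ) : Module.Finite R (beTerm R n k i) :=
  Module.Finite.map _ _

/-- The projection onto a bidegree. -/
noncomputable def bidegreeProj (R : Type u) [CommRing R] (n i j : ℕ) :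
    KoszulModule R n →ₗ[R] KoszulModule R n :=
  TensorProduct.map (GradedAlgebra.proj (fun i => ⋀[R]^i (Fin n → R)) i)
    (MvPolynomial.homogeneousComponent j)

theorem bidegreeProj_mem (i j : ℕ) (x : KoszulModule R n) :
    bidegreeProj R n i j x ∈ bidegree R n i j := by
  induction x using TensorProduct.induction_on with
  | zero => rw [map_zero]; exact Submodule.zero_mem _
  | add x y hx hy => rw [map_add]; exact Submodule.add_mem _ hx hy
  | tmul w s =>
    exact tmul_mem_bidegree
      (SetLike.coe_mem (DirectSum.decompose (fun i => ⋀[R]^i (Fin n → R)) w i))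
      (MvPolynomial.homogeneousComponent_isHomogeneous j s)

theorem bidegreeProj_eq {i j : ℕ} {x : KoszulModule R n} (hx : x ∈ bidegree R n i j) :
    bidegreeProj R n i j x = x := by
  refine bidegree_le (W := LinearMap.eqLocus (bidegreeProj R n i j) LinearMap.id)
    (fun w hw s hs => ?_) hx
  change GradedAlgebra.proj (fun i => ⋀[R]^i (Fin n → R)) i w ⊗ₜ[R]
    MvPolynomial.homogeneousComponent j s = w ⊗ₜ[R] s
  rw [GradedAlgebra.proj_apply, DirectSum.decompose_of_mem_same (fun i => ⋀[R]^i (Fin n → R)) hw,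
    MvPolynomial.homogeneousComponent_of_mem hs, if_pos rfl]

/-- The contracting homotopy followed by κ is the identity on ker κ, which makes the term a direct
summand of the free module ⋀F ⊗ S(F). The projection onto a bidegree is inserted so that the
retraction has values in the term on the whole module. -/
theorem projective_beTerm {k : ℕ} (hk : 1 ≤ k) (i : ℕ) :
    Module.Projective R (beTerm R n k (i + 1)) := by
  have : Module.Free R (ExteriorAlgebra R (Fin n → R)) :=
    Module.Free.of_basis (Pi.basisFun R (Fin n)).ExteriorAlgebra
  obtain ⟨j, rfl⟩ : ∃ j, k = j + 1 := ⟨k - 1, by omega⟩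
  let r : KoszulModule R n →ₗ[R] beTerm R n (j + 1) (i + 1) :=
    LinearMap.codRestrict _ (koszul R n ∘ₗ bidegreeProj R n (i + 1) j ∘ₗ khty R n)
      fun x => ⟨_, bidegreeProj_mem _ _ _, rfl⟩
  refine Module.Projective.of_split (beTerm R n (j + 1) (i + 1)).subtype r ?_
  ext x
  have h1 := (mem_beTerm_iff hk).mp x.2
  change koszul R n (bidegreeProj R n (i + 1) j (khty R n x)) = x
  rw [bidegreeProj_eq (khty_mem h1.1), koszul_khty h1.1 h1.2]

theorem opL_extD_mem_beTerm (k i : ℕ) (a : Fin n) {x : KoszulModule R n}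
    (hx : x ∈ beTerm R n k (i + 1)) : opL R (extD R a) x ∈ beTerm R n k i := by
  have h1 : contraction (Pi.single a (1 : R)) = opL R (extD R a) := by
    rw [contraction_eq, KoszulRel.ctr, Finset.sum_eq_single a]
    · rw [Pi.single_eq_same, one_smul]
    · intro b _ hb
      rw [Pi.single_eq_of_ne hb, zero_smul]
    · simp
  rw [← h1]
  exact contraction_mem_beTerm _ k i x hx

/-- The homotopy substituting the variable `b` for the variable `a`. -/
noncomputable abbrev ksht (R : Type u) [CommRing R] (b a : Fin n) :
    Module.End R (KoszulModule R n) :=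
  KoszulRel.sht (fun a => opL R (extD R a)) (fun a => opL R (extE R a))
    (fun a => opR R (polX R a)) (fun a => opR R (polQ R a)) b a

/-- The operator substituting the variable `b` for the variable `a`. -/
noncomputable abbrev ksbt (R : Type u) [CommRing R] (b a : Fin n) :
    Module.End R (KoszulModule R n) :=
  KoszulRel.sbt (fun a => opL R (extD R a)) (fun a => opL R (extE R a))
    (fun a => opR R (polX R a)) (fun a => opR R (polQ R a)) b a

/-- The homotopy has the form κ(…), so that its values are in the terms of L by construction; E_b
E_a Q_a raises the exterior degree by two and lowers the polynomial degree by one. -/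
theorem ksht_mem {k : ℕ} (hk : 1 ≤ k) (b a : Fin n) :
    ksht R b a ∈ shiftHom (fun i => beTerm R n k (i + 1)) 1 := by
  obtain ⟨j, rfl⟩ : ∃ j, k = j + 1 := ⟨k - 1, by omega⟩
  intro i x hx
  have h1 := mem_bidegree_of_mem hk hx
  refine Submodule.neg_mem _ ⟨_, opL_extE_mem b (opL_extE_mem a (opR_polQ_mem a h1)), ?_⟩
  rw [koszul_eq]
  rfl

variable (f : Fin n → R)

theorem exists_homotopy_koszul {k : ℕ} (hk : 1 ≤ k) (b : Fin n) (l : List (Fin n)) :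
    wordOp (contraction f) (ksht R b) (f b) l ∈ Ideal.span (Set.range f) ^ l.length •
      shiftHom (fun i => beTerm R n k (i + 1)) 0 ∧
    Commute (contraction f) (wordOp (contraction f) (ksht R b) (f b) l) ∧
    ∃ S : Module.End R (KoszulModule R n),
      f b • S ∈ Ideal.span (Set.range f) ^ l.length •
        shiftHom (fun i => beTerm R n k (i + 1)) 1 ∧
      f b ^ l.length • 1 - wordOp (contraction f) (ksht R b) (f b) l =
        contraction f * S + S * contraction f :=
  exists_homotopy_wordOp (T := fun i => beTerm R n k (i + 1)) (contraction_eq R f)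
    (LinearMap.ext fun x => contraction_contraction f x) (ksht_mem hk b)
    (fun c i _ hx => opL_extD_mem_beTerm k (i + 1) c hx)
    (fun c _ hx => opL_extD_eq_zero c (mem_bidegree_of_mem hk hx)) b l

theorem smul_sub_eq_of_eq {V : Type*} [AddCommGroup V] [Module R V] {r r' : R}
    {x p q z y : V} (h : y = r • (x - p) - r' • (z - q)) :
    r • x - y = r • p + r' • (z - q) := by
  rw [h, smul_sub]
  abel

/-- The substitution operator on the kernel of the Koszul differential. -/
theorem subOp_ksht_apply (b a : Fin n) {x : KoszulModule R n} (hx : koszul R n x = 0) :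
    subOp (contraction f) (ksht R b a) (f b) x = f b • kprj R a x + f a • ksbt R b a x := by
  have h := koszulRel R (n := n)
  have h1 := LinearMap.congr_fun (h.ctr_sht f b a) x
  have h2 := LinearMap.congr_fun (h.kap_eq a) x
  have h3 := LinearMap.congr_fun (h.kap_e b) (opR R (polQ R a) x)
  have h4 := LinearMap.congr_fun (h.kap_q a) x
  rw [← contraction_eq, ← koszul_eq] at h1
  rw [← koszul_eq] at h2 h3 h4
  change koszul R n (opL R (extE R a) (opR R (polQ R a) x)) +
    opL R (extE R a) (opR R (polQ R a) (koszul R n x)) = x - kprj R a x at h2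
  change koszul R n (opL R (extE R b) (opR R (polQ R a) x)) +
    opL R (extE R b) (koszul R n (opR R (polQ R a) x)) = opR R (polX R b) (opR R (polQ R a) x) at h3
  change koszul R n (opR R (polQ R a) x) = opR R (polQ R a) (koszul R n x) -
    opL R (extD R a) (KoszulRel.tau (fun a => opR R (polX R a)) (fun a => opR R (polQ R a)) a x)
    at h4
  -- When κx = 0, κE_aQ_a x is x minus its projection, and κE_bQ_a x = X_bQ_a x + E_bD_aτ_a x is the
  -- substitution. Insert both in the formula for [d, s].
  rw [hx, map_zero, map_zero, add_zero] at h2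
  rw [hx, map_zero, zero_sub] at h4
  rw [h4, map_neg, ← sub_eq_add_neg, sub_eq_iff_eq_add] at h3
  change (contraction f * ksht R b a + ksht R b a * contraction f) x =
    f b • koszul R n (opL R (extE R a) (opR R (polQ R a) x)) -
    f a • koszul R n (opL R (extE R b) (opR R (polQ R a) x)) at h1
  rw [h2, h3] at h1
  rw [← sub_neg_eq_add (opR R (polX R b) (opR R (polQ R a) x))] at h1
  refine (smul_sub_eq_of_eq h1).trans ?_
  rw [sub_neg_eq_add]
  rfl

end Terms


/-! ### Eliminating all variables but one -/

namespace KoszulRel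

variable {A : Type*} [Ring A] {n : ℕ} {D E X Q : Fin n → A} (h : KoszulRel D E X Q)
include h

theorem d_prj (a) : D a * prj D E X Q a = 0 := by
  rw [prj, ← mul_assoc, h.d_rho, zero_mul]

theorem q_prj (a) : Q a * prj D E X Q a = 0 := by
  rw [prj, ← mul_assoc, ← (h.commute_rho_q a a).eq, mul_assoc, h.q_tau, mul_zero]

theorem prod_rho_e {l : List (Fin n)} {a : Fin n} (ha : a ∈ l) :
    (l.map (rho D E)).prod * E a = 0 := by
  induction l with
  | nil => simp at ha
  | cons b l ih =>
    rw [List.map_cons, List.prod_cons]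
    by_cases hl : a ∈ l
    · rw [mul_assoc, ih hl, mul_zero]
    · obtain rfl : a = b := by simpa [hl] using ha
      have hc : Commute (l.map (rho D E)).prod (rho D E a) := by
        refine Commute.list_prod_left _ _ fun x hx => ?_
        obtain ⟨c, _, rfl⟩ := List.mem_map.mp hx
        exact h.commute_rho_rho c a
      rw [← hc.eq, mul_assoc, h.rho_e, mul_zero]

end KoszulRel

section Word

variable {R V : Type*} [CommRing R] [AddCommGroup V] [Module R V]

theorem wordOp_append {ι : Type*} (d : Module.End R V) (s : ι → Module.End R V) (r : R)
    (l l' : List ι) : wordOp d s r (l ++ l') = wordOp d s r l * wordOp d s r l' := by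
  rw [wordOp, List.map_append, List.prod_append]
  rfl

theorem wordOp_replicate {ι : Type*} (d : Module.End R V) (s : ι → Module.End R V) (r : R)
    (m : ℕ) (a : ι) : wordOp d s r (List.replicate m a) = subOp d (s a) r ^ m := by
  rw [wordOp, List.map_replicate, List.prod_replicate]

theorem pow_succ_apply' (N : Module.End R V) (m : ℕ) (x : V) :
    (N ^ (m + 1)) x = N ((N ^ m) x) := by
  rw [pow_succ', Module.End.mul_apply]

end Word

section Terms

variable {R : Type u} [CommRing R] {n : ℕ} (f : Fin n → R)

theorem subOp_ksht_mem {k : ℕ} (hk : 1 ≤ k) (b a : Fin n) {i : ℕ} {x : KoszulModule R n}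
    (hx : x ∈ beTerm R n k (i + 1)) :
    subOp (contraction f) (ksht R b a) (f b) x ∈ beTerm R n k (i + 1) := by
  have h := (exists_homotopy_koszul f hk b [a]).1
  exact mem_of_mem_smul_shiftHom h i x hx

/-- In degree k, k+1 divisions by X_a give zero, and `sbt_pow` loses one exponent: hence k+2. -/
theorem ksbt_pow_eq_zero {a b : Fin n} (hab : a ≠ b) {i k : ℕ} {x : KoszulModule R n}
    (hx : x ∈ bidegree R n i k) : (ksbt R b a ^ (k + 2)) x = 0 := by
  obtain ⟨y, hy⟩ := (koszulRel R (n := n)).sbt_pow hab (k + 1)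
  refine (LinearMap.congr_fun hy x).trans ?_
  change y ((opR R (polQ R a) ^ (k + 1)) x) = 0
  rw [opR_polQ_pow_eq_zero a hx, map_zero]

theorem ksbt_kprj {a b : Fin n} (x : KoszulModule R n) : ksbt R b a (kprj R a x) = 0 :=
  LinearMap.congr_fun ((koszulRel R (n := n)).sbt_prj (a := a) (b := b)) x

theorem kprj_kprj (a : Fin n) (x : KoszulModule R n) : kprj R a (kprj R a x) = kprj R a x :=
  LinearMap.congr_fun ((koszulRel R (n := n)).prj_sq a) x

/-- Once the nilpotent part has died, only the image of the projection omitting X_a and e_a remains.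
-/
theorem kprj_subOp_pow {k : ℕ} (hk : 1 ≤ k) {a b : Fin n} (hab : a ≠ b) {i : ℕ}
    {x : KoszulModule R n} (hx : x ∈ beTerm R n k (i + 1)) :
    kprj R a ((subOp (contraction f) (ksht R b a) (f b) ^ (k + 2)) x) =
      (subOp (contraction f) (ksht R b a) (f b) ^ (k + 2)) x := by
  obtain ⟨z, hz⟩ := exists_pow_subOp_apply (W := beTerm R n k (i + 1)) (p := kprj R a)
    (M := ksbt R b a) (r := f b) (r' := f a)
    (fun x hx => subOp_ksht_mem f hk b a hx)
    (fun x hx => subOp_ksht_apply f b a (koszul_eq_zero_of_mem hx)) ksbt_kprj (k + 1) x hx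
  rw [ksbt_pow_eq_zero hab (mem_bidegree_of_mem hk hx), smul_zero, add_zero] at hz
  rw [hz, kprj_kprj]

/-- A variable c ≠ b that has been eliminated does not come back: substituting b for a introduces
the index b only, and for a = c the substitution annihilates x. -/
theorem kprj_subOp {k : ℕ} {a b c : Fin n} (hcb : c ≠ b) {i : ℕ}
    {x : KoszulModule R n} (hx : x ∈ beTerm R n k (i + 1)) (hc : kprj R c x = x) :
    kprj R c (subOp (contraction f) (ksht R b a) (f b) x) =
      subOp (contraction f) (ksht R b a) (f b) x := by
  have h := koszulRel R (n := n)
  have h1 : kprj R c (kprj R a x) = kprj R a (kprj R c x) :=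
    LinearMap.congr_fun (h.commute_prj c a).eq x
  have h2 : kprj R c (ksbt R b a x) = ksbt R b a x := by
    by_cases hca : c = a
    · subst hca
      rw [← hc, ksbt_kprj, map_zero]
    · have : kprj R c (ksbt R b a x) = ksbt R b a (kprj R c x) :=
        LinearMap.congr_fun (h.commute_prj_sbt hca hcb).eq x
      rw [this, hc]
  rw [subOp_ksht_apply f b a (koszul_eq_zero_of_mem hx), map_add, map_smul, map_smul, h1, h2, hc]

theorem subOp_pow_mem {k : ℕ} (hk : 1 ≤ k) (b a : Fin n) (m : ℕ) {i : ℕ} {x : KoszulModule R n}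
    (hx : x ∈ beTerm R n k (i + 1)) :
    (subOp (contraction f) (ksht R b a) (f b) ^ m) x ∈ beTerm R n k (i + 1) := by
  induction m with
  | zero => exact hx
  | succ m ih =>
    rw [pow_succ']
    exact subOp_ksht_mem f hk b a ih

theorem kprj_subOp_pow_of_ne {k : ℕ} (hk : 1 ≤ k) {a b c : Fin n} (hcb : c ≠ b) {i : ℕ}
    {x : KoszulModule R n} (hx : x ∈ beTerm R n k (i + 1)) (hc : kprj R c x = x) (m : ℕ) :
    kprj R c ((subOp (contraction f) (ksht R b a) (f b) ^ m) x) =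
      (subOp (contraction f) (ksht R b a) (f b) ^ m) x := by
  induction m with
  | zero => exact hc
  | succ m ih =>
    rw [pow_succ_apply']
    exact kprj_subOp f hcb (subOp_pow_mem f hk b a m hx) ih

/-- The word in which every letter is repeated `k + 2` times. -/
def substWord (k : ℕ) (l : List (Fin n)) : List (Fin n) :=
  l.flatMap fun a => List.replicate (k + 2) a

theorem wordOp_substWord {k : ℕ} (hk : 1 ≤ k) {b : Fin n} {l : List (Fin n)} (hb : b ∉ l)
    {i : ℕ} {x : KoszulModule R n} (hx : x ∈ beTerm R n k (i + 1)) :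
    wordOp (contraction f) (ksht R b) (f b) (substWord k l) x ∈ beTerm R n k (i + 1) ∧
    ∀ a ∈ l, kprj R a (wordOp (contraction f) (ksht R b) (f b) (substWord k l) x) =
      wordOp (contraction f) (ksht R b) (f b) (substWord k l) x := by
  induction l with
  | nil => exact ⟨hx, by simp⟩
  | cons a l ih =>
    rw [List.mem_cons, not_or] at hb
    obtain ⟨h1, h2⟩ := ih hb.2
    have h3 : wordOp (contraction f) (ksht R b) (f b) (substWord k (a :: l)) x =
        (subOp (contraction f) (ksht R b a) (f b) ^ (k + 2))
          (wordOp (contraction f) (ksht R b) (f b) (substWord k l) x) := by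
      rw [substWord, List.flatMap_cons, wordOp_append, wordOp_replicate]
      rfl
    rw [h3]
    refine ⟨subOp_pow_mem f hk b a _ h1, List.forall_mem_cons.mpr ⟨?_, fun c hc => ?_⟩⟩
    · exact kprj_subOp_pow f hk (Ne.symm hb.1) h1
    · refine kprj_subOp_pow_of_ne f hk ?_ h1 (h2 c hc) _
      rintro rfl
      exact hb.2 hc

/-- For a ≠ b the absence of e_a gives D_a y = 0. Then κy = ∑ X_c D_c y reduces to X_b D_b y, and
multiplication by X_b is injective. -/
theorem opL_extD_eq_zero_of_kprj {b : Fin n} {y : KoszulModule R n} (h0 : koszul R n y = 0)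
    (hy : ∀ a, a ≠ b → kprj R a y = y) (a : Fin n) : opL R (extD R a) y = 0 := by
  have h := koszulRel R (n := n)
  have h1 (a : Fin n) (ha : a ≠ b) : opL R (extD R a) y = 0 := by
    rw [← hy a ha]
    exact LinearMap.congr_fun (h.d_prj a) y
  by_cases ha : a = b
  · subst ha
    have h2 : opR R (polX R a) (opL R (extD R a) y) = 0 := by
      have h3 : koszul R n y = ∑ c, opR R (polX R c) (opL R (extD R c) y) := by
        rw [koszul, LinearMap.sum_apply]
        refine Finset.sum_congr rfl fun c _ => ?_
        rw [← LinearMap.comp_apply, ← TensorProduct.map_comp]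
        rfl
      rw [h3, Finset.sum_eq_single a] at h0
      · exact h0
      · intro c _ hc
        rw [h1 c hc, map_zero]
      · simp
    have h4 : opR R (polQ R a) (opR R (polX R a) (opL R (extD R a) y)) = opL R (extD R a) y :=
      LinearMap.congr_fun (h.qx_same a) _
    rw [← h4, h2, map_zero]
  · exact h1 a ha

theorem exists_sum_extE {i j : ℕ} {y : KoszulModule R n} (hy : y ∈ bidegree R n (i + 1) j) :
    ∃ z : Fin n → KoszulModule R n, y = ∑ a, opL R (extE R a) (z a) := by
  let W : Submodule R (KoszulModule R n) :=
    LinearMap.range (∑ a, (opL R (extE R a)) ∘ₗ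
      (LinearMap.proj a : (Fin n → KoszulModule R n) →ₗ[R] KoszulModule R n))
  have hW : bidegree R n (i + 1) j ≤ W := by
    refine bidegree_le fun w hw s _ => ?_
    rw [ExteriorAlgebra.exteriorPower, pow_succ'] at hw
    refine Submodule.mul_induction_on hw ?_ ?_
    · rintro _ ⟨v, rfl⟩ c _
      refine ⟨fun a => v a • (c ⊗ₜ s), ?_⟩
      rw [LinearMap.sum_apply]
      have hv : v = ∑ a, v a • (Pi.single a (1 : R) : Fin n → R) := by
        ext b
        simp [Finset.sum_apply, Pi.single_apply]
      conv_rhs => rw [hv]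
      rw [map_sum, Finset.sum_mul, TensorProduct.sum_tmul]
      refine Finset.sum_congr rfl fun a _ => ?_
      change opL R (extE R a) (v a • (c ⊗ₜ[R] s)) = _
      rw [map_smul, map_smul, smul_mul_assoc, ← TensorProduct.smul_tmul']
      rfl
    · intro x y hx hy
      rw [TensorProduct.add_tmul]
      exact W.add_mem hx hy
  obtain ⟨z, hz⟩ := hW hy
  refine ⟨z, ?_⟩
  rw [← hz, LinearMap.sum_apply]
  rfl

/-- If all D_a y vanish, then y is fixed by every D_a E_a. The product of these commuting
projections kills every multiple of a basis vector, and in positive exterior degree y is a sum of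
such. Unlike the Euler formula ∑ E_a D_a = degree, this needs no division by integers. -/
theorem eq_zero_of_opL_extD {i j : ℕ} {y : KoszulModule R n} (hy : y ∈ bidegree R n (i + 1) j)
    (h0 : ∀ a, opL R (extD R a) y = 0) : y = 0 := by
  have h := koszulRel R (n := n)
  let P : List (Fin n) → Module.End R (KoszulModule R n) := fun l =>
    (l.map (KoszulRel.rho (fun a => opL R (extD R a)) (fun a => opL R (extE R a)))).prod
  have h1 (l : List (Fin n)) : P l y = y := by
    induction l with
    | nil => rfl
    | cons a l ih =>
      change opL R (extD R a) (opL R (extE R a) (P l y)) = y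
      rw [ih]
      have h2 : opL R (extD R a) (opL R (extE R a) y) =
          y - opL R (extE R a) (opL R (extD R a) y) := LinearMap.congr_fun (h.de_same a) y
      rw [h2, h0, map_zero, sub_zero]
  obtain ⟨z, hz⟩ := exists_sum_extE hy
  rw [← h1 (List.finRange n), hz, map_sum]
  refine Finset.sum_eq_zero fun a _ => ?_
  exact LinearMap.congr_fun (h.prod_rho_e (List.mem_finRange a)) (z a)

theorem eq_tmul_of_mem_bidegree_zero {j : ℕ} {y : KoszulModule R n}
    (hy : y ∈ bidegree R n 0 j) : ∃ s : MvPolynomial (Fin n) R, s.IsHomogeneous j ∧ y = 1 ⊗ₜ s := by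
  let W : Submodule R (KoszulModule R n) :=
    (MvPolynomial.homogeneousSubmodule (Fin n) R j).map
      (TensorProduct.mk R (ExteriorAlgebra R (Fin n → R)) (MvPolynomial (Fin n) R) 1)
  have hW : bidegree R n 0 j ≤ W := by
    refine bidegree_le fun w hw s hs => ?_
    obtain ⟨c, rfl⟩ := mem_exteriorPower_zero hw
    refine ⟨c • s, Submodule.smul_mem _ c hs, ?_⟩
    rw [Algebra.algebraMap_eq_smul_one, TensorProduct.smul_tmul]
    rfl
  obtain ⟨s, hs, rfl⟩ := hW hy
  exact ⟨s, hs, rfl⟩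

theorem eq_smul_X_pow {b : Fin n} {k : ℕ} {s : MvPolynomial (Fin n) R} (hs : s.IsHomogeneous k)
    (h0 : ∀ a, a ≠ b → polQ R a s = 0) : s = s.coeff (Finsupp.single b k) •
      (MvPolynomial.X b : MvPolynomial (Fin n) R) ^ k := by
  ext d
  rw [MvPolynomial.coeff_smul, MvPolynomial.coeff_X_pow]
  split_ifs with hd
  · rw [← hd, smul_eq_mul, mul_one]
  · rw [smul_zero]
    by_contra hc
    have hz : ∀ a, a ≠ b → d a = 0 := by
      intro a ha
      by_contra hda
      have h1 := congrArg (MvPolynomial.coeff (d - Finsupp.single a 1)) (h0 a ha)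
      rw [coeff_polQ, add_tsub_cancel_of_le, MvPolynomial.coeff_zero] at h1
      · exact hc h1
      · rw [Finsupp.single_le_iff]
        omega
    have hd' : d = Finsupp.single b (d b) := by
      ext a
      by_cases ha : a = b
      · rw [ha, Finsupp.single_eq_same]
      · rw [Finsupp.single_eq_of_ne ha, hz a ha]
    have h2 := hs hc
    rw [hd', Finsupp.weight_single, Pi.one_apply, smul_eq_mul, mul_one] at h2
    rw [h2] at hd'
    exact hd hd'.symm

theorem polyEval_one_tmul (s : MvPolynomial (Fin n) R) :
    polyEval f (1 ⊗ₜ s) = MvPolynomial.aeval f s := by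
  simp [polyEval]

theorem opR_polQ_eq_zero_of_kprj {a : Fin n} {y : KoszulModule R n} (hy : kprj R a y = y) :
    opR R (polQ R a) y = 0 := by
  rw [← hy]
  exact LinearMap.congr_fun ((koszulRel R (n := n)).q_prj a) y

/-- Only X_b can occur, so y = c X_b^k and its evaluation is c f_b^k. Expressing y through its
evaluation is what later yields a map out of R. -/
theorem pow_smul_eq_of_kprj {b : Fin n} {k : ℕ} {y : KoszulModule R n}
    (hy : y ∈ bidegree R n 0 k) (h0 : ∀ a, a ≠ b → kprj R a y = y) :
    f b ^ k • y = polyEval f y • ((1 : ExteriorAlgebra R (Fin n → R)) ⊗ₜ[R]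
      ((MvPolynomial.X b : MvPolynomial (Fin n) R) ^ k)) := by
  obtain ⟨s, hs, rfl⟩ := eq_tmul_of_mem_bidegree_zero hy
  have h1 : ∀ a, a ≠ b → polQ R a s = 0 := by
    intro a ha
    have h2 := opR_polQ_eq_zero_of_kprj (h0 a ha)
    let ε : KoszulModule R n →ₗ[R] MvPolynomial (Fin n) R :=
      (TensorProduct.lid R _).toLinearMap ∘ₗ TensorProduct.map
        (ExteriorAlgebra.algebraMapInv (R := R) (M := Fin n → R)).toLinearMap LinearMap.id
    have h3 : ε (1 ⊗ₜ polQ R a s) = polQ R a s := by simp [ε]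
    rw [← h3]
    exact (congrArg ε h2).trans (map_zero ε)
  have h4 := eq_smul_X_pow hs h1
  generalize s.coeff (Finsupp.single b k) = c at h4
  subst h4
  rw [polyEval_one_tmul, map_smul, map_pow, MvPolynomial.aeval_X, TensorProduct.tmul_smul,
    smul_smul, smul_eq_mul, mul_comm]

end Terms


/-! ### Weighted homotopies on the Buchsbaum–Eisenbud complex -/

theorem map_mem_smul_top {R M N : Type*} [CommRing R] [AddCommGroup M] [Module R M]
    [AddCommGroup N] [Module R N] {I : Ideal R} (φ : M →ₗ[R] N) {x : M}
    (hx : x ∈ I • (⊤ : Submodule R M)) : φ x ∈ I • (⊤ : Submodule R N) := by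
  have h := Submodule.mem_map_of_mem (f := φ) hx
  rw [Submodule.map_smul''] at h
  exact Submodule.smul_mono le_rfl le_top h

theorem aeval_mem_pow {R : Type*} [CommRing R] {n k : ℕ} (f : Fin n → R)
    {s : MvPolynomial (Fin n) R} (hs : s.IsHomogeneous k) :
    MvPolynomial.aeval f s ∈ Ideal.span (Set.range f) ^ k := by
  rw [MvPolynomial.aeval_def, MvPolynomial.eval₂_eq]
  refine Submodule.sum_mem _ fun d hd => Ideal.mul_mem_left _ _ ?_
  have h1 : k = ∑ i ∈ d.support, d i := by
    have h2 := hs (MvPolynomial.mem_support_iff.mp hd)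
    rw [Finsupp.weight_apply] at h2
    simpa [Finsupp.sum] using h2.symm
  rw [h1, ← Finset.prod_pow_eq_pow_sum]
  exact Ideal.prod_mem_prod fun i _ => Ideal.pow_mem_pow (Ideal.subset_span (Set.mem_range_self i)) _

section Module

variable {R V : Type*} [CommRing R] [AddCommGroup V] [Module R V]

theorem smul_sub_smul_eq {d S : V →ₗ[R] V} {r : R} {m : ℕ} {x y z : V}
    (h : r ^ m • x - y = d (S x) + S z) :
    r ^ (m + 1) • x - r • y = d ((r • S) x) + (r • S) z := by
  rw [pow_succ', mul_smul, ← smul_sub, h, smul_add, ← map_smul]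
  rfl

theorem pow_smul_eq_add {d : V →ₗ[R] V} {ev : V →ₗ[R] R} {c : R} {k m : ℕ} {x y z v : V}
    (h3 : c ^ k • y = ev y • v) (h4 : c ^ (m + 1) • x - c • y = d z)
    (h5 : c ^ (m + 1) • ev x = c • ev y) :
    c ^ (k + m + 1) • x = d (c ^ k • z) + ev x • (c ^ (m + 1) • v) := by
  rw [map_smul, ← h4, smul_smul (ev x), mul_comm (ev x), ← smul_eq_mul, h5, smul_sub, smul_smul,
    smul_comm (c ^ k) c, h3, smul_eq_mul, mul_smul c (ev y) v, sub_add_cancel, ← pow_add,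
    add_assoc]

end Module

section Chain

variable {R : Type u} [CommRing R] {n : ℕ} (f : Fin n → R)

theorem exists_smul_sub_eq {k : ℕ} (hk : 1 ≤ k) (b : Fin n) :
    ∃ (r : ℕ) (S B : Module.End R (KoszulModule R n)),
      S ∈ Ideal.span (Set.range f) ^ r • shiftHom (fun i => beTerm R n k (i + 1)) 1 ∧
      (∀ x, f b ^ (r + 1) • x - f b • B x = contraction f (S x) + S (contraction f x)) ∧
      ∀ i, ∀ x ∈ beTerm R n k (i + 1), B x ∈ beTerm R n k (i + 1) ∧
        ∀ a, a ≠ b → kprj R a (B x) = B x := by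
  let l := substWord k ((List.finRange n).filter (· ≠ b))
  obtain ⟨-, -, S, hS, hS'⟩ := exists_homotopy_koszul f hk b l
  -- Multiplying the homotopy by f_b puts it into J^r at the price of one more power of f_b, whence
  -- the exponents r and r + 1.
  refine ⟨l.length, f b • S, wordOp (contraction f) (ksht R b) (f b) l, hS, fun x => ?_,
    fun i x hx => ?_⟩
  · have h1 : f b ^ l.length • x - wordOp (contraction f) (ksht R b) (f b) l x =
        contraction f (S x) + S (contraction f x) := LinearMap.congr_fun hS' x
    exact smul_sub_smul_eq h1
  · obtain ⟨h1, h2⟩ := wordOp_substWord f hk (b := b)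
      (l := (List.finRange n).filter (· ≠ b)) (by simp) hx
    exact ⟨h1, fun a ha => h2 a (by simpa using ha)⟩

theorem contraction_eq_zero {j : ℕ} {x : KoszulModule R n} (hx : x ∈ bidegree R n 0 j) :
    contraction f x = 0 := by
  rw [contraction_eq, KoszulRel.ctr, LinearMap.sum_apply]
  refine Finset.sum_eq_zero fun a _ => ?_
  rw [LinearMap.smul_apply, opL_extD_eq_zero a hx, smul_zero]

theorem one_tmul_X_pow_mem {k : ℕ} (hk : 1 ≤ k) (b : Fin n) :
    ((1 : ExteriorAlgebra R (Fin n → R)) ⊗ₜ[R] ((MvPolynomial.X b : MvPolynomial (Fin n) R) ^ k)) ∈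
      beTerm R n k 1 := by
  refine (mem_beTerm_iff hk).mpr ?_
  have h1 : ((1 : ExteriorAlgebra R (Fin n → R)) ⊗ₜ[R]
      ((MvPolynomial.X b : MvPolynomial (Fin n) R) ^ k)) ∈ bidegree R n 0 k := by
    refine tmul_mem_bidegree ?_ (MvPolynomial.isHomogeneous_X_pow b k)
    rw [ExteriorAlgebra.exteriorPower, pow_zero]
    exact Submodule.one_le.mp le_rfl
  refine ⟨h1, ?_⟩
  rw [koszul_eq, KoszulRel.kap, LinearMap.sum_apply]
  refine Finset.sum_eq_zero fun a _ => ?_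
  have h2 := LinearMap.congr_fun ((koszulRel R (n := n)).dx a a).eq
    ((1 : ExteriorAlgebra R (Fin n → R)) ⊗ₜ[R] ((MvPolynomial.X b : MvPolynomial (Fin n) R) ^ k))
  exact h2.trans ((congrArg (opR R (polX R a)) (opL_extD_eq_zero a h1)).trans (map_zero _))

theorem polyEval_contraction {k : ℕ} {x : KoszulModule R n} (hx : x ∈ beTerm R n k 2) :
    polyEval f (contraction f x) = 0 := by
  obtain ⟨y, _, rfl⟩ := hx
  rw [contraction_koszul, map_neg, polyEval_koszul, contraction_contraction, map_zero, neg_zero]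

theorem polyEval_mem {k : ℕ} (hk : 1 ≤ k) {x : KoszulModule R n} (hx : x ∈ beTerm R n k 1) :
    polyEval f x ∈ Ideal.span (Set.range f) ^ k := by
  obtain ⟨s, hs, rfl⟩ := eq_tmul_of_mem_bidegree_zero (mem_bidegree_of_mem hk hx)
  rw [polyEval_one_tmul]
  exact aeval_mem_pow f hs

/-- The weights n - (i+1) and n - (i+2) differ by one unless the truncated subtraction has reached
zero. In that case the target of s is zero, and the exponent can be raised for free. -/
theorem exists_weight_le {k i r : ℕ} {I : Ideal R}
    {s : beTerm R n k (i + 1) →ₗ[R] beTerm R n k (i + 2)} (hs : s ∈ I ^ r • (⊤ : Submodule R _)) :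
    ∃ e, s ∈ I ^ e • (⊤ : Submodule R (beTerm R n k (i + 1) →ₗ[R] beTerm R n k (i + 2))) ∧
      r + 1 + (n - (i + 2)) ≤ e + (n - (i + 1)) := by
  by_cases hi : n < i + 2
  · refine ⟨r + 1, ?_, by omega⟩
    have h0 : s = 0 := by
      ext x
      have h1 := (s x).2
      have h2 := (beTerm_eq_bot (R := R) (k := k) hi).le h1
      exact (Submodule.mem_bot R).mp h2
    rw [h0]
    exact Submodule.zero_mem _
  · exact ⟨r, hs, by omega⟩

/-- In positive exterior degree nothing survives the elimination of all variables but X_b, so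
f_b^{r+1} itself is homotopic to zero. -/
theorem beHomotopy_succ_succ {k : ℕ} (hk : 1 ≤ k) (b : Fin n) (i : ℕ) :
    ∃ (c e : ℕ) (s : beX R n k (i + 2) →ₗ[R] beX R n k (i + 3))
      (t : beX R n k (i + 1) →ₗ[R] beX R n k (i + 2)),
      s ∈ Ideal.span (Set.range f) ^ e • (⊤ : Submodule R _) ∧
      c + (n - (i + 3)) ≤ e + (n - (i + 2)) ∧
      ∀ x, f b ^ c • x = (beD f k (i + 2)).hom (s x) + t ((beD f k (i + 1)).hom x) := by
  obtain ⟨r, S, B, hS, hSB, hB⟩ := exists_smul_sub_eq f hk b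
  obtain ⟨s, hs, hs'⟩ := exists_restrict_shiftHom hS (i + 1)
  obtain ⟨t, -, ht'⟩ := exists_restrict_shiftHom hS i
  obtain ⟨e, he, hle⟩ := exists_weight_le hs
  refine ⟨r + 1, e, s, t, he, hle, fun x => Subtype.ext ?_⟩
  obtain ⟨h1, h2⟩ := hB (i + 1) x.1 x.2
  have h3 : B x.1 = 0 := eq_zero_of_opL_extD (mem_bidegree_of_mem hk h1)
    (opL_extD_eq_zero_of_kprj (koszul_eq_zero_of_mem h1) h2)
  have h4 := hSB x.1
  rw [h3, smul_zero, sub_zero] at h4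
  refine h4.trans ?_
  refine congrArg₂ (· + ·) (congrArg (contraction f) (hs' x).symm) ?_
  exact (ht' ⟨_, contraction_mem_beTerm f k (i + 1) x.1 x.2⟩).symm

/-- In exterior degree 0 the survivors are multiples of X_b^k. After multiplication by f_b^k they
factor through the evaluation L_1 → R, with t sending 1 to f_b^{r+1} X_b^k. The factor f_b^k raises
the power of f_b and the order of s alike, so no weight is lost. -/
theorem beHomotopy_one {k : ℕ} (hk : 1 ≤ k) (b : Fin n) :
    ∃ (c e : ℕ) (s : beX R n k 1 →ₗ[R] beX R n k 2) (t : beX R n k 0 →ₗ[R] beX R n k 1),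
      s ∈ Ideal.span (Set.range f) ^ e • (⊤ : Submodule R _) ∧
      c + (n - 2) ≤ e + (n - 1) ∧
      ∀ x, f b ^ c • x = (beD f k 1).hom (s x) + t ((beD f k 0).hom x) := by
  obtain ⟨r, S, B, hS, hSB, hB⟩ := exists_smul_sub_eq f hk b
  obtain ⟨s, hs, hs'⟩ := exists_restrict_shiftHom hS 0
  have hb : f b ∈ Ideal.span (Set.range f) := Ideal.subset_span (Set.mem_range_self b)
  have hs2 : f b ^ k • s ∈ Ideal.span (Set.range f) ^ (k + r) • (⊤ : Submodule R _) := by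
    rw [pow_add, Submodule.mul_smul]
    exact Submodule.smul_mem_smul (Ideal.pow_mem_pow hb k) hs
  obtain ⟨e, he, hle⟩ := exists_weight_le hs2
  let v : beX R n k 1 := ⟨_, one_tmul_X_pow_mem hk b⟩
  refine ⟨k + r + 1, e, f b ^ k • s, LinearMap.toSpanSingleton R _ (f b ^ (r + 1) • v), he, hle,
    fun x => Subtype.ext ?_⟩
  obtain ⟨h1, h2⟩ := hB 0 x.1 x.2
  have h3 := pow_smul_eq_of_kprj f (mem_bidegree_of_mem hk h1) h2
  have h4 := hSB x.1
  rw [contraction_eq_zero f (mem_bidegree_of_mem hk x.2), map_zero, add_zero] at h4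
  have h5 := congrArg (polyEval f) h4
  have h6 : S x.1 ∈ beTerm R n k 2 := hs' x ▸ (s x).2
  rw [polyEval_contraction f h6, map_sub, map_smul, map_smul, sub_eq_zero] at h5
  refine (pow_smul_eq_add h3 h4 h5).trans ?_
  rw [← hs' x]
  rfl

theorem beHomotopy_zero {k : ℕ} (hk : 1 ≤ k) (b : Fin n) :
    ∃ s : beX R n k 0 →ₗ[R] beX R n k 1, ∀ x, f b ^ k • x = (beD f k 0).hom (s x) := by
  let v : beX R n k 1 := ⟨_, one_tmul_X_pow_mem hk b⟩
  refine ⟨LinearMap.toSpanSingleton R _ v, fun (x : R) => ?_⟩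
  change f b ^ k * x = polyEval f (x • v.1)
  rw [map_smul, polyEval_one_tmul, map_pow, MvPolynomial.aeval_X, smul_eq_mul, mul_comm]

theorem beD_zero_mem {k : ℕ} (hk : 1 ≤ k) (x : beX R n k 1) :
    (beD f k 0).hom x ∈ Ideal.span (Set.range f) ^ k • (⊤ : Submodule R (beX R n k 0)) := by
  have h1 : polyEval f x.1 ∈ Ideal.span (Set.range f) ^ k := polyEval_mem f hk x.2
  have h2 : (beD f k 0).hom x = polyEval f x.1 • (1 : R) := (mul_one (polyEval f x.1)).symm
  rw [h2]
  exact Submodule.smul_mem_smul h1 trivial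

theorem beD_succ_mem (k i : ℕ) (x : beX R n k (i + 2)) :
    (beD f k (i + 1)).hom x ∈
      Ideal.span (Set.range f) • (⊤ : Submodule R (beX R n k (i + 1))) := by
  let D (c : Fin n) : beTerm R n k (i + 1) :=
    ⟨opL R (extD R c) x.1, opL_extD_mem_beTerm k (i + 1) c x.2⟩
  have h1 : (beD f k (i + 1)).hom x = ∑ c, f c • D c := by
    refine Subtype.ext ?_
    change contraction f x.1 = ((∑ c, f c • D c : beTerm R n k (i + 1)) : KoszulModule R n)
    rw [AddSubmonoidClass.coe_finsetSum, contraction_eq, KoszulRel.ctr, LinearMap.sum_apply]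
    rfl
  rw [h1]
  exact Submodule.sum_mem _ fun c _ =>
    Submodule.smul_mem_smul (Ideal.subset_span (Set.mem_range_self c)) trivial

theorem finite_beX (k i : ℕ) : Module.Finite R (beX R n k i) := by
  cases i with
  | zero => exact inferInstanceAs (Module.Finite R R)
  | succ i => exact inferInstanceAs (Module.Finite R (beTerm R n k (i + 1)))

theorem projective_beX {k : ℕ} (hk : 1 ≤ k) (i : ℕ) : Module.Projective R (beX R n k i) := by
  cases i with
  | zero => exact inferInstanceAs (Module.Projective R R)
  | succ i => exact projective_beTerm hk i

theorem isZero_beX {k i : ℕ} (hi : n ≤ i) : IsZero (beX R n k (i + 1)) := by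
  have : Subsingleton (beX R n k (i + 1)) :=
    (Submodule.subsingleton_iff_eq_bot).mpr (beTerm_eq_bot (R := R) (k := k) (by omega))
  exact ModuleCat.isZero_of_subsingleton _

end Chain


/-! ### Weighted contractibility of L^k(f) -/

section Weights

variable {R : Type u} [CommRing R] {n : ℕ} (f : Fin n → R)

/-- A complex of finite projective modules, with weights `w`, such that the differentials increase
the filtration by powers of `J = (f_1, …, f_n)`, and such that every `f_a` has a power homotopic to
zero by a homotopy compatible with the filtration. -/
structure IsWeightedContractible (K : CochainComplex (ModuleCat.{u} R) ℤ) (w : ℤ → ℕ) : Prop where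
  finite q : Module.Finite R (K.X q)
  projective q : Module.Projective R (K.X q)
  d_mem p q : p + 1 = q → ∀ x, (K.d p q).hom x ∈
    Ideal.span (Set.range f) ^ (w q - w p) • (⊤ : Submodule R (K.X q))
  homotopy a p q r : p + 1 = q → q + 1 = r → ∃ (c e : ℕ) (s : K.X q →ₗ[R] K.X p)
    (t : K.X r →ₗ[R] K.X q), s ∈ Ideal.span (Set.range f) ^ e • (⊤ : Submodule R _) ∧
      c + w p ≤ e + w q ∧ ∀ x, f a ^ c • x = (K.d p q).hom (s x) + t ((K.d q r).hom x)

/-- The weights of the Buchsbaum-Eisenbud complex. -/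
def beWeight (n k : ℕ) (q : ℤ) : ℕ := if 0 ≤ q then n + k - 1 else (n + q).toNat

theorem beWeight_zero (n k : ℕ) : beWeight n k 0 = n + k - 1 := rfl

theorem beWeight_neg (n k i : ℕ) : beWeight n k (-((i + 1 : ℕ) : ℤ)) = n - (i + 1) := by
  rw [beWeight, if_neg (by omega)]
  omega

/-- The terms of the Buchsbaum-Eisenbud complex. -/
noncomputable def beComplexXIso (k i : ℕ) {q : ℤ} (hq : q = -(i : ℤ)) :
    (beComplex f k).X q ≅ beX R n k i :=
  (beChain f k).extendXIso ComplexShape.embeddingDownNat (i := i) (i' := q) hq.symm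

theorem beComplex_d (k i : ℕ) {p q : ℤ} (hp : p = -((i + 1 : ℕ) : ℤ)) (hq : q = -(i : ℤ)) :
    (beComplex f k).d p q = (beComplexXIso f k (i + 1) hp).hom ≫ beD f k i ≫
      (beComplexXIso f k i hq).inv := by
  have h := (beChain f k).extend_d_eq ComplexShape.embeddingDownNat (i := i + 1) (j := i)
    (i' := p) (j' := q) hp.symm hq.symm
  have hd : (beChain f k).d (i + 1) i = beD f k i := ChainComplex.of_d _ _ _
  rw [hd] at h
  exact h

theorem isZero_beComplex (k : ℕ) {q : ℤ} (hq : 0 < q) : IsZero ((beComplex f k).X q) :=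
  (beChain f k).isZero_extend_X ComplexShape.embeddingDownNat q fun i hi => by
    simp at hi
    omega

theorem isZero_beComplex_of_lt (k : ℕ) {q : ℤ} (hq : q < -(n : ℤ)) :
    IsZero ((beComplex f k).X q) := by
  obtain ⟨i, hi⟩ : ∃ i : ℕ, q = -((i + 1 : ℕ) : ℤ) := ⟨(-q).toNat - 1, by omega⟩
  exact (isZero_beX (by omega)).of_iso (beComplexXIso f k (i + 1) hi)

theorem subsingleton_of_isZero {M : ModuleCat.{u} R} (hM : IsZero M) : Subsingleton M :=
  ModuleCat.subsingleton_of_isZero hM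

theorem comp_mem_smul_top {M N M' N' : Type*} [AddCommGroup M] [Module R M] [AddCommGroup N]
    [Module R N] [AddCommGroup M'] [Module R M'] [AddCommGroup N'] [Module R N'] {I : Ideal R}
    (φ : N →ₗ[R] N') (ψ : M' →ₗ[R] M) {s : M →ₗ[R] N}
    (hs : s ∈ I • (⊤ : Submodule R (M →ₗ[R] N))) :
    φ ∘ₗ s ∘ₗ ψ ∈ I • (⊤ : Submodule R (M' →ₗ[R] N')) :=
  map_mem_smul_top ((LinearMap.llcomp R M' N N' φ) ∘ₗ (LinearMap.lcomp R N ψ)) hs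

theorem isWeightedContractible_beComplex (hn : 1 ≤ n) {k : ℕ} (hk : 1 ≤ k) :
    IsWeightedContractible f (beComplex f k) (beWeight n k) where
  finite q := by
    by_cases hq : 0 < q
    · have := subsingleton_of_isZero (isZero_beComplex f k hq)
      infer_instance
    · have := finite_beX (R := R) (n := n) k (-q).toNat
      exact Module.Finite.equiv (beComplexXIso f k (-q).toNat (by omega)).symm.toLinearEquiv
  projective q := by
    by_cases hq : 0 < q
    · have := subsingleton_of_isZero (isZero_beComplex f k hq)
      infer_instance
    · have := projective_beX (R := R) (n := n) hk (-q).toNat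
      exact Module.Projective.of_equiv (beComplexXIso f k (-q).toNat (by omega)).symm.toLinearEquiv
  d_mem p q hpq x := by
    by_cases hq : 0 < q
    · have := subsingleton_of_isZero (isZero_beComplex f k hq)
      rw [Subsingleton.elim ((beComplex f k).d p q |>.hom x) 0]
      exact Submodule.zero_mem _
    · obtain ⟨i, rfl⟩ : ∃ i : ℕ, q = -(i : ℤ) := ⟨(-q).toNat, by omega⟩
      obtain rfl : p = -((i + 1 : ℕ) : ℤ) := by omega
      rw [beComplex_d f k i rfl rfl]
      refine map_mem_smul_top (beComplexXIso f k i rfl).inv.hom ?_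
      cases i with
      | zero =>
        rw [beWeight_neg, Nat.cast_zero, neg_zero, beWeight_zero,
          show n + k - 1 - (n - (0 + 1)) = k by omega]
        exact beD_zero_mem f hk _
      | succ i =>
        have h1 : (beD f k (i + 1)).hom ((beComplexXIso f k (i + 1 + 1) rfl).hom.hom x) ∈
          Ideal.span (Set.range f) • (⊤ : Submodule R (beX R n k (i + 1))) := beD_succ_mem f k i _
        rw [beWeight_neg, beWeight_neg]
        rw [← pow_one (Ideal.span (Set.range f))] at h1
        exact Submodule.smul_mono (Ideal.pow_le_pow_right (by omega)) le_rfl h1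
  homotopy a p q r hpq hqr := by
    by_cases hq : 0 < q
    · have := subsingleton_of_isZero (isZero_beComplex f k hq)
      -- In positive degrees the term is zero, so any exponent e works; the weight of the preceding
      -- degree makes the inequality trivial.
      exact ⟨0, beWeight n k p, 0, 0, Submodule.zero_mem _, by omega,
        fun x => Subsingleton.elim _ _⟩
    · obtain ⟨i, rfl⟩ : ∃ i : ℕ, q = -(i : ℤ) := ⟨(-q).toNat, by omega⟩
      obtain rfl : p = -((i + 1 : ℕ) : ℤ) := by omega
      cases i with
      | zero =>
        obtain ⟨s, hs⟩ := beHomotopy_zero f hk a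
        let φ := beComplexXIso f k 0 (q := -((0 : ℕ) : ℤ)) rfl
        let ψ := beComplexXIso f k 1 (q := -((0 + 1 : ℕ) : ℤ)) rfl
        -- In degree 0 the homotopy carries no power of J. The jump of the weight from n - 1 to n +
        -- k - 1 is exactly the exponent k; this uses n ≥ 1.
        refine ⟨k, 0, ψ.inv.hom ∘ₗ s ∘ₗ φ.hom.hom, 0, ?_, ?_, fun x => ?_⟩
        · rw [pow_zero, Ideal.one_eq_top, Submodule.top_smul]
          trivial
        · rw [beWeight_neg, Nat.cast_zero, neg_zero, beWeight_zero]
          omega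
        · rw [LinearMap.zero_apply, add_zero, beComplex_d f k 0 rfl rfl]
          change _ = φ.inv.hom ((beD f k 0).hom (ψ.hom.hom (ψ.inv.hom (s (φ.hom.hom x)))))
          have e1 : ∀ y, ψ.hom.hom (ψ.inv.hom y) = y := fun y => by
            rw [← LinearMap.comp_apply, ← ModuleCat.hom_comp, ψ.inv_hom_id]; rfl
          rw [e1, ← hs, map_smul, ← LinearMap.comp_apply, ← ModuleCat.hom_comp,
            φ.hom_inv_id, ModuleCat.hom_id, LinearMap.id_apply]
      | succ i =>
        obtain rfl : r = -(i : ℤ) := by omega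
        have key : ∃ (c e : ℕ) (s : beX R n k (i + 1) →ₗ[R] beX R n k (i + 2))
          (t : beX R n k i →ₗ[R] beX R n k (i + 1)),
          s ∈ Ideal.span (Set.range f) ^ e • (⊤ : Submodule R _) ∧
          c + (n - (i + 2)) ≤ e + (n - (i + 1)) ∧
          ∀ x, f a ^ c • x = (beD f k (i + 1)).hom (s x) + t ((beD f k i).hom x) := by
          cases i with
          | zero => exact beHomotopy_one f hk a
          | succ i => exact beHomotopy_succ_succ f hk a i
        obtain ⟨c, e, s, t, h1, h2, h3⟩ := key
        let φ := beComplexXIso f k (i + 1) (q := -((i + 1 : ℕ) : ℤ)) rfl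
        let ψ := beComplexXIso f k (i + 2) (q := -((i + 2 : ℕ) : ℤ)) rfl
        let χ := beComplexXIso f k i (q := -(i : ℤ)) rfl
        refine ⟨c, e, ψ.inv.hom ∘ₗ s ∘ₗ φ.hom.hom, φ.inv.hom ∘ₗ t ∘ₗ χ.hom.hom,
          comp_mem_smul_top _ _ h1, ?_, fun x => ?_⟩
        · rw [beWeight_neg, beWeight_neg]
          exact h2
        · rw [beComplex_d f k (i + 1) rfl rfl, beComplex_d f k i rfl rfl]
          change _ = φ.inv.hom ((beD f k (i + 1)).hom (ψ.hom.hom (ψ.inv.hom (s (φ.hom.hom x))))) +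
            φ.inv.hom (t (χ.hom.hom (χ.inv.hom ((beD f k i).hom (φ.hom.hom x)))))
          have e1 : ∀ y, ψ.hom.hom (ψ.inv.hom y) = y := fun y => by
            rw [← LinearMap.comp_apply, ← ModuleCat.hom_comp, ψ.inv_hom_id]; rfl
          have e2 : ∀ y, χ.hom.hom (χ.inv.hom y) = y := fun y => by
            rw [← LinearMap.comp_apply, ← ModuleCat.hom_comp, χ.inv_hom_id]; rfl
          rw [e1, e2, ← map_add, ← h3, map_smul, ← LinearMap.comp_apply, ← ModuleCat.hom_comp,
            φ.hom_inv_id, ModuleCat.hom_id, LinearMap.id_apply]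

end Weights


/-! ### Module structures on the values of additive functors -/

section SectionModule

variable {R : Type u} [CommRing R] (G : ModuleCat.{u} R ⥤ AddCommGrpCat.{u}) [G.Additive]

/-- The module structure on the values of an additive functor on modules. -/
@[reducible]
noncomputable def valueModule (L : ModuleCat.{u} R) : Module R (G.obj L) where
  smul r x := G.map (r • 𝟙 L) x
  one_smul x := by
    change G.map ((1 : R) • 𝟙 L) x = x
    rw [one_smul, G.map_id]
    rfl
  mul_smul r r' x := by
    change G.map ((r * r') • 𝟙 L) x = G.map (r • 𝟙 L) (G.map (r' • 𝟙 L) x)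
    have h : (r * r') • 𝟙 L = (r' • 𝟙 L) ≫ (r • 𝟙 L) := by
      rw [Linear.comp_smul, Category.comp_id, smul_smul]
    rw [h, G.map_comp]
    rfl
  smul_zero r := map_zero (G.map (r • 𝟙 L)).hom
  smul_add r x y := map_add (G.map (r • 𝟙 L)).hom x y
  add_smul r r' x := by
    change G.map ((r + r') • 𝟙 L) x = G.map (r • 𝟙 L) x + G.map (r' • 𝟙 L) x
    rw [add_smul, G.map_add]
    rfl
  zero_smul x := by
    change G.map ((0 : R) • 𝟙 L) x = 0
    rw [zero_smul, G.map_zero]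
    rfl

/-- An additive functor on modules takes values in modules. -/
noncomputable def moduleFunctor : ModuleCat.{u} R ⥤ ModuleCat.{u} R where
  obj L := @ModuleCat.of R _ (G.obj L) _ (valueModule G L)
  map {L L'} φ := by
    let _ := valueModule G L
    let _ := valueModule G L'
    exact ModuleCat.ofHom
      { toFun := fun x => G.map φ x
        map_add' := fun x y => map_add (G.map φ).hom x y
        map_smul' := fun r x => by
          change G.map φ (G.map (r • 𝟙 L) x) = G.map (r • 𝟙 L') (G.map φ x)
          have h : (r • 𝟙 L) ≫ φ = φ ≫ (r • 𝟙 L') := by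
            rw [Linear.comp_smul, Category.comp_id, Linear.smul_comp, Category.id_comp]
          have h2 := congrArg G.map h
          rw [G.map_comp, G.map_comp] at h2
          exact ConcreteCategory.congr_hom h2 x }
  map_id L := by
    let _ := valueModule G L
    refine ModuleCat.hom_ext (LinearMap.ext fun x => ?_)
    change G.map (𝟙 L) x = x
    rw [G.map_id]
    rfl
  map_comp {L L' L''} φ ψ := by
    let _ := valueModule G L
    let _ := valueModule G L''
    refine ModuleCat.hom_ext (LinearMap.ext fun x => ?_)
    change G.map (φ ≫ ψ) x = G.map ψ (G.map φ x)
    rw [G.map_comp]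
    rfl

instance : (moduleFunctor G).Additive where
  map_add {L L' φ ψ} := by
    ext x
    change G.map (φ + ψ) x = G.map φ x + G.map ψ x
    rw [G.map_add]
    rfl

theorem moduleFunctor_map_smul {L L' : ModuleCat.{u} R} (r : R) (φ : L ⟶ L')
    (x : (moduleFunctor G).obj L) :
    (moduleFunctor G).map (r • φ) x = r • (moduleFunctor G).map φ x := by
  change G.map (r • φ) x = G.map (r • 𝟙 L') (G.map φ x)
  have h : r • φ = φ ≫ (r • 𝟙 L') := by rw [Linear.comp_smul, Category.comp_id]
  rw [h, G.map_comp]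
  rfl

end SectionModule

/-! ### Local exactness by division by powers of f_a -/

section Division

variable {R : Type u} [CommRing R] {n : ℕ} (f : Fin n → R)
  (H : ModuleCat.{u} R ⥤ ModuleCat.{u} R) [H.Additive]

/-- `g` acts injectively, and its multiples contain those of all `f_j`. -/
structure IsPrincipalOn (g : R) (M : Type*) [AddCommGroup M] [Module R M] : Prop where
  smul_injective : ∀ x : M, g • x = 0 → x = 0
  smul_mem : ∀ (j : Fin n) (x : M), ∃ y : M, f j • x = g • y

variable {f} in
theorem IsPrincipalOn.pow_smul_injective {g : R} {M : Type*} [AddCommGroup M] [Module R M]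
    (h : IsPrincipalOn f g M) (m : ℕ) (x : M) (hx : g ^ m • x = 0) : x = 0 := by
  induction m with
  | zero => rwa [pow_zero, one_smul] at hx
  | succ m ih =>
    rw [pow_succ', mul_smul] at hx
    exact ih (h.smul_injective _ hx)

variable {f} in
theorem IsPrincipalOn.exists_pow_smul {g : R} {M : Type*} [AddCommGroup M] [Module R M]
    (h : IsPrincipalOn f g M) (m : ℕ) (x : M)
    (hx : x ∈ Ideal.span (Set.range f) ^ m • (⊤ : Submodule R M)) : ∃ y, x = g ^ m • y := by
  have h1 : Ideal.span (Set.range f) • (⊤ : Submodule R M) ≤ Ideal.span {g} • ⊤ := by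
    rw [Submodule.smul_le]
    intro r hr y _
    induction hr using Submodule.span_induction with
    | mem r hr =>
      obtain ⟨j, rfl⟩ := hr
      obtain ⟨z, hz⟩ := h.smul_mem j y
      rw [hz]
      exact Submodule.smul_mem_smul (Ideal.mem_span_singleton_self g) trivial
    | zero => rw [zero_smul]; exact Submodule.zero_mem _
    | add r r' _ _ hr hr' => rw [add_smul]; exact Submodule.add_mem _ hr hr'
    | smul c r _ hr => rw [smul_eq_mul, mul_smul]; exact Submodule.smul_mem _ c hr
  have h2 (m : ℕ) : Ideal.span (Set.range f) ^ m • (⊤ : Submodule R M) ≤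
      Ideal.span {g} ^ m • ⊤ := by
    induction m with
    | zero => rw [pow_zero, pow_zero]
    | succ m ih =>
      rw [pow_succ, Submodule.mul_smul, pow_succ', Submodule.mul_smul]
      calc Ideal.span (Set.range f) ^ m • Ideal.span (Set.range f) • (⊤ : Submodule R M)
          ≤ Ideal.span (Set.range f) ^ m • Ideal.span {g} • ⊤ := Submodule.smul_mono le_rfl h1
        _ = Ideal.span {g} • Ideal.span (Set.range f) ^ m • ⊤ := by
          rw [← Submodule.mul_smul, mul_comm, Submodule.mul_smul]
        _ ≤ _ := Submodule.smul_mono le_rfl ih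
  have h3 := h2 m hx
  rw [Ideal.span_singleton_pow, Submodule.ideal_span_singleton_smul] at h3
  obtain ⟨y, -, rfl⟩ := h3
  exact ⟨y, rfl⟩

/-- L is a summand of some R^m, hence H(L) is a summand of H(R)^m. Injectivity and divisibility are
checked on coordinates. -/
theorem isPrincipalOn_of_projective {g : R} (h : IsPrincipalOn f g (H.obj (ModuleCat.of R R)))
    (L : ModuleCat.{u} R) [Module.Finite R L] [Module.Projective R L] :
    IsPrincipalOn f g (H.obj L) := by
  obtain ⟨m, p, i, -, -, hpi⟩ := Module.Finite.exists_comp_eq_id_of_projective R L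
  let A (j : Fin m) : L ⟶ ModuleCat.of R R := ModuleCat.ofHom (LinearMap.proj j ∘ₗ i)
  let B (j : Fin m) : ModuleCat.of R R ⟶ L :=
    ModuleCat.ofHom (p ∘ₗ LinearMap.single R (fun _ : Fin m => R) j)
  have h1 : ∑ j, A j ≫ B j = 𝟙 L := by
    ext x
    have h2 : (∑ j, A j ≫ B j).hom x = ∑ j, p (Pi.single j (i x j)) := by
      rw [ModuleCat.hom_sum, LinearMap.sum_apply]
      rfl
    rw [h2, ← map_sum, Finset.univ_sum_single]
    exact LinearMap.congr_fun hpi x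
  have h3 (x : H.obj L) : x = ∑ j, H.map (B j) (H.map (A j) x) := by
    have h4 := congrArg H.map h1
    rw [H.map_sum, H.map_id] at h4
    have h5 := congrArg (fun φ => φ.hom x) h4
    simp only [ModuleCat.hom_sum, LinearMap.sum_apply] at h5
    exact h5.symm.trans (Finset.sum_congr rfl fun j _ => by rw [H.map_comp]; rfl)
  refine ⟨fun x hx => ?_, fun j x => ?_⟩
  · rw [h3 x]
    refine Finset.sum_eq_zero fun j _ => ?_
    have h6 : g • H.map (A j) x = 0 := by
      rw [← map_smul (H.map (A j)).hom, hx, map_zero]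
    rw [h.smul_injective _ h6, map_zero]
  · choose y hy using fun l => h.smul_mem j (H.map (A l) x)
    refine ⟨∑ l, H.map (B l) (y l), ?_⟩
    conv_lhs => rw [h3 x]
    rw [Finset.smul_sum, Finset.smul_sum]
    refine Finset.sum_congr rfl fun l _ => ?_
    rw [← map_smul (H.map (B l)).hom, ← map_smul (H.map (B l)).hom, hy]

variable (hH : ∀ {L L' : ModuleCat.{u} R} (r : R) (φ : L ⟶ L') (x : H.obj L),
  H.map (r • φ) x = r • H.map φ x)
include hH

theorem map_apply_mem_smul_top {I : Ideal R} {L L' : ModuleCat.{u} R} (s : L →ₗ[R] L')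
    (hs : s ∈ I • (⊤ : Submodule R (L →ₗ[R] L'))) (x : H.obj L) :
    H.map (ModuleCat.ofHom s) x ∈ I • (⊤ : Submodule R (H.obj L')) := by
  refine Submodule.smul_induction_on hs (fun r hr s _ => ?_) fun s s' hs hs' => ?_
  · have : ModuleCat.ofHom (r • s) = r • ModuleCat.ofHom s := rfl
    rw [this, hH]
    exact Submodule.smul_mem_smul hr trivial
  · have : ModuleCat.ofHom (s + s') = ModuleCat.ofHom s + ModuleCat.ofHom s' := rfl
    rw [this, H.map_add]
    exact Submodule.add_mem _ hs hs'

variable {f} in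
/-- The local exactness of the subcomplex given by the weights. -/
theorem IsWeightedContractible.exists_eq_d {K : CochainComplex (ModuleCat.{u} R) ℤ} {w : ℤ → ℕ}
    (hK : IsWeightedContractible f K w) {a : Fin n}
    (h : IsPrincipalOn f (f a) (H.obj (ModuleCat.of R R))) {p q r : ℤ} (hp : p + 1 = q)
    (hr : q + 1 = r) (z : H.obj (K.X q)) (hz : H.map (K.d q r) (f a ^ w q • z) = 0) :
    ∃ y : H.obj (K.X p), f a ^ w q • z = H.map (K.d p q) (f a ^ w p • y) := by
  have hX (q : ℤ) : IsPrincipalOn f (f a) (H.obj (K.X q)) :=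
    haveI := hK.finite q
    haveI := hK.projective q
    isPrincipalOn_of_projective f H h _
  have hz' : H.map (K.d q r) z = 0 := by
    refine (hX r).pow_smul_injective (w q) _ ?_
    rw [← map_smul (H.map (K.d q r)).hom]
    exact hz
  obtain ⟨c, e, s, t, hs, hle, hst⟩ := hK.homotopy a p q r hp hr
  have h1 : f a ^ c • 𝟙 (K.X q) = ModuleCat.ofHom s ≫ K.d p q + K.d q r ≫ ModuleCat.ofHom t := by
    ext x
    exact hst x
  have h2 : f a ^ c • z = H.map (K.d p q) (H.map (ModuleCat.ofHom s) z) := by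
    have h3 := hH (f a ^ c) (𝟙 (K.X q)) z
    rw [H.map_id] at h3
    refine h3.symm.trans ?_
    rw [h1, H.map_add, H.map_comp, H.map_comp]
    change H.map (K.d p q) (H.map (ModuleCat.ofHom s) z) +
      H.map (ModuleCat.ofHom t) (H.map (K.d q r) z) = _
    rw [hz', map_zero, add_zero]
  obtain ⟨y, hy⟩ := (hX p).exists_pow_smul e _ (map_apply_mem_smul_top H hH s hs z)
  -- With sz = f_a^e y, f_a^c · f_a^{w q} z is the boundary of f_a^{e + w q} y, and e + w q = c + w
  -- p + m. Cancelling f_a^c leaves f_a^{w p} · (f_a^m y) as a primitive.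
  obtain ⟨m, hm⟩ := Nat.exists_eq_add_of_le hle
  refine ⟨f a ^ m • y, ?_⟩
  rw [← sub_eq_zero]
  refine (hX q).pow_smul_injective c _ ?_
  rw [smul_sub, sub_eq_zero, smul_comm, h2, hy, ← map_smul (H.map (K.d p q)).hom,
    ← map_smul (H.map (K.d p q)).hom]
  change H.map (K.d p q) _ = H.map (K.d p q) _
  congr 1
  rw [smul_smul, smul_smul, smul_smul, ← pow_add, ← pow_add, ← pow_add, add_comm (w q) e, hm,
    add_assoc]

end Division


/-! ### The subcomplex cut out by the weights -/

section WeightSubcomplex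

variable {R : Type u} [CommRing R] {n : ℕ} {f : Fin n → R}
  {K : CochainComplex (ModuleCat.{u} R) ℤ} {w : ℤ → ℕ} (hK : IsWeightedContractible f K w)

theorem IsWeightedContractible.d_mem_of_mem
    (hK : IsWeightedContractible f K w) {p q : ℤ} (hpq : p + 1 = q) (x : K.X p)
    (hx : x ∈ Ideal.span (Set.range f) ^ w p • (⊤ : Submodule R (K.X p))) :
    (K.d p q).hom x ∈ Ideal.span (Set.range f) ^ w q • (⊤ : Submodule R (K.X q)) := by
  refine Submodule.smul_induction_on hx (fun r hr x _ => ?_) fun x y hx hy => ?_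
  · rw [map_smul]
    have h1 := Submodule.smul_mem_smul hr (hK.d_mem p q hpq x)
    rw [← Submodule.mul_smul, ← pow_add] at h1
    exact Submodule.smul_mono (Ideal.pow_le_pow_right (by omega)) le_rfl h1
  · rw [map_add]
    exact Submodule.add_mem _ hx hy

/-- The subcomplex of `K` given by the powers of `J` prescribed by the weights. -/
noncomputable def IsWeightedContractible.sub : CochainComplex (ModuleCat.{u} R) ℤ where
  X q := ModuleCat.of R (Ideal.span (Set.range f) ^ w q • (⊤ : Submodule R (K.X q)) :
    Submodule R (K.X q))
  d p q := if hpq : p + 1 = q then ModuleCat.ofHom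
    ((K.d p q).hom.restrict fun x hx => hK.d_mem_of_mem hpq x hx) else 0
  shape p q hpq := dif_neg hpq
  d_comp_d' p q r hpq hqr := by
    have hpq' : p + 1 = q := hpq
    have hqr' : q + 1 = r := hqr
    rw [dif_pos hpq', dif_pos hqr']
    refine ModuleCat.hom_ext (LinearMap.ext fun x => Subtype.ext ?_)
    exact ConcreteCategory.congr_hom (K.d_comp_d p q r) x.1

/-- The inclusion of the subcomplex given by the weights. -/
noncomputable def IsWeightedContractible.subι : hK.sub ⟶ K where
  f q := ModuleCat.ofHom (Submodule.subtype _)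
  comm' p q hpq := by
    change _ ≫ K.d p q = (if hpq : p + 1 = q then ModuleCat.ofHom
      ((K.d p q).hom.restrict fun x hx => hK.d_mem_of_mem hpq x hx) else 0) ≫ _
    have hpq' : p + 1 = q := hpq
    rw [dif_pos hpq']
    rfl

end WeightSubcomplex

/-! ### Acyclicity of the image of the weighted subcomplex, in an abelian category -/

section ChartFamily

variable {C : Type*} [Category C] [Abelian C] {R : Type u} [CommRing R] {n : ℕ} (f : Fin n → R)
  (T : ModuleCat.{u} R ⥤ C) [T.Additive] {τ : Type*} (Γ : τ → C ⥤ AddCommGrpCat.{u})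

/-- A jointly faithful family of functors of sections, on each of which one of the `f_a` is a
nonzerodivisor which divides the other ones. -/
structure IsChartFamily [∀ t, (Γ t).Additive] (chart : τ → Fin n) : Prop where
  eq_zero {X Z : C} (h : X ⟶ Z) : (∀ t (x : (Γ t).obj X), (Γ t).map h x = 0) → h = 0
  isPrincipalOn t : IsPrincipalOn f (f (chart t))
    ((moduleFunctor (T ⋙ Γ t)).obj (ModuleCat.of R R))

variable {f T Γ} [∀ t, (Γ t).Additive] [∀ t, PreservesFiniteLimits (Γ t)]
  {chart : τ → Fin n} (hΓ : IsChartFamily f T Γ chart)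
  {K : CochainComplex (ModuleCat.{u} R) ℤ} {w : ℤ → ℕ} (hK : IsWeightedContractible f K w)

variable (T) in
/-- The image of the weighted subcomplex. -/
noncomputable abbrev IsWeightedContractible.imageComplex : CochainComplex C ℤ :=
  Abelian.image ((T.mapHomologicalComplex (ComplexShape.up ℤ)).map hK.subι)

variable (T) in
/-- The projection onto the image of the weighted subcomplex. -/
noncomputable abbrev IsWeightedContractible.toImage :
    (T.mapHomologicalComplex (ComplexShape.up ℤ)).obj hK.sub ⟶ hK.imageComplex T :=
  Abelian.factorThruImage ((T.mapHomologicalComplex (ComplexShape.up ℤ)).map hK.subι)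

variable (T) in
/-- The inclusion of the image of the weighted subcomplex. -/
noncomputable abbrev IsWeightedContractible.imageι :
    hK.imageComplex T ⟶ (T.mapHomologicalComplex (ComplexShape.up ℤ)).obj K :=
  Abelian.image.ι ((T.mapHomologicalComplex (ComplexShape.up ℤ)).map hK.subι)

theorem IsWeightedContractible.toImage_imageι (q : ℤ) :
    (hK.toImage T).f q ≫ (hK.imageι T).f q = T.map (hK.subι.f q) := by
  rw [← HomologicalComplex.comp_f, Abelian.image.fac]
  rfl

/-- Multiplication by an element of `J ^ w q`, with values in the weighted subcomplex. -/
noncomputable def IsWeightedContractible.smulSub {q : ℤ} {r : R}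
    (hr : r ∈ Ideal.span (Set.range f) ^ w q) : K.X q ⟶ hK.sub.X q :=
  ModuleCat.ofHom (LinearMap.codRestrict
    (Ideal.span (Set.range f) ^ w q • (⊤ : Submodule R (K.X q))) (r • LinearMap.id)
    fun _ => Submodule.smul_mem_smul hr Submodule.mem_top)

theorem IsWeightedContractible.smulSub_subι {q : ℤ} {r : R}
    (hr : r ∈ Ideal.span (Set.range f) ^ w q) :
    hK.smulSub hr ≫ hK.subι.f q = r • 𝟙 (K.X q) := rfl

theorem pow_mem_span_pow (a : Fin n) (m : ℕ) : f a ^ m ∈ Ideal.span (Set.range f) ^ m :=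
  Ideal.pow_mem_pow (Ideal.subset_span (Set.mem_range_self a)) m

/-- A presentation of `J ^ w q K_q`. -/
theorem IsWeightedContractible.exists_cover (q : ℤ) :
    ∃ (P : ModuleCat.{u} R) (φ : P ⟶ hK.sub.X q), Epi φ ∧
      (φ ≫ hK.subι.f q).hom ∈
        Ideal.span (Set.range f) ^ w q • (⊤ : Submodule R (P →ₗ[R] K.X q)) := by
  have hfg : (Ideal.span (Set.range f) ^ w q).FG :=
    Ideal.FG.pow ((Submodule.fg_def).mpr ⟨_, Set.finite_range f, rfl⟩)
  obtain ⟨m, g, hg⟩ := Submodule.fg_iff_exists_fin_generating_family.mp hfg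
  have hgm (i : Fin m) : g i ∈ Ideal.span (Set.range f) ^ w q :=
    hg ▸ Submodule.subset_span (Set.mem_range_self i)
  -- The map ψ, and not merely each of its values, lies in J^{w q} Hom. This form survives any
  -- R-linear functor.
  let ψ : (Fin m → K.X q) →ₗ[R] K.X q := ∑ i, g i • LinearMap.proj i
  have hψ : ψ ∈ Ideal.span (Set.range f) ^ w q • (⊤ : Submodule R ((Fin m → K.X q) →ₗ[R] K.X q)) :=
    Submodule.sum_mem _ fun i _ => Submodule.smul_mem_smul (hgm i) trivial
  have hψ' (x) : ψ x = ∑ i, g i • x i := by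
    rw [LinearMap.sum_apply]
    rfl
  have hr : ∀ x, ψ x ∈ Ideal.span (Set.range f) ^ w q • (⊤ : Submodule R (K.X q)) := fun x => by
    rw [hψ']
    exact Submodule.sum_mem _ fun i _ => Submodule.smul_mem_smul (hgm i) trivial
  refine ⟨ModuleCat.of R (Fin m → K.X q), ModuleCat.ofHom (ψ.codRestrict _ hr),
    (ModuleCat.epi_iff_surjective (ModuleCat.ofHom (ψ.codRestrict _ hr))).mpr ?_, hψ⟩
  have hle : Ideal.span (Set.range f) ^ w q • (⊤ : Submodule R (K.X q)) ≤ LinearMap.range ψ := by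
    rw [Submodule.smul_le]
    intro r hr x _
    rw [← hg] at hr
    obtain ⟨c, rfl⟩ := (Submodule.mem_span_range_iff_exists_fun R).mp hr
    refine ⟨fun i => c i • x, ?_⟩
    rw [hψ', Finset.sum_smul]
    refine Finset.sum_congr rfl fun i _ => ?_
    rw [smul_smul, smul_eq_mul, mul_comm]
  intro x
  obtain ⟨y, hy⟩ := hle x.2
  exact ⟨y, Subtype.ext hy⟩

-- Sections are only left exact, so a section of the cycles of M^q need not lift to the presentation
-- T(P) → M^q. Therefore the presentation is pulled back to the cycles. The pullback still maps
-- epimorphically onto them, and its sections do come with a lift, hence with divisibility by f_a^{w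
-- q}. Exactness then amounts to the vanishing of every map out of the cycles that kills the
-- boundaries, which is tested on sections of the pullback.
include hΓ in
theorem IsWeightedContractible.exactAt_of_factorization [T.PreservesEpimorphisms]
    {M : CochainComplex C ℤ} (π : ∀ q, T.obj (hK.sub.X q) ⟶ M.X q)
    (μ : ∀ q, M.X q ⟶ T.obj (K.X q)) (hπ : ∀ q, Epi (π q)) (hμ' : ∀ q, Mono (μ q))
    (hπμ : ∀ q, π q ≫ μ q = T.map (hK.subι.f q))
    (hμ : ∀ p q, μ p ≫ T.map (K.d p q) = M.d p q ≫ μ q) (q : ℤ) : M.ExactAt q := by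
  obtain ⟨p, hp⟩ : ∃ p, p + 1 = q := ⟨q - 1, by omega⟩
  rw [HomologicalComplex.exactAt_iff' _ p q (q + 1) (by simp [← hp]) (by simp)]
  refine (ShortComplex.exact_iff_epi_kernel_lift _).mpr ?_
  change Epi (kernel.lift (M.d q (q + 1)) (M.d p q) (M.d_comp_d p q (q + 1)))
  refine Preadditive.epi_of_cancel_zero _ fun {W} h hh => ?_
  obtain ⟨P, φ, hφ, hmem⟩ := hK.exists_cover q
  let ρ : T.obj P ⟶ M.X q := T.map φ ≫ π q
  have hρ : Epi ρ := epi_comp _ _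
  let Z := kernel (M.d q (q + 1))
  let ι : Z ⟶ M.X q := kernel.ι _
  have hsnd : Epi (pullback.snd ρ ι) := inferInstance
  rw [← cancel_epi (pullback.snd ρ ι), comp_zero]
  refine hΓ.eq_zero _ fun t b => ?_
  let a := chart t
  let H := moduleFunctor (T ⋙ Γ t)
  let z : (Γ t).obj Z := (Γ t).map (pullback.snd ρ ι) b
  have hcomp {A B D : C} (g : A ⟶ B) (g' : B ⟶ D) (x : (Γ t).obj A) :
      (Γ t).map (g ≫ g') x = (Γ t).map g' ((Γ t).map g x) := by
    rw [(Γ t).map_comp]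
    rfl
  have hX (q : ℤ) : IsPrincipalOn f (f a) (H.obj (K.X q)) :=
    haveI := hK.finite q
    haveI := hK.projective q
    isPrincipalOn_of_projective f H (hΓ.isPrincipalOn t) _
  have hH {L L' : ModuleCat.{u} R} (r : R) (φ : L ⟶ L') (x : H.obj L) :
    H.map (r • φ) x = r • H.map φ x := moduleFunctor_map_smul _ r φ x
  have h1 : (Γ t).map (μ q) ((Γ t).map ι z) =
      (Γ t).map (T.map (φ ≫ hK.subι.f q)) ((Γ t).map (pullback.fst ρ ι) b) := by
    rw [← hcomp, ← hcomp, ← hcomp, T.map_comp, ← hπμ q, ← Category.assoc, ← pullback.condition]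
    simp only [ρ, Category.assoc]
  -- The section comes from T(P), whose map to T(K^q) lies in J^{w q} Hom; on the chart, J^{w q} is
  -- divisible by f_a^{w q}.
  obtain ⟨z', hz'⟩ := (hX q).exists_pow_smul (w q) _
    (map_apply_mem_smul_top H hH _ hmem ((Γ t).map (pullback.fst ρ ι) b))
  have hz2 : (Γ t).map (μ q) ((Γ t).map ι z) = f a ^ w q • z' := h1.trans hz'
  have h2 : H.map (K.d q (q + 1)) (f a ^ w q • z') = 0 := by
    rw [← hz2]
    change (Γ t).map (T.map (K.d q (q + 1))) ((Γ t).map (μ q) ((Γ t).map ι z)) = 0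
    rw [← hcomp, ← hcomp]
    have : ι ≫ μ q ≫ T.map (K.d q (q + 1)) = 0 := by
      rw [hμ, ← Category.assoc, kernel.condition, zero_comp]
    rw [this, (Γ t).map_zero]
    rfl
  obtain ⟨y, hy⟩ := hK.exists_eq_d H hH (hΓ.isPrincipalOn t) hp rfl z' h2
  -- Multiplication by f_a^{w p} maps K^p into the weighted subcomplex, so f_a^{w p} y comes from a
  -- section of M^p.
  obtain ⟨m, hm⟩ : ∃ m, (Γ t).map (μ p) m = f a ^ w p • y := by
    let y' : (Γ t).obj (T.obj (K.X p)) := y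
    let σ := T.map (hK.smulSub (pow_mem_span_pow a (w p)))
    have h3 : σ ≫ π p ≫ μ p = T.map ((f a ^ w p) • 𝟙 (K.X p)) := by
      rw [hπμ p, ← T.map_comp, hK.smulSub_subι]
    refine ⟨(Γ t).map (π p) ((Γ t).map σ y'), ?_⟩
    rw [← hcomp, ← hcomp, h3]
    rfl
  have hinj : Function.Injective ((Γ t).map (ι ≫ μ q)) := by
    have : Mono (ι ≫ μ q) := mono_comp _ _
    exact (AddCommGrpCat.mono_iff_injective _).mp inferInstance
  have hz : z = (Γ t).map (kernel.lift (M.d q (q + 1)) (M.d p q) (M.d_comp_d p q (q + 1))) m := by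
    refine hinj ?_
    have h3 : (Γ t).map (ι ≫ μ q) ((Γ t).map (kernel.lift (M.d q (q + 1)) (M.d p q)
        (M.d_comp_d p q (q + 1))) m) = (Γ t).map (T.map (K.d p q)) ((Γ t).map (μ p) m) := by
      rw [← hcomp, ← hcomp, kernel.lift_ι_assoc, hμ]
    rw [h3, hm, hcomp, hz2]
    exact hy
  rw [hcomp]
  change (Γ t).map h z = 0
  rw [hz, ← hcomp]
  rw [hh, (Γ t).map_zero]
  rfl

include hΓ in
theorem IsWeightedContractible.exactAt_imageComplex [T.PreservesEpimorphisms] (q : ℤ) :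
    (hK.imageComplex T).ExactAt q :=
  have h1 (q : ℤ) : Epi ((hK.toImage T).f q) :=
    inferInstanceAs (Epi ((HomologicalComplex.eval C (ComplexShape.up ℤ) q).map (hK.toImage T)))
  have h2 (q : ℤ) : Mono ((hK.imageι T).f q) :=
    inferInstanceAs (Mono ((HomologicalComplex.eval C (ComplexShape.up ℤ) q).map (hK.imageι T)))
  hK.exactAt_of_factorization hΓ (fun q => (hK.toImage T).f q) (fun q => (hK.imageι T).f q) h1 h2
    hK.toImage_imageι (fun p q => (hK.imageι T).comm p q) q

include hΓ hK in
/-- A map from a single object to `T K`, which is locally divisible by `f_a ^ w 0`, factors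
through an acyclic subcomplex. -/
theorem IsWeightedContractible.exists_factorization [T.PreservesEpimorphisms] {F : C}
    (ψ : (HomologicalComplex.single C (ComplexShape.up ℤ) 0).obj F ⟶
      (T.mapHomologicalComplex (ComplexShape.up ℤ)).obj K)
    (hψ : ∀ {W : C} (h : T.obj (K.X 0) ⟶ W),
      (∀ a, T.map (f a ^ w 0 • 𝟙 (K.X 0)) ≫ h = 0) →
      (HomologicalComplex.singleObjXSelf (ComplexShape.up ℤ) 0 F).inv ≫ ψ.f 0 ≫ h = 0) :
    ∃ (M : CochainComplex C ℤ) (μ : M ⟶ (T.mapHomologicalComplex (ComplexShape.up ℤ)).obj K)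
      (ψ' : (HomologicalComplex.single C (ComplexShape.up ℤ) 0).obj F ⟶ M),
      Mono μ ∧ M.Acyclic ∧ ψ' ≫ μ = ψ := by
  let M := hK.imageComplex T
  let μ := hK.imageι T
  -- Each f_a^{w 0} maps into the image, so the cokernel kills it. By hypothesis the cokernel then
  -- kills ψ in degree 0, which yields the factorization.
  let h := cokernel.π (μ.f 0)
  let ψ0 := (HomologicalComplex.singleObjXSelf (ComplexShape.up ℤ) 0 F).inv ≫ ψ.f 0
  have h1 : ψ0 ≫ h = 0 := by
    rw [Category.assoc]
    refine hψ h fun a => ?_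
    have e : T.map (f a ^ w 0 • 𝟙 (K.X 0)) =
        (T.map (hK.smulSub (pow_mem_span_pow a (w 0))) ≫ (hK.toImage T).f 0) ≫ μ.f 0 := by
      rw [← hK.smulSub_subι (pow_mem_span_pow a (w 0)), T.map_comp, ← hK.toImage_imageι 0]
      exact (Category.assoc _ _ _).symm
    exact (congrArg (· ≫ h) e).trans ((Category.assoc _ _ _).trans
      ((whisker_eq _ (cokernel.condition _)).trans comp_zero))
  let ψ1 : F ⟶ M.X 0 := Abelian.monoLift (μ.f 0) ψ0 h1
  have h2 : ψ1 ≫ μ.f 0 = ψ0 := Abelian.monoLift_comp _ _ _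
  have h3 (j : ℤ) (hj : (ComplexShape.up ℤ).Rel 0 j) : ψ1 ≫ M.d 0 j = 0 := by
    rw [← cancel_mono (μ.f j), zero_comp, Category.assoc, ← μ.comm, ← Category.assoc, h2,
      Category.assoc, ψ.comm, HomologicalComplex.single_obj_d, zero_comp, comp_zero]
  refine ⟨M, μ, HomologicalComplex.mkHomFromSingle ψ1 h3, inferInstance,
    fun q => hK.exactAt_imageComplex hΓ q, ?_⟩
  refine HomologicalComplex.from_single_hom_ext ?_
  rw [HomologicalComplex.comp_f, HomologicalComplex.mkHomFromSingle_f, Category.assoc, h2,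
    Iso.hom_inv_id_assoc]

/-- The zero endomorphism of an acyclic complex is a quasi-isomorphism, so the complex becomes a
zero object. -/
theorem Q_map_eq_zero [HasDerivedCategory.{w'} C] {A M B : CochainComplex C ℤ} (hM : M.Acyclic)
    (ψ : A ⟶ M) (μ : M ⟶ B) : DerivedCategory.Q.map (ψ ≫ μ) = 0 := by
  have h1 : QuasiIso (0 : M ⟶ M) := by
    refine ⟨fun i => ?_⟩
    rw [quasiIsoAt_iff_exactAt _ _ (hM i)]
    exact hM i
  have h2 : IsIso (DerivedCategory.Q.map (0 : M ⟶ M)) := inferInstance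
  have h3 : IsZero (DerivedCategory.Q.obj M) := by
    rw [Functor.map_zero] at h2
    exact (IsZero.iff_id_eq_zero _).mpr (by
      rw [← IsIso.hom_inv_id (0 : DerivedCategory.Q.obj M ⟶ DerivedCategory.Q.obj M), zero_comp])
  rw [Functor.map_comp, h3.eq_of_tgt (DerivedCategory.Q.map ψ) 0, zero_comp]

end ChartFamily


/-! ### Primes of the Rees algebra and the irrelevant ideal -/

section Rees

variable {A : Type u} [CommRing A]

/-- The element `h t ^ i` of the Rees algebra. -/
noncomputable def reesMonomial {I : Ideal A} (i : ℕ) (h : A) (hh : h ∈ I ^ i) : reesAlgebra I :=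
  ⟨Polynomial.monomial i h, reesAlgebra.monomial_mem.mpr hh⟩

theorem reesMonomial_mem {I : Ideal A} (i : ℕ) (h : A) (hh : h ∈ I ^ i) :
    reesMonomial i h hh ∈ reesGrading I i := ⟨h, rfl⟩

theorem reesMonomial_mul {I : Ideal A} {i j l : ℕ} {a b c : A} (ha : a ∈ I ^ i) (hb : b ∈ I ^ j)
    (hc : c ∈ I ^ l) (hl : i + j = l) (h : a * b = c) :
    reesMonomial i a ha * reesMonomial j b hb = reesMonomial l c hc := by
  subst hl h
  exact Subtype.ext (Polynomial.monomial_mul_monomial _ _ _ _)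

/-- Used for J = I, and for an ideal J with integral closure I, where the coefficients of an
integral equation are powers of J. -/
theorem reesMonomial_mem_of_forall {I J : Ideal A} (hJ : J ≤ I) (P : Ideal (reesAlgebra I))
    (h1 : ∀ h (hh : h ∈ J), reesMonomial 1 h (by rw [pow_one]; exact hJ hh) ∈ P)
    (m : ℕ) (h : A) (hh : h ∈ J ^ (m + 1)) :
    reesMonomial (m + 1) h (Ideal.pow_right_mono hJ _ hh) ∈ P := by
  have key : ∃ h' : h ∈ I ^ (m + 1), reesMonomial (m + 1) h h' ∈ P := by
    rw [pow_succ] at hh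
    refine Submodule.mul_induction_on hh (fun a ha b hb => ?_) fun x y hx hy => ?_
    · have ha' : a ∈ I ^ m := Ideal.pow_right_mono hJ _ ha
      have hb' : b ∈ I ^ 1 := by rw [pow_one]; exact hJ hb
      have hab : a * b ∈ I ^ (m + 1) := by
        rw [pow_add]
        exact Ideal.mul_mem_mul ha' hb'
      refine ⟨hab, ?_⟩
      rw [← reesMonomial_mul ha' hb' hab rfl rfl]
      exact P.mul_mem_left _ (h1 b hb)
    · obtain ⟨hx, hx'⟩ := hx
      obtain ⟨hy, hy'⟩ := hy
      refine ⟨Ideal.add_mem _ hx hy, ?_⟩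
      have : reesMonomial (m + 1) (x + y) (Ideal.add_mem _ hx hy) =
          reesMonomial (m + 1) x hx + reesMonomial (m + 1) y hy :=
        Subtype.ext (map_add (Polynomial.monomial (m + 1)) x y)
      rw [this]
      exact P.add_mem hx' hy'
  exact key.2

theorem le_integralClosureIdeal (I : Ideal A) : I ≤ integralClosureIdeal I := by
  intro h hh
  refine ⟨1, fun i => if i = 0 then 1 else if i = 1 then -h else 0, le_rfl, fun i => ?_, ?_⟩
  · dsimp only
    split_ifs with h0 h1
    · rw [h0, pow_zero, Ideal.one_eq_top]
      trivial
    · rw [h1, pow_one]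
      exact I.neg_mem hh
    · exact Ideal.zero_mem _
  · simp

variable {n N : ℕ} (f : Fin n → A)

theorem pow_mem_integralClosureIdeal (a : Fin n) :
    f a ^ N ∈ integralClosureIdeal (Ideal.span (Set.range f) ^ N) ^ 1 := by
  rw [pow_one]
  exact le_integralClosureIdeal _ (pow_mem_span_pow a N)

variable (N) in
/-- The element `f_a ^ N t` of the Rees algebra. -/
noncomputable def chartElement (a : Fin n) :
    reesAlgebra (integralClosureIdeal (Ideal.span (Set.range f) ^ N)) :=
  reesMonomial 1 (f a ^ N) (pow_mem_integralClosureIdeal f a)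

/-- A product f_{σ1}⋯f_{σN} t has N-th power ∏ (f_{σi}^N t), which lies in P; a prime ideal then
contains the product itself. These products generate J^N t. -/
theorem reesMonomial_mem_of_chartElement (hN : 1 ≤ N)
    (P : Ideal (reesAlgebra (integralClosureIdeal (Ideal.span (Set.range f) ^ N)))) [P.IsPrime]
    (hP : ∀ a, chartElement N f a ∈ P) (h : A) (hh : h ∈ Ideal.span (Set.range f) ^ N) :
    reesMonomial 1 h (by rw [pow_one]; exact le_integralClosureIdeal _ hh) ∈ P := by
  have key : ∃ h' : h ∈ integralClosureIdeal (Ideal.span (Set.range f) ^ N) ^ 1,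
      reesMonomial 1 h h' ∈ P := by
    have hle : Ideal.span (Set.range f) ^ N ≤
        integralClosureIdeal (Ideal.span (Set.range f) ^ N) ^ 1 := by
      rw [pow_one]
      exact le_integralClosureIdeal _
    have hh' := hh
    rw [Ideal.span, Submodule.span_pow] at hh'
    induction hh' using Submodule.span_induction with
    | mem x hx =>
      obtain ⟨g, rfl⟩ := Set.mem_pow.mp hx
      have hx : (List.ofFn fun i => (g i : A)).prod ∈ Ideal.span (Set.range f) ^ N := by
        rw [Ideal.span, Submodule.span_pow]
        exact Submodule.subset_span (Set.mem_pow.mpr ⟨g, rfl⟩)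
      refine ⟨hle hx, ?_⟩
      choose σ hσ using fun i => (g i).2
      have hprod : (List.ofFn fun i => (g i : A)).prod = ∏ i, f (σ i) := by
        rw [List.prod_ofFn]
        exact Finset.prod_congr rfl fun i _ => (hσ i).symm
      have hpow : (reesMonomial 1 _ (hle hx)) ^ N = ∏ i, chartElement N f (σ i) := by
        refine Subtype.ext ?_
        rw [SubmonoidClass.coe_finsetProd, SubmonoidClass.coe_pow]
        change (Polynomial.monomial 1 (List.ofFn fun i => (g i : A)).prod) ^ N =
          ∏ i, Polynomial.monomial 1 (f (σ i) ^ N)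
        rw [Polynomial.monomial_pow, hprod, ← Finset.prod_pow, one_mul]
        simp only [← Polynomial.C_mul_X_pow_eq_monomial, pow_one]
        rw [Finset.prod_mul_distrib, Finset.prod_const, Finset.card_univ, Fintype.card_fin,
          ← map_prod]
      refine Ideal.IsPrime.mem_of_pow_mem ‹_› N ?_
      rw [hpow]
      -- N ≥ 1 provides a factor of the product.
      exact Ideal.mem_of_dvd _ (Finset.dvd_prod_of_mem _ (Finset.mem_univ (⟨0, hN⟩ : Fin N))) (hP _)
    | zero =>
      refine ⟨Ideal.zero_mem _, ?_⟩
      convert P.zero_mem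
      exact Subtype.ext (map_zero _)
    | add x y hx hy hx' hy' =>
      obtain ⟨hx, hx'⟩ := hx' (by rwa [Ideal.span, Submodule.span_pow])
      obtain ⟨hy, hy'⟩ := hy' (by rwa [Ideal.span, Submodule.span_pow])
      refine ⟨Ideal.add_mem _ hx hy, ?_⟩
      convert P.add_mem hx' hy'
      exact Subtype.ext (map_add _ _ _)
    | smul c x hx hx' =>
      obtain ⟨hx, hx'⟩ := hx' (by rwa [Ideal.span, Submodule.span_pow])
      refine ⟨Ideal.mul_mem_left _ c hx, ?_⟩
      convert P.mul_mem_left (algebraMap A _ c) hx'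
      refine Subtype.ext ?_
      change Polynomial.monomial 1 (c * x) = Polynomial.C c * Polynomial.monomial 1 x
      rw [Polynomial.C_mul_monomial]
  exact key.2

/-- Multiply the integral equation of h by t^d: (ht)^d is a combination of the elements a_i t^i with
i ≥ 1, all in P. -/
theorem reesMonomial_mem_of_isIntegral {I : Ideal A}
    (P : Ideal (reesAlgebra (integralClosureIdeal I))) [P.IsPrime]
    (hP : ∀ h (hh : h ∈ I),
      reesMonomial 1 h (by rw [pow_one]; exact le_integralClosureIdeal _ hh) ∈ P)
    (h : A) (hh : h ∈ integralClosureIdeal I) :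
    reesMonomial 1 h (by rwa [pow_one]) ∈ P := by
  have hh' := hh
  obtain ⟨d, a, hd, ha, he⟩ := hh'
  have ha' (i : ℕ) : a i ∈ integralClosureIdeal I ^ i :=
    Ideal.pow_right_mono (le_integralClosureIdeal I) _ (ha i)
  set z : reesAlgebra (integralClosureIdeal I) := reesMonomial 1 h (by rwa [pow_one]) with hz
  have h1 : z ^ d + ∑ i ∈ Finset.Icc 1 d, reesMonomial i (a i) (ha' i) * z ^ (d - i) = 0 := by
    refine Subtype.ext ?_
    push_cast
    change (Polynomial.monomial 1 h) ^ d + ∑ i ∈ Finset.Icc 1 d,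
      Polynomial.monomial i (a i) * (Polynomial.monomial 1 h) ^ (d - i) = 0
    have h2 : ∀ i ∈ Finset.Icc 1 d,
        (Polynomial.monomial i (a i) : Polynomial A) * (Polynomial.monomial 1 h) ^ (d - i) =
          Polynomial.monomial d (a i * h ^ (d - i)) := by
      intro i hi
      rw [Finset.mem_Icc] at hi
      rw [Polynomial.monomial_pow, Polynomial.monomial_mul_monomial, one_mul,
        show i + (d - i) = d by omega]
    rw [Finset.sum_congr rfl h2, Polynomial.monomial_pow, one_mul, ← map_sum, ← map_add, he,
      map_zero]
  refine Ideal.IsPrime.mem_of_pow_mem ‹_› d ?_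
  rw [eq_neg_of_add_eq_zero_left h1]
  refine P.neg_mem (P.sum_mem fun i hi => P.mul_mem_right _ ?_)
  obtain ⟨m, rfl⟩ : ∃ m, i = m + 1 := ⟨i - 1, by rw [Finset.mem_Icc] at hi; omega⟩
  exact reesMonomial_mem_of_forall (le_integralClosureIdeal I) P hP m _ (ha _)

theorem irrelevant_le_of_chartElement (hN : 1 ≤ N)
    (P : Ideal (reesAlgebra (integralClosureIdeal (Ideal.span (Set.range f) ^ N)))) [P.IsPrime]
    (hP : ∀ a, chartElement N f a ∈ P) :
    (HomogeneousIdeal.irrelevant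
      (reesGrading (integralClosureIdeal (Ideal.span (Set.range f) ^ N)))).toIdeal ≤ P := by
  classical
  intro z hz
  have h1 := reesMonomial_mem_of_isIntegral P (reesMonomial_mem_of_chartElement f hN P hP)
  rw [← DirectSum.sum_support_decompose
    (reesGrading (integralClosureIdeal (Ideal.span (Set.range f) ^ N))) z]
  refine P.sum_mem fun i _ => ?_
  cases i with
  | zero =>
    have h0 := (HomogeneousIdeal.mem_irrelevant_iff _ _).mp hz
    rw [GradedRing.proj_apply] at h0
    rw [h0]
    exact P.zero_mem
  | succ i =>
    generalize DirectSum.decompose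
      (reesGrading (integralClosureIdeal (Ideal.span (Set.range f) ^ N))) z (i + 1) = y
    obtain ⟨⟨y, hy⟩, h, hh⟩ := y
    change Polynomial.monomial (i + 1) h = y at hh
    subst hh
    exact reesMonomial_mem_of_forall le_rfl P h1 i h (reesAlgebra.monomial_mem.mp hy)

end Rees


/-! ### The standard charts of the blowup -/

section Charts

variable {R : CommRingCat.{u}} {n N : ℕ} (f : Fin n → R)

/-- The ideal whose blowup is considered. -/
abbrev blowupIdeal (f : Fin n → R) (N : ℕ) : Ideal R :=
  integralClosureIdeal (Ideal.span (Set.range f) ^ N)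

variable (N) in
/-- The chart of the blowup on which `f_a` generates `J`. -/
noncomputable def chartOpen (a : Fin n) : (blowup (blowupIdeal f N)).Opens :=
  Proj.basicOpen (reesGrading (blowupIdeal f N)) (chartElement N f a)

theorem iSup_chartOpen (hN : 1 ≤ N) : ⨆ a, chartOpen N f a = ⊤ := by
  refine top_le_iff.mp fun x _ => TopologicalSpace.Opens.mem_iSup.mpr ?_
  by_contra! H
  have key (x : ProjectiveSpectrum (reesGrading (blowupIdeal f N))) :
      ∃ a, chartElement N f a ∉ x.asHomogeneousIdeal := by
    by_contra! H
    have := x.isPrime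
    exact x.not_irrelevant_le
      (irrelevant_le_of_chartElement f hN x.asHomogeneousIdeal.toIdeal fun a => H a)
  obtain ⟨a, ha⟩ := key x
  exact H a ha

theorem isAffineOpen_chartOpen (a : Fin n) : IsAffineOpen (chartOpen N f a) :=
  Proj.isAffineOpen_basicOpen _ _ (reesMonomial_mem _ _ _) one_pos

/-- The ring homomorphism from `R` to the degree zero part of the localization of a graded
`R`-algebra. -/
noncomputable def toAway (I : Ideal R) (g : reesAlgebra I) :
    R →+* HomogeneousLocalization.Away (reesGrading I) g :=
  (HomogeneousLocalization.fromZeroRingHom (reesGrading I) _).comp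
    (algebraMap R (reesGrading I 0))

theorem opens_ι_comp_eq {Y : Scheme.{u}} (p : Y ⟶ Spec R) (U : Y.Opens) :
    U.ι ≫ p = U.toSpecΓ ≫ Spec.map (CommRingCat.ofHom (toSections p U)) := by
  have h1 : p = Y.toSpecΓ ≫ Spec.map ((Scheme.ΓSpecIso R).inv ≫ p.appTop) := by
    rw [Spec.map_comp, ← Category.assoc, ← Scheme.toSpecΓ_naturality, Category.assoc,
      toSpecΓ_SpecMap_ΓSpecIso_inv, Category.comp_id]
  have h2 : CommRingCat.ofHom (toSections p U) =
      ((Scheme.ΓSpecIso R).inv ≫ p.appTop) ≫ Y.presheaf.map (homOfLE le_top).op := by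
    rw [Category.assoc]
    rfl
  rw [h2, Spec.map_comp, ← Category.assoc, Scheme.Opens.toSpecΓ_SpecMap_presheaf_map_top,
    Category.assoc, ← h1]

/-- Both ring homomorphisms induce the structure morphism of the affine chart over Spec R. -/
theorem toSections_chartOpen (a : Fin n) (r : R) :
    toSections (blowupMap (blowupIdeal f N)) (chartOpen N f a) r =
      (Proj.awayToSection (reesGrading (blowupIdeal f N)) (chartElement N f a)).hom
        (toAway _ _ r) := by
  let 𝒜 := reesGrading (blowupIdeal f N)
  let g := chartElement N f a
  have h1 : (chartOpen N f a).ι ≫ blowupMap (blowupIdeal f N) = (chartOpen N f a).toSpecΓ ≫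
      Spec.map (CommRingCat.ofHom (toAway (blowupIdeal f N) g) ≫ Proj.awayToSection 𝒜 g) := by
    have h2 := Proj.awayι_toSpecZero 𝒜 g (reesMonomial_mem _ _ _) one_pos
    have h3 := Proj.basicOpenIsoSpec_inv_ι 𝒜 g (reesMonomial_mem _ _ _) one_pos
    rw [Iso.inv_comp_eq] at h3
    have h4 : (chartOpen N f a).ι = Proj.basicOpenToSpec 𝒜 g ≫
      Proj.awayι 𝒜 g (reesMonomial_mem _ _ _) one_pos := h3
    rw [h4]
    change (Proj.basicOpenToSpec 𝒜 g ≫ Proj.awayι 𝒜 g (reesMonomial_mem _ _ _) one_pos) ≫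
      Proj.toSpecZero 𝒜 ≫ Spec.map _ = _
    rw [Category.assoc, reassoc_of% h2, ← Spec.map_comp, Proj.basicOpenToSpec, Category.assoc,
      ← Spec.map_comp]
    rfl
  rw [opens_ι_comp_eq] at h1
  have h5 : IsIso (chartOpen N f a).toSpecΓ :=
    inferInstanceAs (IsIso (isAffineOpen_chartOpen f a).isoSpec.hom)
  have h6 := Spec.map_injective ((cancel_epi _).mp h1)
  exact congrArg (fun φ => φ.hom r) h6

/-- The quotient f_j / f_a is (f_j f_a^{N-1} t) / (f_a^N t), whose numerator lies in J^N t. -/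
theorem toAway_dvd (hN : 1 ≤ N) (a j : Fin n) :
    ∃ u, toAway (blowupIdeal f N) (chartElement N f a) (f j) =
      u * toAway (blowupIdeal f N) (chartElement N f a) (f a) := by
  have hm : f j * f a ^ (N - 1) ∈ blowupIdeal f N ^ 1 := by
    rw [pow_one]
    refine le_integralClosureIdeal _ ?_
    obtain ⟨m, rfl⟩ : ∃ m, N = m + 1 := ⟨N - 1, by omega⟩
    rw [pow_succ', Nat.add_sub_cancel]
    exact Ideal.mul_mem_mul (Ideal.subset_span (Set.mem_range_self j)) (pow_mem_span_pow a m)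
  have hg : chartElement N f a ∈ reesGrading (blowupIdeal f N) 1 := reesMonomial_mem _ _ _
  refine ⟨HomogeneousLocalization.Away.mk _ hg 1 (reesMonomial 1 _ hm) ?_, ?_⟩
  · exact reesMonomial_mem 1 _ hm
  · refine HomogeneousLocalization.val_injective _ ?_
    rw [HomogeneousLocalization.val_mul]
    change Localization.mk (algebraMap R _ (f j)) 1 = Localization.mk _ _ *
      Localization.mk (algebraMap R _ (f a)) 1
    rw [Localization.mk_mul, Localization.mk_eq_mk_iff, Localization.r_iff_exists]
    refine ⟨1, ?_⟩
    refine congrArg _ ?_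
    refine Subtype.ext ?_
    change (Polynomial.monomial 1 (f a ^ N)) ^ 1 * 1 * Polynomial.C (f j) =
      1 * (Polynomial.monomial 1 (f j * f a ^ (N - 1)) * Polynomial.C (f a))
    rw [pow_one, mul_one, one_mul, Polynomial.monomial_mul_C, Polynomial.monomial_mul_C]
    congr 1
    obtain ⟨m, rfl⟩ : ∃ m, N = m + 1 := ⟨N - 1, by omega⟩
    rw [Nat.add_sub_cancel]
    ring

/-- If (f_a^N t)^l annihilates z f_a, then (f_a^N t)^{l+1} annihilates z, since N ≥ 1 gives one
factor f_a to spare. -/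
theorem eq_zero_of_mul_toAway (hN : 1 ≤ N) (a : Fin n)
    (x : HomogeneousLocalization.Away (reesGrading (blowupIdeal f N)) (chartElement N f a))
    (hx : x * toAway (blowupIdeal f N) (chartElement N f a) (f a) = 0) : x = 0 := by
  have hg : chartElement N f a ∈ reesGrading (blowupIdeal f N) 1 := reesMonomial_mem _ _ _
  obtain ⟨m, z, hz, rfl⟩ := HomogeneousLocalization.Away.mk_surjective _ hg x
  have hz' := hz
  obtain ⟨h, hh⟩ := hz'
  refine HomogeneousLocalization.val_injective _ ?_
  have h1 := congrArg HomogeneousLocalization.val hx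
  rw [HomogeneousLocalization.val_mul, HomogeneousLocalization.val_zero] at h1
  rw [HomogeneousLocalization.val_zero]
  change Localization.mk z _ * Localization.mk (algebraMap R _ (f a)) 1 = 0 at h1
  change Localization.mk z _ = 0
  rw [Localization.mk_mul, ← Localization.mk_zero 1, Localization.mk_eq_mk_iff,
    Localization.r_iff_exists] at h1
  rw [← Localization.mk_zero 1, Localization.mk_eq_mk_iff, Localization.r_iff_exists]
  obtain ⟨⟨_, l, rfl⟩, hc⟩ := h1
  refine ⟨⟨_, l + 1, rfl⟩, ?_⟩
  simp only [OneMemClass.coe_one, one_mul, mul_zero] at hc ⊢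
  have hc' := congrArg (Subtype.val : reesAlgebra (blowupIdeal f N) → _) hc
  change (Polynomial.monomial 1 (f a ^ N)) ^ l * ((z : Polynomial R) * Polynomial.C (f a)) = 0
    at hc'
  refine Subtype.ext ?_
  change (Polynomial.monomial 1 (f a ^ N)) ^ (l + 1) * (z : Polynomial R) = 0
  replace hh : Polynomial.monomial (m • 1) h = (z : Polynomial R) := hh
  rw [← hh] at hc' ⊢
  rw [Polynomial.monomial_pow, Polynomial.monomial_mul_C, Polynomial.monomial_mul_monomial,
    Polynomial.monomial_eq_zero_iff] at hc'
  rw [Polynomial.monomial_pow, Polynomial.monomial_mul_monomial, Polynomial.monomial_eq_zero_iff]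
  obtain ⟨N, rfl⟩ : ∃ m, N = m + 1 := ⟨N - 1, by omega⟩
  rw [show (f a ^ (N + 1)) ^ (l + 1) * h = f a ^ N * ((f a ^ (N + 1)) ^ l * (h * f a)) by ring, hc',
    mul_zero]

end Charts


/-! ### Schemes covered by charts on which J is principal -/

section ChartCover

variable {R : CommRingCat.{u}} {Y : Scheme.{u}} (p : Y ⟶ Spec R) {n : ℕ} (f : Fin n → R)

theorem germ_toSections (V : Y.Opens) (y : Y) (hy : y ∈ V) (r : R) :
    Y.presheaf.germ V y hy (toSections p V r) = toStalk p y r :=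
  TopCat.Presheaf.germ_res_apply Y.presheaf (homOfLE (le_top : V ≤ ⊤)) y hy
    (((Scheme.ΓSpecIso R).inv ≫ p.appTop).hom r)

theorem toSections_map {V W : Y.Opens} (i : W ⟶ V) (r : R) :
    Y.presheaf.map i.op (toSections p V r) = toSections p W r := by
  refine (ConcreteCategory.comp_apply (Y.presheaf.map (homOfLE le_top).op) (Y.presheaf.map i.op)
    (((Scheme.ΓSpecIso R).inv ≫ p.appTop).hom r)).symm.trans ?_
  rw [← Y.presheaf.map_comp]
  rfl

theorem eq_zero_of_mul_algebraMap {A : Type*} [CommRing A] (M : Submonoid A) (S : Type*) [CommRing S]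
    [Algebra A S] [IsLocalization M S] (g : A) (hg : ∀ x, x * g = 0 → x = 0) (s : S)
    (hs : s * algebraMap A S g = 0) : s = 0 := by
  obtain ⟨a, m, rfl⟩ := IsLocalization.exists_mk'_eq M s
  rw [mul_comm, IsLocalization.mul_mk'_eq_mk'_of_mul, IsLocalization.mk'_eq_zero_iff] at hs
  obtain ⟨c, hc⟩ := hs
  rw [IsLocalization.mk'_eq_zero_iff]
  exact ⟨c, hg _ (by rw [← hc]; ring)⟩

/-- A cover of `Y` by affine open subsets, on the `a`-th of which `f_a` is a nonzerodivisor which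
divides the other `f_j`. -/
structure IsChartCover (U : Fin n → Y.Opens) : Prop where
  iSup_eq_top : ⨆ a, U a = ⊤
  isAffineOpen a : IsAffineOpen (U a)
  eq_zero_of_mul a (x : Γ(Y, U a)) : x * toSections p (U a) (f a) = 0 → x = 0
  dvd a j : ∃ u, toSections p (U a) (f j) = u * toSections p (U a) (f a)

theorem isChartCover_chartOpen {f : Fin n → R} {N : ℕ} (hN : 1 ≤ N) :
    IsChartCover (blowupMap (blowupIdeal f N)) f (chartOpen N f) where
  iSup_eq_top := iSup_chartOpen f hN
  isAffineOpen := isAffineOpen_chartOpen f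
  eq_zero_of_mul a x hx := by
    have hg : chartElement N f a ∈ reesGrading (blowupIdeal f N) 1 := reesMonomial_mem _ _ _
    let e := (Proj.basicOpenIsoAway (reesGrading (blowupIdeal f N)) _ hg one_pos)
    have he : e.hom = Proj.awayToSection _ _ := Proj.basicOpenIsoAway_hom _ _ _ _
    obtain ⟨y, rfl⟩ := e.commRingCatIsoToRingEquiv.surjective x
    have h1 : e.commRingCatIsoToRingEquiv (y * toAway (blowupIdeal f N) (chartElement N f a) (f a)) =
        0 := by
      rw [map_mul]
      refine Eq.trans ?_ hx
      rw [toSections_chartOpen, ← he]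
      rfl
    rw [eq_zero_of_mul_toAway f hN a y
      ((map_eq_zero_iff _ e.commRingCatIsoToRingEquiv.injective).mp h1)]
    exact map_zero _
  dvd a j := by
    obtain ⟨u, hu⟩ := toAway_dvd f hN a j
    refine ⟨(Proj.awayToSection (reesGrading (blowupIdeal f N)) (chartElement N f a)).hom u, ?_⟩
    rw [toSections_chartOpen, toSections_chartOpen, hu, map_mul]
    rfl

variable {p f} {U : Fin n → Y.Opens} (hU : IsChartCover p f U)
include hU

theorem IsChartCover.isEffectiveCartier : IsEffectiveCartier p (idealJ f) := by
  intro y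
  have hy : y ∈ ⨆ a, U a := by
    rw [hU.iSup_eq_top]
    trivial
  obtain ⟨a, ha⟩ := TopologicalSpace.Opens.mem_iSup.mp hy
  refine ⟨⟨U a, hU.isAffineOpen a⟩, ha, toSections p (U a) (f a), ?_, ?_⟩
  · exact mem_nonZeroDivisors_iff_right.mpr (hU.eq_zero_of_mul a)
  · rw [Ideal.map_span]
    refine le_antisymm (Ideal.span_le.mpr ?_) (Ideal.span_le.mpr ?_)
    · rintro _ ⟨_, ⟨j, rfl⟩, rfl⟩
      obtain ⟨u, hu⟩ := hU.dvd a j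
      exact Ideal.mem_span_singleton'.mpr ⟨u, hu.symm⟩
    · rintro _ rfl
      exact Ideal.subset_span ⟨_, ⟨a, rfl⟩, rfl⟩

/-- A smaller open subset need not be affine, but its stalks are localizations of the ring of the
chart, where nonzerodivisors stay nonzerodivisors. -/
theorem IsChartCover.eq_zero_of_mul_of_le {a : Fin n} {V : Y.Opens} (hV : V ≤ U a) (s : Γ(Y, V))
    (hs : s * toSections p V (f a) = 0) : s = 0 := by
  refine TopCat.Presheaf.section_ext Y.sheaf V s 0 fun y hy => ?_
  have h1 := congrArg (Y.presheaf.germ V y hy) hs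
  rw [map_mul, germ_toSections, map_zero, ← germ_toSections p (U a) y (hV hy)] at h1
  let : Algebra Γ(Y, U a) (Y.presheaf.stalk y) := (Y.presheaf.germ (U a) y (hV hy)).hom.toAlgebra
  have := (hU.isAffineOpen a).isLocalization_stalk ⟨y, hV hy⟩
  have h2 := eq_zero_of_mul_algebraMap
    ((hU.isAffineOpen a).primeIdealOf ⟨y, hV hy⟩).asIdeal.primeCompl (Y.presheaf.stalk y) _ (hU.eq_zero_of_mul a) _ h1
  exact h2.trans (map_zero _).symm

theorem IsChartCover.exists_mul_of_le {a : Fin n} {V : Y.Opens} (hV : V ≤ U a) (j : Fin n) :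
    ∃ u, toSections p V (f j) = u * toSections p V (f a) := by
  obtain ⟨u, hu⟩ := hU.dvd a j
  refine ⟨Y.presheaf.map (homOfLE hV).op u, ?_⟩
  rw [← toSections_map p (homOfLE hV), ← toSections_map p (homOfLE hV), hu, map_mul]

/-- On the chart J^N is generated by f_a^N in every stalk; the equation between germs spreads to a
neighbourhood. -/
theorem IsChartCover.exists_eq_pow_mul {a : Fin n} {V : Y.Opens} (hV : V ≤ U a) (N : ℕ) (s : Γ(Y, V))
    (hs : s ∈ idealSections p (idealJ f ^ N) V) (y : Y) (hy : y ∈ V) :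
    ∃ (W : Y.Opens) (hWV : W ≤ V) (_ : y ∈ W) (t : Γ(Y, W)),
      Y.presheaf.map (homOfLE hWV).op s = toSections p W (f a ^ N) * t := by
  have h1 := hs y hy
  have h2 : (idealJ f ^ N).map (toStalk p y) ≤ Ideal.span {toStalk p y (f a ^ N)} := by
    rw [Ideal.map_pow, map_pow, ← Ideal.span_singleton_pow]
    refine Ideal.pow_right_mono ?_ N
    rw [Ideal.map_span, Ideal.span_le]
    rintro _ ⟨_, ⟨j, rfl⟩, rfl⟩
    obtain ⟨u, hu⟩ := hU.exists_mul_of_le hV j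
    refine Ideal.mem_span_singleton'.mpr ⟨Y.presheaf.germ V y hy u, ?_⟩
    rw [← germ_toSections p V y hy, ← germ_toSections p V y hy, hu, map_mul]
  obtain ⟨c, hc⟩ := Ideal.mem_span_singleton'.mp (h2 h1)
  obtain ⟨W₁, hW₁, hy₁, t, rfl⟩ := TopCat.Presheaf.exists_le_germ_eq Y.presheaf c hy
  rw [← germ_toSections p W₁ y hy₁, ← map_mul] at hc
  obtain ⟨W, hyW, i₁, i₂, h⟩ := TopCat.Presheaf.germ_eq Y.presheaf y hy₁ hy _ _ hc
  refine ⟨W, i₂.le, hyW, Y.presheaf.map i₁.op t, ?_⟩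
  refine h.symm.trans ?_
  rw [mul_comm, map_mul, toSections_map]

end ChartCover


/-! ### Chart families and maps from a complex in degree 0 -/

theorem isPrincipalOn_moduleFunctor {R : Type u} [CommRing R] {n : ℕ} {f : Fin n → R}
    (G : ModuleCat.{u} R ⥤ AddCommGrpCat.{u}) [G.Additive] {B : Type*} [CommRing B] (θ : R →+* B)
    (x : G.obj (ModuleCat.of R R) ≃+ B)
    (hx : ∀ (r : R) (y : G.obj (ModuleCat.of R R)), x (G.map (r • 𝟙 _) y) = θ r * x y) (g : R)
    (hg : ∀ b, b * θ g = 0 → b = 0) (hf : ∀ j, ∃ c, θ (f j) = c * θ g) :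
    IsPrincipalOn f g ((moduleFunctor G).obj (ModuleCat.of R R)) := by
  refine ⟨fun (y : G.obj (ModuleCat.of R R)) hy => ?_,
    fun j (y : G.obj (ModuleCat.of R R)) => ?_⟩
  · replace hy : G.map (g • 𝟙 _) y = 0 := hy
    have h1 := hx g y
    rw [hy, map_zero, mul_comm] at h1
    exact (map_eq_zero_iff x x.injective).mp (hg _ h1.symm)
  · obtain ⟨c, hc⟩ := hf j
    refine ⟨x.symm (c * x y), ?_⟩
    change G.map (f j • 𝟙 _) y = G.map (g • 𝟙 _) (x.symm (c * x y))
    refine x.injective ?_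
    rw [hx, hx, hc, x.apply_symm_apply]
    ring

section SingleMap

variable {C : Type*} [Category C] [Abelian C] {R : Type u} [CommRing R]
  (T : ModuleCat.{u} R ⥤ C) [T.Additive] {K : CochainComplex (ModuleCat.{u} R) ℤ}

/-- The map `F → T K`, where `F` is placed in degree `0`, given by maps `R → K` and `F → T R`. -/
noncomputable def singleMap (e : (HomologicalComplex.single (ModuleCat.{u} R) (ComplexShape.up ℤ) 0).obj
      (ModuleCat.of R R) ⟶ K) {F : C} (j : F ⟶ T.obj (ModuleCat.of R R)) :
    (HomologicalComplex.single C (ComplexShape.up ℤ) 0).obj F ⟶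
      (T.mapHomologicalComplex (ComplexShape.up ℤ)).obj K :=
  (HomologicalComplex.single C (ComplexShape.up ℤ) 0).map j ≫
    (HomologicalComplex.singleMapHomologicalComplex T (ComplexShape.up ℤ) 0).inv.app
      (ModuleCat.of R R) ≫ (T.mapHomologicalComplex (ComplexShape.up ℤ)).map e

omit [Abelian C] in
theorem iso_cancel_three {X F Z B D : C} (s₁ : X ≅ F) (s₂ : Z ≅ B) (j : F ⟶ B) {B' : C} (t : B ⟶ B')
    (g : B' ⟶ D) : s₁.inv ≫ (s₁.hom ≫ j ≫ s₂.inv) ≫ (s₂.hom ≫ t) ≫ g = j ≫ t ≫ g := by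
  simp

theorem singleMap_f_zero (e : (HomologicalComplex.single (ModuleCat.{u} R) (ComplexShape.up ℤ) 0).obj
      (ModuleCat.of R R) ⟶ K) {F : C} (j : F ⟶ T.obj (ModuleCat.of R R)) :
    (HomologicalComplex.singleObjXSelf (ComplexShape.up ℤ) 0 F).inv ≫ (singleMap T e j).f 0 =
      j ≫ T.map ((HomologicalComplex.singleObjXSelf (ComplexShape.up ℤ) 0 _).inv ≫ e.f 0) := by
  have h1 : (singleMap T e j).f 0 =
      ((HomologicalComplex.single C (ComplexShape.up ℤ) 0).map j).f 0 ≫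
        ((HomologicalComplex.singleMapHomologicalComplex T (ComplexShape.up ℤ) 0).inv.app
          (ModuleCat.of R R)).f 0 ≫ T.map (e.f 0) := rfl
  rw [h1, HomologicalComplex.single_map_f_self,
    HomologicalComplex.singleMapHomologicalComplex_inv_app_self, T.map_comp]
  exact iso_cancel_three _ _ _ _ _

variable {T} in
-- Multiplication by f_a^{w 0} commutes with R → K^0, so the divisibility required in T(K^0) need
-- only be tested in T(R).
theorem IsWeightedContractible.exists_factorization_of_single [T.PreservesEpimorphisms] {n : ℕ}
    {f : Fin n → R} {τ : Type*} {Γ : τ → C ⥤ AddCommGrpCat.{u}} [∀ t, (Γ t).Additive]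
    [∀ t, PreservesFiniteLimits (Γ t)] {chart : τ → Fin n} {w : ℤ → ℕ}
    (hK : IsWeightedContractible f K w) (hΓ : IsChartFamily f T Γ chart)
    (e : (HomologicalComplex.single (ModuleCat.{u} R) (ComplexShape.up ℤ) 0).obj
      (ModuleCat.of R R) ⟶ K) {F : C} (j : F ⟶ T.obj (ModuleCat.of R R))
    (hj : ∀ {W : C} (h : T.obj (ModuleCat.of R R) ⟶ W),
      (∀ a, T.map (f a ^ w 0 • 𝟙 (ModuleCat.of R R)) ≫ h = 0) → j ≫ h = 0) :
    ∃ (M : CochainComplex C ℤ) (μ : M ⟶ (T.mapHomologicalComplex (ComplexShape.up ℤ)).obj K)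
      (ψ' : (HomologicalComplex.single C (ComplexShape.up ℤ) 0).obj F ⟶ M),
      Mono μ ∧ M.Acyclic ∧ ψ' ≫ μ = singleMap T e j := by
  refine hK.exists_factorization hΓ _ fun {W} h hh => ?_
  have h1 := singleMap_f_zero T e j
  let α := (HomologicalComplex.singleObjXSelf (ComplexShape.up ℤ) 0 (ModuleCat.of R R)).inv ≫ e.f 0
  have h2 : j ≫ T.map α ≫ h = 0 := by
    refine hj _ fun a => ?_
    have h3 : (f a ^ w 0 • 𝟙 (ModuleCat.of R R)) ≫ α = α ≫ (f a ^ w 0 • 𝟙 (K.X 0)) := by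
      rw [Linear.comp_smul, Category.comp_id, Linear.smul_comp, Category.id_comp]
    rw [← Category.assoc, ← T.map_comp, h3, T.map_comp, Category.assoc, hh, comp_zero]
  exact (Category.assoc _ _ _).symm.trans
    ((congrArg (· ≫ h) h1).trans ((Category.assoc _ _ _).trans h2))

end SingleMap

/-! ### Vanishing in the derived category of 𝒪_Y-modules -/

section ModulesSMul

variable {R : CommRingCat.{u}} {Y : Scheme.{u}} (p : Y ⟶ Spec R) {n : ℕ}

/-- Multiplication by the image of `r ∈ R` on an `𝒪_Y`-module. -/
noncomputable def modulesSMul (r : R) (M : Y.Modules) : M ⟶ M :=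
  SheafOfModules.Hom.mk
    { app V := ModuleCat.ofHom (X := M.val.obj V) (Y := M.val.obj V)
        (LinearMap.lsmul Γ(Y, V.unop) Γ(M, V.unop) (toSections p V.unop r) :)
      naturality {V W} i := by
        refine ModuleCat.hom_ext (LinearMap.ext fun x => ?_)
        have := M.map_smul i.unop (toSections p V.unop r) x
        rw [toSections_map] at this
        exact this.symm }

theorem modulesSMul_naturality (r : R) {M M' : Y.Modules} (φ : M ⟶ M') :
    modulesSMul p r M ≫ φ = φ ≫ modulesSMul p r M' := by
  refine Scheme.Modules.hom_ext _ _ fun V => ?_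
  ext x
  exact Scheme.Modules.Hom.app_smul φ (toSections p V r) x

/-- Under the adjunction between M ↦ M ⊗ 𝒪_Y and global sections, both maps correspond to r times
the unit. -/
theorem tensorStructureSheaf_map_smul (r : R) (L : ModuleCat.{u} R) :
    (tensorStructureSheaf p).map (r • 𝟙 L) = modulesSMul p r _ := by
  let adj := (tilde.adjunction (R := R)).comp (Scheme.Modules.pullbackPushforwardAdjunction p)
  refine (adj.homEquiv L _).injective ?_
  refine (adj.homEquiv_unit _ _ _).trans (Eq.trans ?_ (adj.homEquiv_unit _ _ _).symm)
  refine (adj.unit.naturality (r • 𝟙 L)).symm.trans ?_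
  refine ModuleCat.hom_ext (LinearMap.ext fun x => ?_)
  refine ((adj.unit.app L).hom.map_smul r x).trans ?_
  have h : (p.app ⊤).hom (((Spec R).presheaf.map (TopologicalSpace.Opens.leTop ⊤).op).hom
      ((Scheme.ΓSpecIso R).inv.hom r)) = toSections p (p ⁻¹ᵁ ⊤) r := by
    have e1 : (TopologicalSpace.Opens.leTop (⊤ : (Spec R).Opens)).op = 𝟙 _ := Subsingleton.elim _ _
    have e2 : (homOfLE (le_top : (⊤ : Y.Opens) ≤ ⊤)).op = 𝟙 _ := Subsingleton.elim _ _
    change _ = (Y.presheaf.map (homOfLE (le_top : (⊤ : Y.Opens) ≤ ⊤)).op).hom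
      (p.appTop.hom ((Scheme.ΓSpecIso R).inv.hom r))
    rw [e1, e2, CategoryTheory.Functor.map_id, CategoryTheory.Functor.map_id]
    rfl
  exact congrArg (· • (show Γ((tensorStructureSheaf p).obj L, p ⁻¹ᵁ ⊤) from
    (adj.unit.app L).hom x)) h

/-- The sections of a sheaf of modules over an open subset. -/
noncomputable abbrev modulesSections (Y : Scheme.{u}) (V : Y.Opens) : Y.Modules ⥤ AddCommGrpCat.{u} :=
  Scheme.Modules.toPresheaf Y ⋙ (CategoryTheory.evaluation _ _).obj (.op V)

instance (V : Y.Opens) : (modulesSections Y V).Additive where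
  map_add := rfl

/-- The sections of `R ⊗_R 𝒪_Y`. -/
noncomputable def tensorStructureSheafSections (V : Y.Opens) :
    (tensorStructureSheaf p ⋙ modulesSections Y V).obj (ModuleCat.of R R) ≃+ Γ(Y, V) :=
  ((modulesSections Y V).mapIso (tensorStructureSheafSelf p)).addCommGroupIsoToAddEquiv

theorem sections_eq_of_cover {U : Fin n → Y.Opens} (hU : ⨆ a, U a = ⊤) (M : Y.Modules) (V : Y.Opens)
    (x y : Γ(M, V)) (h : ∀ a, M.presheaf.map (homOfLE (inf_le_left : V ⊓ U a ≤ V)).op x =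
      M.presheaf.map (homOfLE (inf_le_left : V ⊓ U a ≤ V)).op y) : x = y := by
  refine TopCat.Sheaf.eq_of_locally_eq' ⟨M.presheaf, M.isSheaf⟩ (fun a => V ⊓ U a) V
    (fun a => homOfLE inf_le_left) ?_ x y h
  rw [← inf_iSup_eq, hU, inf_top_eq]

/-- The family uses every open subset of a chart, not just the charts: the sheaves it has to
separate are arbitrary, not quasi-coherent. -/
theorem IsChartCover.isChartFamily {f : Fin n → R} {U : Fin n → Y.Opens} (hU : IsChartCover p f U) :
    IsChartFamily f (tensorStructureSheaf p)
      (fun t : Σ a, { V : Y.Opens // V ≤ U a } => modulesSections Y t.2.1) (fun t => t.1) where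
  eq_zero {X Z} h H := by
    refine Scheme.Modules.hom_ext _ _ fun V => ?_
    ext x
    refine sections_eq_of_cover hU.iSup_eq_top Z V _ _ fun a => ?_
    have h1 := H ⟨a, V ⊓ U a, inf_le_right⟩
      (X.presheaf.map (homOfLE (inf_le_left : V ⊓ U a ≤ V)).op x)
    have h2 := ConcreteCategory.congr_hom
      (h.mapPresheaf.naturality (homOfLE (inf_le_left : V ⊓ U a ≤ V)).op) x
    exact (h2.symm.trans h1).trans (map_zero (Z.presheaf.map _).hom).symm
  isPrincipalOn := by
    rintro ⟨a, V, hV⟩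
    refine isPrincipalOn_moduleFunctor _ (toSections p V) (x := tensorStructureSheafSections p V)
      (fun r x => ?_) (f a) (fun x => hU.eq_zero_of_mul_of_le hV x) (hU.exists_mul_of_le hV)
    change (tensorStructureSheafSelf p).hom.app V
      (((tensorStructureSheaf p).map (r • 𝟙 _)).app V x) = _
    rw [tensorStructureSheaf_map_smul]
    exact Scheme.Modules.Hom.app_smul (tensorStructureSheafSelf p).hom (toSections p V r) x

/-- A section of J^N 𝒪_Y is locally a multiple of some f_a^N. Only locality of the target is used,
so the statement serves both sheaves of 𝒪_Y-modules and sheaves of R-modules. -/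
theorem IsChartCover.apply_eq_zero_of_mem_idealSections {f : Fin n → R} {U : Fin n → Y.Opens}
    (hU : IsChartCover p f U) {G : Y.Opens → Type*} [∀ V, Zero (G V)]
    (res : ∀ {V V' : Y.Opens}, V' ≤ V → G V → G V')
    (hG : ∀ (V : Y.Opens) (x : G V),
      (∀ y ∈ V, ∃ (V' : Y.Opens) (h : V' ≤ V), y ∈ V' ∧ res h x = 0) → x = 0)
    (g : ∀ V : Y.Opens, Γ(Y, V) → G V)
    (hg : ∀ {V V' : Y.Opens} (h : V' ≤ V) (t : Γ(Y, V)),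
      res h (g V t) = g V' (Y.presheaf.map (homOfLE h).op t)) (N : ℕ)
    (hN : ∀ a V t, g V (toSections p V (f a ^ N) * t) = 0) (V : Y.Opens) (s : Γ(Y, V))
    (hs : s ∈ idealSections p (idealJ f ^ N) V) : g V s = 0 := by
  refine hG V _ fun y hy => ?_
  have hy' : y ∈ ⨆ a, U a := by
    rw [hU.iSup_eq_top]
    trivial
  obtain ⟨a, ha⟩ := TopologicalSpace.Opens.mem_iSup.mp hy'
  obtain ⟨W, hW, hyW, t, ht⟩ := hU.exists_eq_pow_mul (inf_le_right : V ⊓ U a ≤ U a) N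
    (Y.presheaf.map (homOfLE inf_le_left).op s)
    ((idealSubmodule p (idealJ f ^ N)).map (homOfLE (inf_le_left : V ⊓ U a ≤ V)).op hs) y ⟨hy, ha⟩
  refine ⟨W, hW.trans inf_le_left, hyW, ?_⟩
  rw [hg]
  refine (congrArg _ ?_).trans (hN a W t)
  rw [← ht, ← ConcreteCategory.comp_apply, ← Functor.map_comp]
  rfl

theorem sheafLevelMap_eq_zero_of_isChartCover {f : Fin n → R} {U : Fin n → Y.Opens}
    [HasDerivedCategory.{w} Y.Modules]
    (hU : IsChartCover p f U) {K : CochainComplex (ModuleCat.{u} R) ℤ} {w : ℤ → ℕ}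
    (hK : IsWeightedContractible f K w)
    (e : (HomologicalComplex.single (ModuleCat.{u} R) (ComplexShape.up ℤ) 0).obj
      (ModuleCat.of R R) ⟶ K) :
    DerivedCategory.Q.map (sheafLevelMap p e (minusTwistι p (idealJ f) (w 0))) = 0 := by
  have : (tensorStructureSheaf p).PreservesEpimorphisms :=
    inferInstanceAs (tilde.functor R ⋙ Scheme.Modules.pullback p).PreservesEpimorphisms
  have hfac : ∀ {W : Y.Modules} (h : structureSheaf Y ⟶ W),
      (∀ a, modulesSMul p (f a ^ w 0) _ ≫ h = 0) → minusTwistι p (idealJ f) (w 0) ≫ h = 0 := by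
    intro W h hh
    refine Scheme.Modules.hom_ext _ _ fun V => ?_
    ext (s : idealSections p (idealJ f ^ w 0) V)
    have hh' (a) (V' : Y.Opens) (t : Γ(Y, V')) :
        h.app V' (toSections p V' (f a ^ w 0) * t) = 0 := by
      have h1 (t : Γ(structureSheaf Y, V')) :
          (modulesSMul p (f a ^ w 0) (structureSheaf Y) ≫ h).app V' t = 0 := by
        rw [hh a]
        rfl
      exact h1 t
    have hnat (V' V'' : Y.Opens) (i : V'' ⟶ V') (t : Γ(Y, V')) :
        W.presheaf.map i.op (h.app V' t) = h.app V'' (Y.presheaf.map i.op t) :=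
      (ConcreteCategory.congr_hom (h.mapPresheaf.naturality i.op) t).symm
    refine hU.apply_eq_zero_of_mem_idealSections p (G := fun V => Γ(W, V))
      (fun h => W.presheaf.map (homOfLE h).op) (fun V x hx => ?_) (fun V t => h.app V t)
      (fun h t => hnat _ _ _ t) (w 0) hh' V s.1 s.2
    choose W' hW' hyW' hs using hx
    refine TopCat.Sheaf.eq_of_locally_eq' ⟨W.presheaf, W.isSheaf⟩ (fun y : V => W' y.1 y.2) V
      (fun y => homOfLE (hW' y.1 y.2)) (fun y hy => ?_) _ _ fun y => ?_
    · exact TopologicalSpace.Opens.mem_iSup.mpr ⟨⟨y, hy⟩, hyW' y hy⟩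
    · exact (hs y.1 y.2).trans (map_zero (W.presheaf.map _).hom).symm
  obtain ⟨M, μ, ψ', -, hM, h⟩ := hK.exists_factorization_of_single (hU.isChartFamily p) e
    (minusTwistι p (idealJ f) (w 0) ≫ (tensorStructureSheafSelf p).inv) fun {W} h hh => by
      rw [Category.assoc]
      refine hfac _ fun a => ?_
      rw [← Category.assoc, modulesSMul_naturality, Category.assoc, ← tensorStructureSheaf_map_smul,
        hh, comp_zero]
  exact (congrArg _ h.symm).trans (Q_map_eq_zero hM ψ' μ)

end ModulesSMul


/-! ### The tensor product of complexes in coordinates -/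

section TensorComplex

variable {R : Type u} [CommRing R] (L K K' K'' : CochainComplex (ModuleCat.{u} R) ℤ)

/-- The tensor product of complexes. -/
noncomputable abbrev tensorCx : CochainComplex (ModuleCat.{u} R) ℤ :=
  HomologicalComplex.tensorObj L K

/-- The inclusion of a summand in the tensor product of complexes. -/
noncomputable def tensorι (i j q : ℤ) (h : i + j = q) : L.X i ⊗[R] K.X j →ₗ[R] (tensorCx L K).X q :=
  (HomologicalComplex.ιTensorObj L K i j q h).hom

variable {L K} in
theorem tensorCx_ext {q : ℤ} {A : ModuleCat.{u} R} {φ ψ : (tensorCx L K).X q ⟶ A}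
    (H : ∀ i j (h : i + j = q) (x : L.X i) (y : K.X j),
      φ.hom (tensorι L K i j q h (x ⊗ₜ y)) = ψ.hom (tensorι L K i j q h (x ⊗ₜ y))) : φ = ψ := by
  refine HomologicalComplex.mapBifunctor.hom_ext fun i j h => ?_
  refine ModuleCat.hom_ext (TensorProduct.ext' fun x y => ?_)
  exact H i j h x y

theorem tensorCx_d {i i' j j' q q' : ℤ} (hi : i + 1 = i') (hj : j + 1 = j') (h : i + j = q)
    (h' : i' + j = q') (h'' : i + j' = q') (x : L.X i) (y : K.X j) :
    ((tensorCx L K).d q q').hom (tensorι L K i j q h (x ⊗ₜ y)) =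
      tensorι L K i' j q' h' ((L.d i i').hom x ⊗ₜ y) +
        i.negOnePow • tensorι L K i j' q' h'' (x ⊗ₜ (K.d j j').hom y) := by
  have h1 : HomologicalComplex.ιTensorObj L K i j q h ≫ (tensorCx L K).d q q' =
      ((MonoidalCategory.curriedTensor _).map (L.d i i')).app (K.X j) ≫
        HomologicalComplex.ιTensorObj L K i' j q' h' +
      i.negOnePow • (((MonoidalCategory.curriedTensor _).obj (L.X i)).map (K.d j j') ≫
        HomologicalComplex.ιTensorObj L K i j' q' h'') := by
    rw [HomologicalComplex.mapBifunctor.d_eq, Preadditive.comp_add,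
      HomologicalComplex.mapBifunctor.ι_D₁, HomologicalComplex.mapBifunctor.ι_D₂,
      HomologicalComplex.mapBifunctor.d₁_eq _ _ _ _ (i₁' := i') hi _ _ h',
      HomologicalComplex.mapBifunctor.d₂_eq _ _ _ _ _ (i₂' := j') hj _ h'']
    congr 1
    exact one_smul _ _
  exact LinearMap.congr_fun (congrArg ModuleCat.Hom.hom h1) (x ⊗ₜ y)

/-- Functoriality of the tensor product of complexes in the second variable. -/
noncomputable abbrev tensorMap {K K' : CochainComplex (ModuleCat.{u} R) ℤ} (φ : K ⟶ K') :
    tensorCx L K ⟶ tensorCx L K' := HomologicalComplex.tensorHom (𝟙 L) φ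

variable {K K'} in
theorem tensorMap_ι (φ : K ⟶ K') {i j q : ℤ} (h : i + j = q) (x : L.X i) (y : K.X j) :
    ((tensorMap L φ).f q).hom (tensorι L K i j q h (x ⊗ₜ y)) =
      tensorι L K' i j q h (x ⊗ₜ (φ.f j).hom y) := by
  have h1 := HomologicalComplex.ι_mapBifunctorMap (𝟙 L) φ (MonoidalCategory.curriedTensor _)
    (ComplexShape.up ℤ) i j q h
  exact LinearMap.congr_fun (congrArg ModuleCat.Hom.hom h1) (x ⊗ₜ y)

/-- The inclusion `y ↦ b ⊗ y`. -/
noncomputable def tensorIncl {i : ℤ} (b : L.X i) (j q : ℤ) (h : i + j = q) :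
    K.X j ⟶ (tensorCx L K).X q :=
  ModuleCat.ofHom (tensorι L K i j q h ∘ₗ TensorProduct.mk R (L.X i) (K.X j) b)

/-- The contraction `x ⊗ y ↦ c(x) y` in degree `i`, and zero in the other degrees of `L`. -/
noncomputable def tensorContr {i : ℤ} (c : L.X i →ₗ[R] R) (j q : ℤ) (h : i + j = q) :
    (tensorCx L K).X q ⟶ K.X j :=
  HomologicalComplex.mapBifunctorDesc fun i' j' h' =>
    if hi : i' = i then
      ModuleCat.ofHom (TensorProduct.lid R (K.X j') ∘ₗ
        LinearMap.rTensor (K.X j') (c ∘ₗ (L.XIsoOfEq hi).hom.hom)) ≫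
      (K.XIsoOfEq (show j' = j by change i' + j' = q at h'; omega)).hom
    else 0

theorem tensorContr_ι {i : ℤ} (c : L.X i →ₗ[R] R) (j q : ℤ) (h : i + j = q) (x : L.X i) (y : K.X j) :
    (tensorContr L K c j q h).hom (tensorι L K i j q h (x ⊗ₜ y)) = c x • y := by
  have h1 : HomologicalComplex.ιTensorObj L K i j q h ≫ tensorContr L K c j q h = _ :=
    HomologicalComplex.ι_mapBifunctorDesc _ i j h
  rw [dif_pos rfl] at h1
  exact LinearMap.congr_fun (congrArg ModuleCat.Hom.hom h1) (x ⊗ₜ y)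

theorem tensorContr_ι_of_ne {i : ℤ} (c : L.X i →ₗ[R] R) (j q : ℤ) (h : i + j = q) {i' j' : ℤ}
    (h' : i' + j' = q) (hi : i' ≠ i) (x : L.X i') (y : K.X j') :
    (tensorContr L K c j q h).hom (tensorι L K i' j' q h' (x ⊗ₜ y)) = 0 := by
  have h1 : HomologicalComplex.ιTensorObj L K i' j' q h' ≫ tensorContr L K c j q h = _ :=
    HomologicalComplex.ι_mapBifunctorDesc _ i' j' h'
  rw [dif_neg hi] at h1
  exact LinearMap.congr_fun (congrArg ModuleCat.Hom.hom h1) (x ⊗ₜ y)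

variable {K K'} in
theorem tensorContr_naturality (φ : K ⟶ K') {i : ℤ} (c : L.X i →ₗ[R] R) (j q : ℤ) (h : i + j = q) :
    (tensorMap L φ).f q ≫ tensorContr L K' c j q h = tensorContr L K c j q h ≫ φ.f j := by
  refine tensorCx_ext fun i' j' h' x y => ?_
  change (tensorContr L K' c j q h).hom (((tensorMap L φ).f q).hom (tensorι L K i' j' q h' (x ⊗ₜ y))) =
    (φ.f j).hom ((tensorContr L K c j q h).hom (tensorι L K i' j' q h' (x ⊗ₜ y)))
  rw [tensorMap_ι]
  by_cases hi : i' = i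
  · subst hi
    obtain rfl : j' = j := by omega
    rw [tensorContr_ι, tensorContr_ι, map_smul]
  · rw [tensorContr_ι_of_ne _ _ _ _ _ _ _ hi, tensorContr_ι_of_ne _ _ _ _ _ _ _ hi, map_zero]

variable {K K'} in
theorem tensorIncl_naturality (φ : K ⟶ K') {i : ℤ} (b : L.X i) (j q : ℤ) (h : i + j = q) :
    φ.f j ≫ tensorIncl L K' b j q h = tensorIncl L K b j q h ≫ (tensorMap L φ).f q := by
  refine ModuleCat.hom_ext (LinearMap.ext fun y => ?_)
  exact (tensorMap_ι L φ h b y).symm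

theorem tensorIncl_d {i i' j j' q q' : ℤ} (hi : i + 1 = i') (hj : j + 1 = j') (h : i + j = q)
    (h' : i' + j = q') (h'' : i + j' = q') (b : L.X i) (y : K.X j) :
    ((tensorCx L K).d q q').hom ((tensorIncl L K b j q h).hom y) =
      (tensorIncl L K ((L.d i i').hom b) j q' h').hom y +
        i.negOnePow • (tensorIncl L K b j' q' h'').hom ((K.d j j').hom y) :=
  tensorCx_d L K hi hj h h' h'' b y

/-- The Leibniz rule read through a functional c: contraction commutes with the differential up to
sign and up to contraction with c ∘ d_L. -/
theorem tensorContr_d {i i' j j' q q' : ℤ} (hi : i' + 1 = i) (hj : j + 1 = j') (h : i + j = q)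
    (h' : i' + j' = q) (h'' : i + j' = q') (c : L.X i →ₗ[R] R) (z : (tensorCx L K).X q) :
    (tensorContr L K c j' q' h'').hom (((tensorCx L K).d q q').hom z) =
      (tensorContr L K (c ∘ₗ (L.d i' i).hom) j' q h').hom z +
        i.negOnePow • (K.d j j').hom ((tensorContr L K c j q h).hom z) := by
  have h1 : (tensorCx L K).d q q' ≫ tensorContr L K c j' q' h'' =
      tensorContr L K (c ∘ₗ (L.d i' i).hom) j' q h' +
        i.negOnePow • (tensorContr L K c j q h ≫ K.d j j') := by
    refine tensorCx_ext fun a b hab x y => ?_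
    change (tensorContr L K c j' q' h'').hom (((tensorCx L K).d q q').hom
      (tensorι L K a b q hab (x ⊗ₜ y))) =
      (tensorContr L K (c ∘ₗ (L.d i' i).hom) j' q h').hom (tensorι L K a b q hab (x ⊗ₜ y)) +
        i.negOnePow • (K.d j j').hom ((tensorContr L K c j q h).hom (tensorι L K a b q hab (x ⊗ₜ y)))
    have hq : a + 1 + b = q' := by omega
    rw [tensorCx_d L K rfl rfl hab hq (by omega), map_add]
    have hsm (ε : ℤˣ) (z) : (tensorContr L K c j' q' h'').hom (ε • z) =
        ε • (tensorContr L K c j' q' h'').hom z := by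
      rw [Units.smul_def, Units.smul_def, map_zsmul]
    rw [hsm]
    by_cases h1 : a = i
    · subst h1
      obtain rfl : b = j := by omega
      subst hj
      rw [tensorContr_ι, tensorContr_ι, tensorContr_ι_of_ne _ _ _ _ _ _ _ (by omega),
        tensorContr_ι_of_ne _ _ _ _ _ _ _ (by omega), map_smul]
    · rw [tensorContr_ι_of_ne _ _ c _ _ h'' _ h1, tensorContr_ι_of_ne _ _ c _ _ h _ h1, map_zero,
        smul_zero, smul_zero, add_zero, add_zero]
      by_cases h2 : a = i'
      · subst h2 hi
        obtain rfl : b = j' := by omega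
        rw [tensorContr_ι, tensorContr_ι]
        rfl
      · rw [tensorContr_ι_of_ne _ _ _ _ _ _ _ h2, tensorContr_ι_of_ne _ _ _ _ _ _ _ (by omega)]
  exact LinearMap.congr_fun (congrArg ModuleCat.Hom.hom h1) z

end TensorComplex


/-! ### Tensoring with a bounded complex of finite projective modules -/

section DualBases

variable {R : Type u} [CommRing R]

theorem tensorContr_incl (L K : CochainComplex (ModuleCat.{u} R) ℤ) {i : ℤ} (c : L.X i →ₗ[R] R)
    (b : L.X i) (j q : ℤ) (h : i + j = q) (y : K.X j) :
    (tensorContr L K c j q h).hom ((tensorIncl L K b j q h).hom y) = c b • y :=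
  tensorContr_ι _ _ _ _ _ _ _ _

theorem tensorContr_incl_of_ne (L K : CochainComplex (ModuleCat.{u} R) ℤ) {i i' : ℤ}
    (c : L.X i →ₗ[R] R) (b : L.X i') (j j' q : ℤ) (h : i + j = q) (h' : i' + j' = q) (hi : i' ≠ i)
    (y : K.X j') : (tensorContr L K c j q h).hom ((tensorIncl L K b j' q h').hom y) = 0 :=
  tensorContr_ι_of_ne _ _ _ _ _ _ _ hi _ _

/-- Dual bases of the terms of a bounded complex of finite projective modules. -/
structure DualBases (L : CochainComplex (ModuleCat.{u} R) ℤ) (lo hi : ℤ) where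
  /-- The number of elements of the dual bases. -/
  rank : ℤ → ℕ
  /-- The generators. -/
  vec (i : ℤ) : Fin (rank i) → L.X i
  /-- The coordinates. -/
  coord (i : ℤ) : Fin (rank i) → (L.X i →ₗ[R] R)
  sum_coord_smul_vec i x : ∑ l, coord i l x • vec i l = x
  isZero i : i < lo ∨ hi < i → IsZero (L.X i)

theorem exists_dual_bases (M : Type*) [AddCommGroup M] [Module R M] [Module.Finite R M]
    [Module.Projective R M] :
    ∃ (m : ℕ) (b : Fin m → M) (c : Fin m → (M →ₗ[R] R)), ∀ x, ∑ l, c l x • b l = x := by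
  obtain ⟨m, p, s, -, -, h⟩ := Module.Finite.exists_comp_eq_id_of_projective R M
  refine ⟨m, fun l => p (Pi.single l 1), fun l => LinearMap.proj l ∘ₗ s, fun x => ?_⟩
  conv_rhs => rw [← LinearMap.id_apply (R := R) x, ← h, LinearMap.comp_apply,
    LinearMap.pi_apply_eq_sum_univ p (s x)]
  refine Finset.sum_congr rfl fun l _ => ?_
  have h3 : (fun j => if l = j then (1 : R) else 0) = Pi.single l 1 := by
    funext j
    simp [Pi.single_apply, eq_comm]
  rw [h3]
  rfl

theorem nonempty_dualBases {L : CochainComplex (ModuleCat.{u} R) ℤ} {lo hi : ℤ}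
    (h1 : ∀ q, Module.Finite R (L.X q)) (h2 : ∀ q, Module.Projective R (L.X q))
    (h3 : ∀ i, i < lo ∨ hi < i → IsZero (L.X i)) : Nonempty (DualBases L lo hi) := by
  choose m b c h using fun q => exists_dual_bases (R := R) (L.X q)
  exact ⟨⟨m, b, c, h, h3⟩⟩

variable {L : CochainComplex (ModuleCat.{u} R) ℤ} {lo hi : ℤ} (B : DualBases L lo hi)
  (K K' : CochainComplex (ModuleCat.{u} R) ℤ)
include B

/-- The identity of L^i is ∑ coord ⊗ vec; tensor it with K and sum over the finitely many degrees of
L. -/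
theorem DualBases.sum_incl_contr (q : ℤ) (z : (tensorCx L K).X q) :
    ∑ i ∈ Finset.Icc lo hi, ∑ l, (tensorIncl L K (B.vec i l) (q - i) q (by omega)).hom
      ((tensorContr L K (B.coord i l) (q - i) q (by omega)).hom z) = z := by
  have h1 : ∑ i ∈ Finset.Icc lo hi, ∑ l, tensorContr L K (B.coord i l) (q - i) q (by omega) ≫
      tensorIncl L K (B.vec i l) (q - i) q (by omega) = 𝟙 ((tensorCx L K).X q) := by
    refine tensorCx_ext fun i j h x y => ?_
    simp only [ModuleCat.hom_sum, LinearMap.sum_apply, ModuleCat.hom_comp, LinearMap.comp_apply]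
    refine Eq.trans ?_ (ModuleCat.id_apply _ _).symm
    by_cases hi : i ∈ Finset.Icc lo hi
    · rw [Finset.sum_eq_single_of_mem i hi]
      · obtain rfl : j = q - i := by omega
        conv_rhs => rw [← B.sum_coord_smul_vec i x, TensorProduct.sum_tmul, map_sum]
        refine Finset.sum_congr rfl fun l _ => ?_
        rw [tensorContr_ι, map_smul, ← TensorProduct.smul_tmul', map_smul]
        rfl
      · intro i' _ hi'
        refine Finset.sum_eq_zero fun l _ => ?_
        rw [tensorContr_ι_of_ne _ _ _ _ _ _ _ hi'.symm, map_zero]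
    · have : IsZero (L.X i) := B.isZero i (by rw [Finset.mem_Icc] at hi; omega)
      have := ModuleCat.subsingleton_of_isZero this
      rw [Subsingleton.elim x 0, TensorProduct.zero_tmul, map_zero]
      simp
  have h2 := LinearMap.congr_fun (congrArg ModuleCat.Hom.hom h1) z
  simp only [ModuleCat.hom_sum, LinearMap.sum_apply] at h2
  exact h2

theorem DualBases.tensor_ext {q : ℤ} {z z' : (tensorCx L K).X q}
    (H : ∀ (i : ℤ) (h : i + (q - i) = q) (c : L.X i →ₗ[R] R),
      (tensorContr L K c (q - i) q h).hom z = (tensorContr L K c (q - i) q h).hom z') : z = z' := by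
  rw [← B.sum_incl_contr K q z, ← B.sum_incl_contr K q z']
  simp only [H]

theorem DualBases.contr_eq_sum {i j q : ℤ} (h : i + j = q) (c : L.X i →ₗ[R] R)
    (z : (tensorCx L K).X q) : (tensorContr L K c j q h).hom z =
      ∑ l, c (B.vec i l) • (tensorContr L K (B.coord i l) j q h).hom z := by
  have h1 : tensorContr L K c j q h =
      ∑ l, c (B.vec i l) • tensorContr L K (B.coord i l) j q h := by
    refine tensorCx_ext fun i' j' h' x y => ?_
    simp only [ModuleCat.hom_sum, LinearMap.sum_apply, ModuleCat.hom_smul, LinearMap.smul_apply]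
    by_cases hi : i' = i
    · subst hi
      obtain rfl : j' = j := by omega
      rw [tensorContr_ι]
      conv_lhs => rw [← B.sum_coord_smul_vec i' x, map_sum, Finset.sum_smul]
      refine Finset.sum_congr rfl fun l _ => ?_
      rw [tensorContr_ι, map_smul, smul_smul, smul_eq_mul, mul_comm]
    · rw [tensorContr_ι_of_ne _ _ _ _ _ _ _ hi]
      refine (Finset.sum_eq_zero fun l _ => ?_).symm
      rw [tensorContr_ι_of_ne _ _ _ _ _ _ _ hi, smul_zero]
  have h2 := LinearMap.congr_fun (congrArg ModuleCat.Hom.hom h1) z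
  simp only [ModuleCat.hom_sum, LinearMap.sum_apply] at h2
  exact h2

variable {K}

/-- Filter L ⊗ K by the degree in L. A cycle without components of L-degree below t has components
of degree t that are cycles of K, hence boundaries; subtracting a boundary of L ⊗ K removes them.
Since L is bounded this stops. -/
theorem DualBases.exists_eq_d (hK : ∀ (j j' : ℤ), j + 1 = j' → ∀ y : K.X j',
      (K.d j' (j' + 1)).hom y = 0 → ∃ x, (K.d j j').hom x = y) {p q r : ℤ} (hpq : p + 1 = q)
    (hqr : q + 1 = r) (z : (tensorCx L K).X q) (hz : ((tensorCx L K).d q r).hom z = 0) :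
    ∃ x, ((tensorCx L K).d p q).hom x = z := by
  suffices H : ∀ (m : ℕ) (t : ℤ), hi < t + m → ∀ z : (tensorCx L K).X q,
      ((tensorCx L K).d q r).hom z = 0 →
      (∀ (i j : ℤ) (h : i + j = q) (c : L.X i →ₗ[R] R), i < t →
        (tensorContr L K c j q h).hom z = 0) → ∃ x, ((tensorCx L K).d p q).hom x = z by
    refine H (hi - lo + 1).toNat lo (by omega) z hz fun i j h c hi => ?_
    have := ModuleCat.subsingleton_of_isZero (B.isZero i (Or.inl hi))
    rw [B.contr_eq_sum]
    refine Finset.sum_eq_zero fun l _ => ?_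
    rw [Subsingleton.elim (B.vec i l) 0, map_zero, zero_smul]
  intro m
  induction m with
  | zero =>
    intro t ht z _ h0
    refine ⟨0, ?_⟩
    rw [map_zero]
    refine (B.tensor_ext K fun i h c => ?_).symm
    rw [map_zero]
    by_cases hi : i < t
    · exact h0 i _ h c hi
    · have := ModuleCat.subsingleton_of_isZero (B.isZero i (Or.inr (by push_cast at ht; omega)))
      rw [B.contr_eq_sum]
      refine Finset.sum_eq_zero fun l _ => ?_
      rw [Subsingleton.elim (B.vec i l) 0, map_zero, zero_smul]
  | succ m ih =>
    intro t ht z hz h0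
    have h1 (c : L.X t →ₗ[R] R) : (K.d (q - t) (q - t + 1)).hom
        ((tensorContr L K c (q - t) q (by omega)).hom z) = 0 := by
      have h2 := tensorContr_d L K (i := t) (i' := t - 1) (j := q - t) (j' := q - t + 1) (q' := r)
        (by omega) rfl (by omega) (by omega) (by omega) c z
      rw [hz, map_zero, h0 _ _ _ _ (by omega), zero_add] at h2
      exact (smul_eq_zero_iff_eq (t.negOnePow : ℤˣ)).mp h2.symm
    choose y hy using fun l => hK (q - t - 1) (q - t) (by omega) _ (h1 (B.coord t l))
    -- The sign cancels that of the Leibniz rule, so d x has the required components in L-degree t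
    -- and an error only in L-degree t + 1.
    let x : (tensorCx L K).X p := t.negOnePow •
      ∑ l, (tensorIncl L K (B.vec t l) (q - t - 1) p (by omega)).hom (y l)
    have hx : ((tensorCx L K).d p q).hom x =
        ∑ l, (t.negOnePow • (tensorIncl L K ((L.d t (t + 1)).hom (B.vec t l)) (q - t - 1) q
          (by omega)).hom (y l) + (tensorIncl L K (B.vec t l) (q - t) q (by omega)).hom
            ((tensorContr L K (B.coord t l) (q - t) q (by omega)).hom z)) := by
      have hs : ((tensorCx L K).d p q).hom x = t.negOnePow • ((tensorCx L K).d p q).hom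
          (∑ l, (tensorIncl L K (B.vec t l) (q - t - 1) p (by omega)).hom (y l)) := by
        rw [Units.smul_def, ← map_zsmul]
        rfl
      rw [hs, map_sum, Finset.smul_sum]
      refine Finset.sum_congr rfl fun l _ => ?_
      rw [tensorIncl_d L K (i' := t + 1) (j' := q - t) rfl (by omega) (by omega) (by omega)
        (by omega), hy, smul_add, smul_smul, Int.units_mul_self, one_smul]
    obtain ⟨x', hx'⟩ := ih (t + 1) (by push_cast at ht; omega) (z - ((tensorCx L K).d p q).hom x) (by
      rw [map_sub, hz]
      have := ConcreteCategory.congr_hom ((tensorCx L K).d_comp_d p q r) x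
      exact sub_eq_zero.mpr this.symm) (by
      intro i j h c hi
      rw [map_sub, hx, map_sum, sub_eq_zero]
      have hsm (ε : ℤˣ) (z) : (tensorContr L K c j q h).hom (ε • z) =
          ε • (tensorContr L K c j q h).hom z := by
        rw [Units.smul_def, Units.smul_def, map_zsmul]
      simp only [map_add, hsm]
      by_cases hit : i = t
      · subst hit
        obtain rfl : j = q - i := by omega
        rw [B.contr_eq_sum]
        refine Finset.sum_congr rfl fun l _ => ?_
        rw [tensorContr_incl, tensorContr_incl_of_ne _ _ _ _ _ _ _ _ _ (by omega), smul_zero,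
          zero_add]
      · rw [h0 i j h c (by omega)]
        refine (Finset.sum_eq_zero fun l _ => ?_).symm
        rw [tensorContr_incl_of_ne _ _ _ _ _ _ _ _ _ (by omega),
          tensorContr_incl_of_ne _ _ _ _ _ _ _ _ _ (by omega), smul_zero, zero_add])
    refine ⟨x' + x, ?_⟩
    rw [map_add, hx', sub_add_cancel]

end DualBases


/-! ### Preservation of quasi-isomorphisms by L ⊗ - -/

section QuasiIso

theorem quasiIso_f_of_acyclic {C : Type*} [Category C] [Abelian C] {ι : Type*} {c : ComplexShape ι}
    {S : ShortComplex (HomologicalComplex C c)} (hS : S.ShortExact) (h : S.X₃.Acyclic)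
    (hc : ∀ j, ∃ i, c.Rel i j) : QuasiIso S.f := by
  refine ⟨fun j => ?_⟩
  rw [quasiIsoAt_iff_isIso_homologyMap]
  obtain ⟨i, hij⟩ := hc j
  have hz (i) : IsZero (S.X₃.homology i) := (S.X₃.exactAt_iff_isZero_homology i).mp (h i)
  have h1 : Mono (HomologicalComplex.homologyMap S.f j) :=
    (hS.homology_exact₁ i j hij).mono_g ((hz i).eq_of_src _ _)
  have h2 : Epi (HomologicalComplex.homologyMap S.f j) :=
    (hS.homology_exact₂ j).epi_f ((hz j).eq_of_tgt _ _)
  exact isIso_of_mono_of_epi _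

/-- Every map of complexes is a monomorphism followed by a split homotopy equivalence. -/
theorem exists_mono_factorization {C : Type*} [Category C] [Abelian C]
    {K K' : CochainComplex C ℤ} (φ : K ⟶ K') :
    ∃ (E : CochainComplex C ℤ) (ψ : K ⟶ E) (π : E ⟶ K') (σ : K' ⟶ E),
      Mono ψ ∧ ψ ≫ π = φ ∧ σ ≫ π = 𝟙 K' ∧ Nonempty (Homotopy (π ≫ σ) (𝟙 E)) := by
  let P := CochainComplex.mappingCone (𝟙 K)
  have hP : Homotopy (𝟙 P) 0 := CochainComplex.mappingCone.homotopyToZeroOfId K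
  refine ⟨K' ⊞ P, biprod.lift φ (CochainComplex.mappingCone.inr (𝟙 K)), biprod.fst, biprod.inl, ?_,
    biprod.lift_fst _ _, biprod.inl_fst, ⟨?_⟩⟩
  · have : Mono (CochainComplex.mappingCone.inr (𝟙 K)) := by
      refine HomologicalComplex.mono_of_mono_f _ fun i => ?_
      exact (SplitMono.mk (CochainComplex.mappingCone.snd (𝟙 K) |>.v i i (add_zero i))
        (CochainComplex.mappingCone.inr_f_snd_v _ _)).mono
    exact mono_of_mono_fac (biprod.lift_snd φ _)
  · have h1 : Homotopy ((biprod.snd : K' ⊞ P ⟶ P) ≫ 𝟙 P ≫ (biprod.inr : P ⟶ K' ⊞ P))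
        ((biprod.snd : K' ⊞ P ⟶ P) ≫ (0 : P ⟶ P) ≫ (biprod.inr : P ⟶ K' ⊞ P)) :=
      (hP.compRight _).compLeft _
    have h2 : (biprod.fst : K' ⊞ P ⟶ _) ≫ biprod.inl + biprod.snd ≫ 𝟙 P ≫ biprod.inr = 𝟙 _ := by
      rw [Category.id_comp, biprod.total]
    have h3 : (biprod.fst : K' ⊞ P ⟶ _) ≫ biprod.inl + biprod.snd ≫ (0 : P ⟶ P) ≫ biprod.inr =
        biprod.fst ≫ biprod.inl := by
      rw [zero_comp, comp_zero, add_zero]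
    exact (Homotopy.ofEq h3.symm).trans (((Homotopy.refl _).add h1.symm).trans (Homotopy.ofEq h2))

variable {R : Type u} [CommRing R] {L : CochainComplex (ModuleCat.{u} R) ℤ} {lo hi : ℤ}
  (B : DualBases L lo hi)

theorem tensorMap_comp {K K' K'' : CochainComplex (ModuleCat.{u} R) ℤ} (φ : K ⟶ K') (ψ : K' ⟶ K'') :
    tensorMap L (φ ≫ ψ) = tensorMap L φ ≫ tensorMap L ψ :=
  (MonoidalCategory.tensorLeft L).map_comp φ ψ

theorem tensorMap_id (K : CochainComplex (ModuleCat.{u} R) ℤ) : tensorMap L (𝟙 K) = 𝟙 _ :=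
  (MonoidalCategory.tensorLeft L).map_id K

theorem tensorMap_zero {K K' : CochainComplex (ModuleCat.{u} R) ℤ} :
    tensorMap L (0 : K ⟶ K') = 0 := by
  refine HomologicalComplex.hom_ext _ _ fun q => tensorCx_ext fun i j h x y => ?_
  rw [tensorMap_ι]
  change tensorι L K' i j q h (x ⊗ₜ 0) = 0
  rw [TensorProduct.tmul_zero, map_zero]

theorem exactAt_iff_exists (K : CochainComplex (ModuleCat.{u} R) ℤ) {p q r : ℤ} (hp : p + 1 = q)
    (hr : q + 1 = r) : K.ExactAt q ↔
      ∀ y : K.X q, (K.d q r).hom y = 0 → ∃ x, (K.d p q).hom x = y := by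
  rw [K.exactAt_iff' p q r (by simp; omega) (by simp; omega), ShortComplex.moduleCat_exact_iff]
  rfl

include B

theorem DualBases.acyclic {K : CochainComplex (ModuleCat.{u} R) ℤ} (hK : K.Acyclic) :
    (tensorCx L K).Acyclic := by
  intro q
  rw [exactAt_iff_exists (tensorCx L K) (p := q - 1) (r := q + 1) (by omega) rfl]
  exact B.exists_eq_d (fun j j' hj => (exactAt_iff_exists K hj rfl).mp (hK j')) (by omega) rfl

/-- The dual bases split elements of L ⊗ K into finitely many elements of the terms of K, naturally
in K, so lifts are found coordinate by coordinate. -/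
theorem DualBases.shortExact {S : ShortComplex (CochainComplex (ModuleCat.{u} R) ℤ)}
    (hS : S.ShortExact) (h0 : tensorMap L S.f ≫ tensorMap L S.g = 0) :
    (ShortComplex.mk (tensorMap L S.f) (tensorMap L S.g) h0).ShortExact := by
  have nat {K K' : CochainComplex (ModuleCat.{u} R) ℤ} (φ : K ⟶ K') {i j q : ℤ} (h : i + j = q)
      (c : L.X i →ₗ[R] R) (z : (tensorCx L K).X q) :
      (tensorContr L K' c j q h).hom (((tensorMap L φ).f q).hom z) =
        (φ.f j).hom ((tensorContr L K c j q h).hom z) :=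
    ConcreteCategory.congr_hom (tensorContr_naturality L φ c j q h) z
  have nat' {K K' : CochainComplex (ModuleCat.{u} R) ℤ} (φ : K ⟶ K') {i j q : ℤ} (h : i + j = q)
      (b : L.X i) (y : K.X j) :
      (tensorIncl L K' b j q h).hom ((φ.f j).hom y) =
        ((tensorMap L φ).f q).hom ((tensorIncl L K b j q h).hom y) :=
    ConcreteCategory.congr_hom (tensorIncl_naturality L φ b j q h) y
  have hS' (q) := (HomologicalComplex.shortExact_iff_degreewise_shortExact S).mp hS q
  refine HomologicalComplex.shortExact_of_degreewise_shortExact _ fun q => ?_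
  refine ShortComplex.ShortExact.mk' ?_ ?_ ?_
  · rw [ShortComplex.moduleCat_exact_iff]
    intro (z : (tensorCx L S.X₂).X q) (hz : ((tensorMap L S.g).f q).hom z = 0)
    have h1 (i : ℤ) (l : Fin (B.rank i)) : ∃ y : S.X₁.X (q - i), (S.f.f (q - i)).hom y =
        (tensorContr L S.X₂ (B.coord i l) (q - i) q (by omega)).hom z := by
      refine (ShortComplex.moduleCat_exact_iff _).mp (hS' (q - i)).exact _ ?_
      refine (nat S.g _ _ _).symm.trans ?_
      rw [hz, map_zero]
      rfl
    choose y hy using h1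
    have h2 : ((tensorMap L S.f).f q).hom (∑ i ∈ Finset.Icc lo hi, ∑ l,
        (tensorIncl L S.X₁ (B.vec i l) (q - i) q (by omega)).hom (y i l)) = z := by
      rw [← B.sum_incl_contr S.X₂ q z, map_sum]
      refine Finset.sum_congr rfl fun i _ => ?_
      rw [map_sum]
      refine Finset.sum_congr rfl fun l _ => ?_
      rw [← nat', hy]
    exact ⟨_, h2⟩
  · refine (ModuleCat.mono_iff_injective _).mpr fun z z' h => B.tensor_ext S.X₁ fun i h' c => ?_
    refine (ModuleCat.mono_iff_injective _).mp (hS' (q - i)).mono_f ?_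
    refine (nat S.f _ _ _).symm.trans (Eq.trans ?_ (nat S.f _ _ _))
    exact congrArg _ h
  · refine (ModuleCat.epi_iff_surjective _).mpr fun (z : (tensorCx L S.X₃).X q) => ?_
    have h1 (i : ℤ) (l : Fin (B.rank i)) : ∃ y : S.X₂.X (q - i), (S.g.f (q - i)).hom y =
        (tensorContr L S.X₃ (B.coord i l) (q - i) q (by omega)).hom z :=
      (ModuleCat.epi_iff_surjective _).mp (hS' (q - i)).epi_g _
    choose y hy using h1
    have h2 : ((tensorMap L S.g).f q).hom (∑ i ∈ Finset.Icc lo hi, ∑ l,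
        (tensorIncl L S.X₂ (B.vec i l) (q - i) q (by omega)).hom (y i l)) = z := by
      rw [← B.sum_incl_contr S.X₃ q z, map_sum]
      refine Finset.sum_congr rfl fun i _ => ?_
      rw [map_sum]
      refine Finset.sum_congr rfl fun l _ => ?_
      rw [← nat', hy]
    exact ⟨_, h2⟩

/-- Factor φ as a monomorphism followed by a homotopy equivalence. Tensoring keeps homotopy
equivalences. The monomorphism is a quasi-isomorphism with acyclic cokernel, and both short
exactness and acyclicity survive tensoring. -/
theorem DualBases.quasiIso {K K' : CochainComplex (ModuleCat.{u} R) ℤ} (φ : K ⟶ K') [QuasiIso φ] :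
    QuasiIso (tensorMap L φ) := by
  obtain ⟨E, ψ, π, σ, hψ, hφ, hσ, ⟨h⟩⟩ := exists_mono_factorization φ
  have e : HomotopyEquiv E K' := ⟨π, σ, h, Homotopy.ofEq hσ⟩
  have hπ : QuasiIso π := (HomotopyEquiv.mk π σ h (Homotopy.ofEq hσ)).quasiIso_hom
  have hψ' : QuasiIso ψ := by
    rw [← quasiIso_iff_comp_right ψ π, hφ]
    infer_instance
  have hπ' : QuasiIso (tensorMap L π) := by
    refine (HomotopyEquiv.mk (tensorMap L π) (tensorMap L σ) ?_ (Homotopy.ofEq ?_)).quasiIso_hom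
    · refine (Homotopy.ofEq (tensorMap_comp π σ).symm).trans
        (Homotopy.trans ?_ (Homotopy.ofEq (tensorMap_id E)))
      exact HomologicalComplex.mapBifunctorMapHomotopy₂ _ h _ _
    · rw [← tensorMap_comp, hσ, tensorMap_id]
  let S := ShortComplex.mk ψ (cokernel.π ψ) (cokernel.condition ψ)
  have hS : S.ShortExact := { exact := ShortComplex.exact_cokernel ψ }
  have h0 : tensorMap L ψ ≫ tensorMap L (cokernel.π ψ) = 0 := by
    rw [← tensorMap_comp, cokernel.condition]
    exact tensorMap_zero
  have h3 : (cokernel ψ).Acyclic := hS.acyclic_X₃ hψ'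
  have h4 : QuasiIso (tensorMap L ψ) :=
    quasiIso_f_of_acyclic (B.shortExact hS h0) (B.acyclic h3) fun j => ⟨j - 1, by simp⟩
  rw [← hφ, tensorMap_comp]
  infer_instance

end QuasiIso


/-! ### The derived tensor product with L -/

section DerivedTensorProduct

open MonoidalCategory

variable {R : CommRingCat.{u}} [HasDerivedCategory.{w} (ModuleCat.{u} R)]
  {L : CochainComplex (ModuleCat.{u} R) ℤ} {lo hi : ℤ} (B : DualBases L lo hi)
/-- The canonical map from the derived tensor product to the tensor product. -/
noncomputable def derivedTensorCounit (L : CochainComplex (ModuleCat.{u} R) ℤ)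
    [HasDerivedTensor L] : DerivedCategory.Q ⋙ derivedTensor L ⟶ tensorComplex L :=
  (tensorComplex L).totalLeftDerivedCounit DerivedCategory.Q
    (HomologicalComplex.quasiIso (ModuleCat.{u} R) (ComplexShape.up ℤ))

instance (L : CochainComplex (ModuleCat.{u} R) ℤ) [HasDerivedTensor L] :
    (derivedTensor L).IsLeftDerivedFunctor (derivedTensorCounit L)
      (HomologicalComplex.quasiIso (ModuleCat.{u} R) (ComplexShape.up ℤ)) :=
  inferInstanceAs (((tensorComplex L).totalLeftDerived DerivedCategory.Q
      (HomologicalComplex.quasiIso (ModuleCat.{u} R)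
        (ComplexShape.up ℤ))).IsLeftDerivedFunctor
      ((tensorComplex L).totalLeftDerivedCounit _ _) _)

theorem toDerivedTensor_app_derivedTensorCounit [HasDerivedTensor L]
    (e : 𝟙_ (CochainComplex (ModuleCat.{u} R) ℤ) ⟶ L) (K : CochainComplex (ModuleCat.{u} R) ℤ) :
    (toDerivedTensor e).app (DerivedCategory.Q.obj K) ≫ (derivedTensorCounit L).app K =
      DerivedCategory.Q.map ((λ_ K).inv ≫ e ▷ K) :=
  Functor.leftDerived_fac_app (derivedTensor L) (derivedTensorCounit L)
    (HomologicalComplex.quasiIso (ModuleCat.{u} R) (ComplexShape.up ℤ)) _ _ _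

include B

theorem DualBases.isInvertedBy :
    (HomologicalComplex.quasiIso (ModuleCat.{u} R) (ComplexShape.up ℤ)).IsInvertedBy
      (tensorComplex L) := fun K K' φ hφ => by
  have : QuasiIso φ := hφ
  have : QuasiIso (tensorMap L φ) := B.quasiIso φ
  exact inferInstanceAs (IsIso (DerivedCategory.Q.map (tensorMap L φ)))

theorem DualBases.hasDerivedTensor : HasDerivedTensor L :=
  have := Functor.hasPointwiseLeftDerivedFunctor_of_inverts _ B.isInvertedBy
  inferInstance

/-- The counit from L ⊗ᴸ K to L ⊗ K is an isomorphism, so vanishing can be tested on the ordinary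
tensor product. -/
theorem DualBases.comp_toDerivedTensor_eq_zero [HasDerivedTensor L]
    (e : 𝟙_ (CochainComplex (ModuleCat.{u} R) ℤ) ⟶ L) {K : CochainComplex (ModuleCat.{u} R) ℤ}
    {X : DerivedCategory (ModuleCat.{u} R)} (g : X ⟶ DerivedCategory.Q.obj K)
    (h : g ≫ DerivedCategory.Q.map ((λ_ K).inv ≫ e ▷ K) = 0) :
    g ≫ (toDerivedTensor e).app (DerivedCategory.Q.obj K) = 0 := by
  have h1 : IsIso (derivedTensorCounit L) :=
    Functor.isIso_of_isLeftDerivedFunctor_of_inverts (derivedTensor L) _ B.isInvertedBy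
  have h2 : IsIso ((derivedTensorCounit L).app K) := inferInstance
  refine (cancel_mono ((derivedTensorCounit L).app K)).mp ?_
  rw [zero_comp, Category.assoc]
  exact (congrArg (g ≫ ·) (toDerivedTensor_app_derivedTensorCounit e K)).trans h

end DerivedTensorProduct


/-! ### Retracts of finite families -/

section Retracts

/-- The hypothesis says that P is a retract of the direct sum of the E_a; extensions are found in
each E_a and added. -/
theorem injective_of_sum_eq_id {C : Type*} [Category C] [Preadditive C] {P : C} {S : Type*}
    [Fintype S] (E : S → C) [∀ a, Injective (E a)] (r : ∀ a, P ⟶ E a) (s : ∀ a, E a ⟶ P)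
    (h : ∑ a, r a ≫ s a = 𝟙 P) : Injective P where
  factors {A B} g m hm := by
    refine ⟨∑ a, Injective.factorThru (g ≫ r a) m ≫ s a, ?_⟩
    rw [Preadditive.comp_sum]
    have h1 (a : S) : m ≫ Injective.factorThru (g ≫ r a) m ≫ s a = g ≫ r a ≫ s a := by
      rw [← Category.assoc, Injective.comp_factorThru, Category.assoc]
    rw [Finset.sum_congr rfl fun a _ => h1 a, ← Preadditive.comp_sum, h, Category.comp_id]

/-- A retract of a finite sum of sheaves: the coordinates are glued, and uniqueness is also seen on
coordinates. -/
theorem isSheaf_of_sum_eq_id {R : Type u} [CommRing R] {X : TopCat.{u}}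
    (P : TopCat.Presheaf (ModuleCat.{u} R) X) {S : Type*} [Fintype S]
    (E : S → TopCat.Sheaf (ModuleCat.{u} R) X) (r : ∀ a, P ⟶ (E a).obj) (s : ∀ a, (E a).obj ⟶ P)
    (h : ∀ V (x : P.obj V), ∑ a, ((s a).app V).hom (((r a).app V).hom x) = x) : P.IsSheaf := by
  have nat {P P' : TopCat.Presheaf (ModuleCat.{u} R) X} (t : P ⟶ P') {V W : TopologicalSpace.Opens X}
      (i : W ⟶ V) (x : P.obj (.op V)) :
      (t.app (.op W)).hom ((P.map i.op).hom x) = (P'.map i.op).hom ((t.app (.op V)).hom x) :=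
    ConcreteCategory.congr_hom (t.naturality i.op) x
  rw [TopCat.Presheaf.isSheaf_iff_isSheafUniqueGluing]
  intro ι U x hx
  have h1 (a : S) := TopCat.Sheaf.existsUnique_gluing (E a) U
    (fun i => ((r a).app (.op (U i))).hom (x i)) fun i j => by
      refine (nat (r a) _ _).symm.trans (Eq.trans ?_ (nat (r a) _ _))
      exact congrArg ((r a).app _).hom (hx i j)
  choose y hy hy' using h1
  refine ⟨∑ a, ((s a).app (.op (iSup U))).hom (y a), fun i => ?_, fun z hz => ?_⟩
  · refine (map_sum (P.map _).hom _ _).trans ?_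
    refine Eq.trans (Finset.sum_congr rfl fun a _ => ?_) (h _ (x i))
    refine (nat (s a) _ _).symm.trans ?_
    exact congrArg ((s a).app _).hom (hy a i)
  · refine (h _ z).symm.trans (Finset.sum_congr rfl fun a _ => ?_)
    refine congrArg ((s a).app _).hom (hy' a _ fun i => ?_)
    refine (nat (r a) _ _).symm.trans ?_
    exact congrArg ((r a).app _).hom (hz i)

end Retracts

/-! ### The complex of sheaves L ⊗ I -/

section SheafTensor

variable {R : Type u} [CommRing R] {X : TopCat.{u}} (I : CochainComplex (TopCat.Sheaf (ModuleCat.{u} R) X) ℤ)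

/-- The sections of a sheaf of modules over an open subset. -/
noncomputable abbrev sheafSections (V : TopologicalSpace.Opens X) :
    TopCat.Sheaf (ModuleCat.{u} R) X ⥤ ModuleCat.{u} R :=
  TopCat.Sheaf.forget _ _ ⋙ (CategoryTheory.evaluation _ _).obj (.op V)

instance (V : TopologicalSpace.Opens X) : (sheafSections (R := R) V).Additive where
  map_add := rfl

/-- The complexes of sections of a complex of sheaves. -/
noncomputable def sectionsCx : (TopologicalSpace.Opens X)ᵒᵖ ⥤ CochainComplex (ModuleCat.{u} R) ℤ where
  obj V :=
    { X q := (I.X q).obj.obj V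
      d p q := (I.d p q).hom.app V
      shape p q h := by
        rw [I.shape p q h]
        rfl
      d_comp_d' p q r _ _ := by
        have := I.d_comp_d p q r
        exact congrArg (fun t => t.hom.app V) this }
  map i :=
    { f q := (I.X q).obj.map i
      comm' p q _ := (I.d p q).hom.naturality i }
  map_id V := by
    ext q : 1
    exact (I.X q).obj.map_id V
  map_comp i j := by
    ext q : 1
    exact (I.X q).obj.map_comp i j

variable {L : CochainComplex (ModuleCat.{u} R) ℤ} {lo hi : ℤ}

variable (L) in
/-- The presheaf `V ↦ (L ⊗ I(V))^q`. -/
noncomputable def tensorPresheaf (q : ℤ) : TopCat.Presheaf (ModuleCat.{u} R) X :=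
  sectionsCx I ⋙ MonoidalCategory.tensorLeft L ⋙ HomologicalComplex.eval _ _ q

/-- The inclusion `y ↦ b ⊗ y` of presheaves. -/
noncomputable def presheafIncl {i : ℤ} (b : L.X i) (j q : ℤ) (h : i + j = q) :
    (I.X j).obj ⟶ tensorPresheaf I L q where
  app V := tensorIncl L ((sectionsCx I).obj V) b j q h
  naturality _ _ t := tensorIncl_naturality L ((sectionsCx I).map t) b j q h

/-- The contraction `b ⊗ y ↦ c(b) y` of presheaves. -/
noncomputable def presheafContr {i : ℤ} (c : L.X i →ₗ[R] R) (j q : ℤ) (h : i + j = q) :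
    tensorPresheaf I L q ⟶ (I.X j).obj where
  app V := tensorContr L ((sectionsCx I).obj V) c j q h
  naturality _ _ t := tensorContr_naturality L ((sectionsCx I).map t) c j q h

theorem DualBases.sum_presheafIncl_presheafContr (B : DualBases L lo hi) (q : ℤ)
    (V : (TopologicalSpace.Opens X)ᵒᵖ) (z : (tensorPresheaf I L q).obj V) :
    ∑ a : Σ i : Finset.Icc lo hi, Fin (B.rank i),
      ((presheafIncl I (B.vec a.1 a.2) (q - a.1) q (by omega)).app V).hom
        (((presheafContr I (B.coord a.1 a.2) (q - a.1) q (by omega)).app V).hom z) = z := by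
  refine Eq.trans ?_ (B.sum_incl_contr ((sectionsCx I).obj V) q z)
  rw [Fintype.sum_sigma]
  exact Finset.sum_coe_sort (Finset.Icc lo hi) fun i => ∑ l,
    (tensorIncl L ((sectionsCx I).obj V) (B.vec i l) (q - i) q (by omega)).hom
      ((tensorContr L ((sectionsCx I).obj V) (B.coord i l) (q - i) q (by omega)).hom z)

/-- Because of the dual bases no sheafification is needed, and the sections of L ⊗ I over V are
exactly L ⊗ I(V). This is what identifies Γ(L ⊗ I) with L ⊗ Γ(I). -/
theorem DualBases.isSheaf_tensorPresheaf (B : DualBases L lo hi) (q : ℤ) :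
    (tensorPresheaf I L q).IsSheaf :=
  isSheaf_of_sum_eq_id _ (fun a : Σ i : Finset.Icc lo hi, Fin (B.rank i) => I.X (q - a.1))
    (fun a => presheafContr I (B.coord a.1 a.2) (q - a.1) q (by omega))
    (fun a => presheafIncl I (B.vec a.1 a.2) (q - a.1) q (by omega))
    (B.sum_presheafIncl_presheafContr I q)

/-- The complex of sheaves `V ↦ L ⊗ I(V)`. -/
noncomputable def DualBases.tensorSheafCx (B : DualBases L lo hi) :
    CochainComplex (TopCat.Sheaf (ModuleCat.{u} R) X) ℤ where
  X q := ⟨tensorPresheaf I L q, B.isSheaf_tensorPresheaf I q⟩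
  d p q := ⟨{ app V := (tensorCx L ((sectionsCx I).obj V)).d p q
              naturality V W t := (tensorMap L ((sectionsCx I).map t)).comm p q }⟩
  shape p q h := by
    refine ObjectProperty.hom_ext _ (NatTrans.ext (funext fun V => ?_))
    exact (tensorCx L ((sectionsCx I).obj _)).shape p q h
  d_comp_d' p q r _ _ := by
    refine ObjectProperty.hom_ext _ (NatTrans.ext (funext fun V => ?_))
    exact (tensorCx L ((sectionsCx I).obj _)).d_comp_d p q r

/-- The inclusion `y ↦ b ⊗ y` of sheaves. -/
noncomputable def DualBases.sheafIncl (B : DualBases L lo hi) {i : ℤ} (b : L.X i) (j q : ℤ)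
    (h : i + j = q) : I.X j ⟶ (B.tensorSheafCx I).X q :=
  ObjectProperty.homMk (presheafIncl I b j q h)

/-- The contraction `b ⊗ y ↦ c(b) y` of sheaves. -/
noncomputable def DualBases.sheafContr (B : DualBases L lo hi) {i : ℤ} (c : L.X i →ₗ[R] R) (j q : ℤ)
    (h : i + j = q) : (B.tensorSheafCx I).X q ⟶ I.X j :=
  ObjectProperty.homMk (presheafContr I c j q h)

theorem DualBases.sum_contr_comp_incl (B : DualBases L lo hi) (q : ℤ) :
    ∑ a : Σ i : Finset.Icc lo hi, Fin (B.rank i),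
      B.sheafContr I (B.coord a.1 a.2) (q - a.1) q (by omega) ≫
        B.sheafIncl I (B.vec a.1 a.2) (q - a.1) q (by omega) = 𝟙 _ := by
  refine ObjectProperty.hom_ext _ (NatTrans.ext (funext fun V => ?_))
  refine ((sheafSections V.unop).map_sum _ _).trans ?_
  refine ModuleCat.hom_ext (LinearMap.ext fun z => ?_)
  refine Eq.trans ?_ (B.sum_presheafIncl_presheafContr I q V z)
  rw [ModuleCat.hom_sum, LinearMap.sum_apply]
  rfl

theorem DualBases.injective_tensorSheafCx (B : DualBases L lo hi) (hI : ∀ q, Injective (I.X q))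
    (q : ℤ) : Injective ((B.tensorSheafCx I).X q) :=
  injective_of_sum_eq_id
    (fun a : Σ i : Finset.Icc lo hi, Fin (B.rank i) => I.X (q - a.1)) _ _ (B.sum_contr_comp_incl I q)

theorem DualBases.isStrictlyGE_tensorSheafCx (B : DualBases L lo hi) (m : ℤ) [I.IsStrictlyGE m] :
    (B.tensorSheafCx I).IsStrictlyGE (lo + m) := by
  rw [CochainComplex.isStrictlyGE_iff]
  intro q hq
  rw [IsZero.iff_id_eq_zero, ← B.sum_contr_comp_incl I q]
  refine Finset.sum_eq_zero fun a _ => ?_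
  have h : IsZero (I.X (q - a.1)) := I.isZero_of_isStrictlyGE m _ (by
    have := Finset.mem_Icc.mp a.1.2
    omega)
  rw [h.eq_of_tgt (B.sheafContr I _ _ _ _) 0, zero_comp]

end SheafTensor


/-! ### The map I → L ⊗ I given by R → L -/

section UnitElement

variable {R : Type u} [CommRing R] {L : CochainComplex (ModuleCat.{u} R) ℤ}
  (e : (HomologicalComplex.single (ModuleCat.{u} R) (ComplexShape.up ℤ) 0).obj
    (ModuleCat.of R R) ⟶ L)

/-- The image of `1` under `R → L`. -/
noncomputable def unitElement : L.X 0 :=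
  ((HomologicalComplex.singleObjXSelf (ComplexShape.up ℤ) 0 (ModuleCat.of R R)).inv ≫ e.f 0).hom 1

theorem d_unitElement (r : ℤ) : (L.d 0 r).hom (unitElement e) = 0 := by
  have h : ((HomologicalComplex.singleObjXSelf (ComplexShape.up ℤ) 0 (ModuleCat.of R R)).inv ≫
      e.f 0) ≫ L.d 0 r = 0 := by
    rw [Category.assoc, e.comm, HomologicalComplex.single_obj_d, zero_comp, comp_zero]
  exact LinearMap.congr_fun (congrArg ModuleCat.Hom.hom h) (1 : R)

open MonoidalCategory in
-- Makes the canonical map K ≅ R ⊗ K → L ⊗ K explicit as y ↦ e(1) ⊗ y.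
theorem leftUnitor_inv_whiskerRight_f (K : CochainComplex (ModuleCat.{u} R) ℤ) (q : ℤ) :
    ((λ_ K).inv ≫ (show 𝟙_ (CochainComplex (ModuleCat.{u} R) ℤ) ⟶ L from e) ▷ K).f q =
      tensorIncl L K (unitElement e) q q (zero_add q) := by
  have h1 : (λ_ K).inv.f q = (HomologicalComplex.leftUnitor' K).inv q := rfl
  have h2 := HomologicalComplex.ι_mapBifunctorMap e (𝟙 K) (MonoidalCategory.curriedTensor _)
    (ComplexShape.up ℤ) 0 q q (zero_add q)
  refine ModuleCat.hom_ext (LinearMap.ext fun y => ?_)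
  change ((e ▷ K).f q).hom (((λ_ K).inv.f q).hom y) = _
  rw [h1, HomologicalComplex.leftUnitor'_inv]
  exact LinearMap.congr_fun (congrArg ModuleCat.Hom.hom h2)
    ((HomologicalComplex.singleObjXSelf (ComplexShape.up ℤ) 0 (ModuleCat.of R R)).inv.hom 1 ⊗ₜ y)

end UnitElement

section InclLinear

variable {R : Type u} [CommRing R] {L : CochainComplex (ModuleCat.{u} R) ℤ}
  (K : CochainComplex (ModuleCat.{u} R) ℤ)

theorem tensorIncl_smul (r : R) {i : ℤ} (b : L.X i) (j q : ℤ) (h : i + j = q) (y : K.X j) :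
    (tensorIncl L K (r • b) j q h).hom y = (tensorIncl L K b j q h).hom (r • y) := by
  change tensorι L K i j q h ((r • b) ⊗ₜ y) = tensorι L K i j q h (b ⊗ₜ (r • y))
  rw [TensorProduct.smul_tmul]

theorem tensorIncl_zero {i : ℤ} (j q : ℤ) (h : i + j = q) (y : K.X j) :
    (tensorIncl L K (0 : L.X i) j q h).hom y = 0 := by
  change tensorι L K i j q h (0 ⊗ₜ y) = 0
  rw [TensorProduct.zero_tmul, map_zero]

theorem tensorIncl_add {i : ℤ} (b b' : L.X i) (j q : ℤ) (h : i + j = q) (y : K.X j) :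
    (tensorIncl L K (b + b') j q h).hom y =
      (tensorIncl L K b j q h).hom y + (tensorIncl L K b' j q h).hom y := by
  change tensorι L K i j q h ((b + b') ⊗ₜ y) =
    tensorι L K i j q h (b ⊗ₜ y) + tensorι L K i j q h (b' ⊗ₜ y)
  rw [TensorProduct.add_tmul, map_add]

end InclLinear

/-! ### Comparison of L ⊗ 𝒪 with L ⊗ I -/

section Comparison

variable {R : Type u} [CommRing R] {X : TopCat.{u}}

theorem sheaf_hom_ext {F G : TopCat.Sheaf (ModuleCat.{u} R) X} {φ ψ : F ⟶ G}
    (h : ∀ V (x : F.obj.obj V), (φ.hom.app V).hom x = (ψ.hom.app V).hom x) : φ = ψ :=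
  ObjectProperty.hom_ext _ (NatTrans.ext (funext fun V =>
    ModuleCat.hom_ext (LinearMap.ext (h V))))

/-- Multiplication by `r ∈ R` on a sheaf of `R`-modules. -/
noncomputable def sheafSMul (r : R) (F : TopCat.Sheaf (ModuleCat.{u} R) X) : F ⟶ F :=
  ObjectProperty.homMk
    { app V := ModuleCat.ofHom (LinearMap.lsmul R (F.obj.obj V) r)
      naturality _ _ i := ModuleCat.hom_ext (LinearMap.ext fun x =>
        ((F.obj.map i).hom.map_smul r x).symm) }

theorem sheafSMul_naturality (r : R) {F G : TopCat.Sheaf (ModuleCat.{u} R) X} (φ : F ⟶ G) :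
    sheafSMul r F ≫ φ = φ ≫ sheafSMul r G :=
  sheaf_hom_ext fun V x => (φ.hom.app V).hom.map_smul r x

variable (I : CochainComplex (TopCat.Sheaf (ModuleCat.{u} R) X) ℤ)
  {L : CochainComplex (ModuleCat.{u} R) ℤ} {lo hi : ℤ} (B : DualBases L lo hi)

theorem DualBases.sheafIncl_smul (r : R) {i : ℤ} (b : L.X i) (j q : ℤ) (h : i + j = q) :
    B.sheafIncl I (r • b) j q h = sheafSMul r _ ≫ B.sheafIncl I b j q h := by
  refine sheaf_hom_ext fun V y => ?_
  exact tensorIncl_smul ((sectionsCx I).obj V) r b j q h y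

theorem DualBases.sheafIncl_sum {S : Type*} (s : Finset S) {i : ℤ} (b : S → L.X i) (j q : ℤ)
    (h : i + j = q) : B.sheafIncl I (∑ a ∈ s, b a) j q h = ∑ a ∈ s, B.sheafIncl I (b a) j q h := by
  let F : L.X i →+ ((I.X j) ⟶ (B.tensorSheafCx I).X q) :=
    { toFun b := B.sheafIncl I b j q h
      map_zero' := sheaf_hom_ext fun V y => tensorIncl_zero ((sectionsCx I).obj V) j q h y
      map_add' b b' := sheaf_hom_ext fun V y => tensorIncl_add ((sectionsCx I).obj V) b b' j q h y }
  exact map_sum F b s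

theorem DualBases.sheafIncl_d {i i' j j' q q' : ℤ} (hi : i + 1 = i') (hj : j + 1 = j')
    (h : i + j = q) (h' : i' + j = q') (h'' : i + j' = q') (b : L.X i) :
    B.sheafIncl I b j q h ≫ (B.tensorSheafCx I).d q q' =
      B.sheafIncl I ((L.d i i').hom b) j q' h' +
        i.negOnePow • (I.d j j' ≫ B.sheafIncl I b j' q' h'') := by
  refine sheaf_hom_ext fun V y => ?_
  refine (tensorIncl_d L ((sectionsCx I).obj V) hi hj h h' h'' b y).trans ?_
  rcases Int.even_or_odd i with he | ho
  · rw [Int.negOnePow_even _ he, one_smul, one_smul]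
    rfl
  · rw [Int.negOnePow_odd _ ho, Units.neg_smul, Units.neg_smul, one_smul, one_smul]
    rfl

/-- The map `I → L ⊗ I` given by a map `R → L`. -/
noncomputable def DualBases.sheafUnit
    (e : (HomologicalComplex.single (ModuleCat.{u} R) (ComplexShape.up ℤ) 0).obj
      (ModuleCat.of R R) ⟶ L) : I ⟶ B.tensorSheafCx I where
  f q := B.sheafIncl I (unitElement e) q q (zero_add q)
  comm' q q' hq := by
    have h := B.sheafIncl_d I (i := 0) (i' := 1) (zero_add 1) hq (zero_add q)
      (by change q + 1 = q' at hq; omega) (zero_add q') (unitElement e)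
    rw [h, d_unitElement, Int.negOnePow_zero, one_smul]
    -- The inclusion attached to the vector 0 is zero, being an empty sum.
    have h0 := B.sheafIncl_sum I (∅ : Finset ℕ) (i := 1) (fun _ => 0) q q'
      (by change q + 1 = q' at hq; omega)
    rw [Finset.sum_empty, Finset.sum_empty] at h0
    rw [h0, zero_add]

variable (T : ModuleCat.{u} R ⥤ TopCat.Sheaf (ModuleCat.{u} R) X) [T.Additive]
  (φ : T.obj (ModuleCat.of R R) ⟶ I.X 0)
  (hφ : ∀ r : R, T.map (r • 𝟙 (ModuleCat.of R R)) ≫ φ = φ ≫ sheafSMul r _)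

/-- The map `T(L^q) → (L ⊗ I)^q` given by a map `T(R) → I⁰`. -/
noncomputable def DualBases.comparisonApp (q : ℤ) : T.obj (L.X q) ⟶ (B.tensorSheafCx I).X q :=
  ∑ l, T.map (ModuleCat.ofHom (B.coord q l)) ≫ φ ≫ B.sheafIncl I (B.vec q l) 0 q (add_zero q)

-- Shows that the comparison does not depend on the dual bases: on the copy of R spanned by b it is
-- φ followed by y ↦ b ⊗ y.
include hφ in
omit [T.Additive] in
theorem DualBases.map_comparisonApp {q : ℤ} (b : L.X q) :
    T.map (ModuleCat.ofHom (LinearMap.toSpanSingleton R (L.X q) b)) ≫ B.comparisonApp I T φ q =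
      φ ≫ B.sheafIncl I b 0 q (add_zero q) := by
  have h1 (l) : T.map (ModuleCat.ofHom (LinearMap.toSpanSingleton R (L.X q) b)) ≫
      T.map (ModuleCat.ofHom (B.coord q l)) ≫ φ ≫ B.sheafIncl I (B.vec q l) 0 q (add_zero q) =
      φ ≫ B.sheafIncl I (B.coord q l b • B.vec q l) 0 q (add_zero q) := by
    have h2 : ModuleCat.ofHom (LinearMap.toSpanSingleton R (L.X q) b) ≫
        ModuleCat.ofHom (B.coord q l) = B.coord q l b • 𝟙 (ModuleCat.of R R) := by
      ext
      change B.coord q l ((1 : R) • b) = B.coord q l b • (1 : R)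
      rw [one_smul, smul_eq_mul, mul_one]
    rw [← Category.assoc, ← T.map_comp, h2, ← Category.assoc, hφ, Category.assoc, B.sheafIncl_smul]
  refine (Preadditive.comp_sum _ _ _).trans ?_
  rw [Finset.sum_congr rfl fun l _ => h1 l, ← Preadditive.comp_sum, ← B.sheafIncl_sum,
    B.sum_coord_smul_vec]

/-- The map `T(L) → L ⊗ I` given by a map `T(R) → I⁰`. -/
noncomputable def DualBases.comparison (h0 : φ ≫ I.d 0 1 = 0) :
    (T.mapHomologicalComplex (ComplexShape.up ℤ)).obj L ⟶ B.tensorSheafCx I where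
  f q := B.comparisonApp I T φ q
  comm' q q' hq := by
    change B.comparisonApp I T φ q ≫ (B.tensorSheafCx I).d q q' =
      T.map (L.d q q') ≫ B.comparisonApp I T φ q'
    have h1 (l) : (T.map (ModuleCat.ofHom (B.coord q l)) ≫ φ ≫
        B.sheafIncl I (B.vec q l) 0 q (add_zero q)) ≫ (B.tensorSheafCx I).d q q' =
        T.map (ModuleCat.ofHom (B.coord q l) ≫ ModuleCat.ofHom (LinearMap.toSpanSingleton R (L.X q')
          ((L.d q q').hom (B.vec q l)))) ≫ B.comparisonApp I T φ q' := by
      have h2 := B.sheafIncl_d I (j := 0) (j' := 1) hq (zero_add 1) (add_zero q) (add_zero q') hq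
        (B.vec q l)
      -- The other Leibniz term vanishes, since φ has values in the cycles of I⁰.
      have h3 : φ ≫ (q.negOnePow • (I.d 0 1 ≫ B.sheafIncl I (B.vec q l) 1 q' hq)) = 0 := by
        rw [Linear.comp_units_smul, ← Category.assoc, h0, zero_comp, smul_zero]
      rw [T.map_comp]
      simp only [Category.assoc]
      rw [B.map_comparisonApp I T φ hφ, h2, Preadditive.comp_add, h3, add_zero]
    have h4 : ∑ l, ModuleCat.ofHom (B.coord q l) ≫ ModuleCat.ofHom (LinearMap.toSpanSingleton R
        (L.X q') ((L.d q q').hom (B.vec q l))) = L.d q q' := by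
      refine ModuleCat.hom_ext (LinearMap.ext fun x => ?_)
      rw [ModuleCat.hom_sum, LinearMap.sum_apply]
      conv_rhs => rw [← B.sum_coord_smul_vec q x, map_sum]
      refine Finset.sum_congr rfl fun l _ => ?_
      exact ((L.d q q').hom.map_smul _ _).symm
    refine (Preadditive.sum_comp _ _ _).trans ?_
    rw [Finset.sum_congr rfl fun l _ => h1 l, ← Preadditive.sum_comp, ← T.map_sum, h4]

-- In degree 0 both composites send a section s of F to e(1) ⊗ φ(j(s)).
include hφ in
theorem DualBases.singleMap_comparison (h0 : φ ≫ I.d 0 1 = 0)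
    (e : (HomologicalComplex.single (ModuleCat.{u} R) (ComplexShape.up ℤ) 0).obj
      (ModuleCat.of R R) ⟶ L) {F : TopCat.Sheaf (ModuleCat.{u} R) X}
    (j : F ⟶ T.obj (ModuleCat.of R R))
    (β : (HomologicalComplex.single _ (ComplexShape.up ℤ) 0).obj F ⟶ I)
    (hβ : (HomologicalComplex.singleObjXSelf (ComplexShape.up ℤ) 0 F).inv ≫ β.f 0 = j ≫ φ) :
    singleMap T e j ≫ B.comparison I T φ hφ h0 = β ≫ B.sheafUnit I e := by
  refine HomologicalComplex.from_single_hom_ext ?_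
  refine (cancel_epi (HomologicalComplex.singleObjXSelf (ComplexShape.up ℤ) 0 F).inv).mp ?_
  have h1 := singleMap_f_zero T e j
  have h2 : (HomologicalComplex.singleObjXSelf (ComplexShape.up ℤ) 0 (ModuleCat.of R R)).inv ≫
      e.f 0 = ModuleCat.ofHom (LinearMap.toSpanSingleton R (L.X 0) (unitElement e)) := by
    refine ModuleCat.hom_ext (LinearMap.ext_ring ?_)
    exact (one_smul R _).symm
  have h3 : (HomologicalComplex.singleObjXSelf (ComplexShape.up ℤ) 0 F).inv ≫
      (singleMap T e j).f 0 ≫ B.comparisonApp I T φ 0 =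
      (HomologicalComplex.singleObjXSelf (ComplexShape.up ℤ) 0 F).inv ≫ β.f 0 ≫
        B.sheafIncl I (unitElement e) 0 0 (zero_add 0) := by
    have h4 := B.map_comparisonApp I T φ hφ (unitElement e)
    rw [← h2] at h4
    refine (Category.assoc _ _ _).symm.trans ((congrArg (· ≫ _) h1).trans ?_)
    refine (Category.assoc _ _ _).trans ((congrArg (j ≫ ·) h4).trans ?_)
    refine (Category.assoc _ _ _).symm.trans ((congrArg (· ≫ _) hβ.symm).trans (Category.assoc _ _ _))
  exact h3

end Comparison


/-! ### Tensoring modules with a sheaf of R-modules -/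

section TensorSheaf

open MonoidalCategory

variable {R : Type u} [CommRing R] {X : TopCat.{u}} (O : TopCat.Sheaf (ModuleCat.{u} R) X)

/-- The functor which sends `M` to the presheaf `V ↦ M ⊗ O(V)`. -/
noncomputable def presheafTwist :
    ModuleCat.{u} R ⥤ ((TopologicalSpace.Opens X)ᵒᵖ ⥤ ModuleCat.{u} R) :=
  curriedTensor (ModuleCat.{u} R) ⋙ (Functor.whiskeringLeft _ _ _).obj O.obj

instance : (presheafTwist O).Additive where
  map_add {M N φ ψ} := by
    refine NatTrans.ext (funext fun V => ?_)
    exact MonoidalPreadditive.add_whiskerRight (C := ModuleCat.{u} R) (X := O.obj.obj V) φ ψ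

instance : (presheafTwist O).PreservesEpimorphisms where
  preserves {M N} φ hφ := by
    have : ∀ V, Epi (((presheafTwist O).map φ).app V) := fun V =>
      (ModuleCat.epi_iff_surjective _).mpr
        (LinearMap.rTensor_surjective (O.obj.obj V) ((ModuleCat.epi_iff_surjective φ).mp hφ))
    exact NatTrans.epi_of_epi_app _

/-- The functor which sends `M` to the sheaf associated with `V ↦ M ⊗ O(V)`. -/
noncomputable def sheafTwist : ModuleCat.{u} R ⥤ TopCat.Sheaf (ModuleCat.{u} R) X :=
  presheafTwist O ⋙ presheafToSheaf (Opens.grothendieckTopology X) (ModuleCat.{u} R)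

instance : (sheafTwist O).Additive :=
  inferInstanceAs (presheafTwist O ⋙ presheafToSheaf (Opens.grothendieckTopology X) _).Additive

instance : (sheafTwist O).PreservesEpimorphisms :=
  inferInstanceAs (presheafTwist O ⋙ presheafToSheaf (Opens.grothendieckTopology X) _).PreservesEpimorphisms

/-- The isomorphism `R ⊗ O(V) ≅ O(V)`. -/
noncomputable def presheafTwistSelf : (presheafTwist O).obj (ModuleCat.of R R) ≅ O.obj :=
  NatIso.ofComponents (fun V => λ_ (O.obj.obj V)) fun i => leftUnitor_naturality (O.obj.map i)

/-- The isomorphism `R ⊗ O ≅ O`. -/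
noncomputable def sheafTwistSelf : (sheafTwist O).obj (ModuleCat.of R R) ≅ O :=
  (presheafToSheaf (Opens.grothendieckTopology X) (ModuleCat.{u} R)).mapIso (presheafTwistSelf O) ≪≫
    @asIso _ _ _ _
      ((sheafificationAdjunction (Opens.grothendieckTopology X) (ModuleCat.{u} R)).counit.app O)
      (isIso_sheafificationAdjunction_counit O)

theorem presheafTwist_map_smul (r : R) :
    (presheafTwist O).map (r • 𝟙 (ModuleCat.of R R)) ≫ (presheafTwistSelf O).hom =
      (presheafTwistSelf O).hom ≫ (sheafSMul r O).hom := by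
  refine NatTrans.ext (funext fun V => ?_)
  refine ModuleCat.hom_ext (TensorProduct.ext' fun a y => ?_)
  exact mul_smul r a y

theorem sheafTwist_map_smul (r : R) :
    (sheafTwist O).map (r • 𝟙 (ModuleCat.of R R)) ≫ (sheafTwistSelf O).hom =
      (sheafTwistSelf O).hom ≫ sheafSMul r O := by
  let F := presheafToSheaf (Opens.grothendieckTopology X) (ModuleCat.{u} R)
  let adj := sheafificationAdjunction (Opens.grothendieckTopology X) (ModuleCat.{u} R)
  have h1 := congrArg F.map (presheafTwist_map_smul O r)
  rw [F.map_comp, F.map_comp] at h1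
  have h2 : F.map (sheafSMul r O).hom ≫ adj.counit.app O = adj.counit.app O ≫ sheafSMul r O :=
    adj.counit.naturality (sheafSMul r O)
  have h3 : (sheafTwistSelf O).hom = F.map (presheafTwistSelf O).hom ≫ adj.counit.app O := rfl
  rw [h3]
  refine (Category.assoc _ _ _).symm.trans ((congrArg (· ≫ adj.counit.app O) h1).trans ?_)
  refine (Category.assoc _ _ _).trans ((congrArg (F.map (presheafTwistSelf O).hom ≫ ·) h2).trans ?_)
  exact (Category.assoc _ _ _).symm

/-- The sections of a sheaf of modules, as an abelian group. -/
noncomputable abbrev sheafSectionsAb (V : TopologicalSpace.Opens X) :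
    TopCat.Sheaf (ModuleCat.{u} R) X ⥤ AddCommGrpCat.{u} :=
  sheafSections V ⋙ forget₂ (ModuleCat.{u} R) AddCommGrpCat.{u}

instance (V : TopologicalSpace.Opens X) :
    PreservesFiniteLimits (sheafSectionsAb (R := R) V) := by
  have h1 : PreservesFiniteLimits (TopCat.Sheaf.forget (ModuleCat.{u} R) X) :=
    inferInstanceAs (PreservesFiniteLimits (sheafToPresheaf _ _))
  have h2 : PreservesFiniteLimits (sheafSections (R := R) V) := by
    have : PreservesFiniteLimits ((CategoryTheory.evaluation (TopologicalSpace.Opens X)ᵒᵖ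
      (ModuleCat.{u} R)).obj (.op V)) := inferInstance
    exact comp_preservesFiniteLimits _ _
  exact comp_preservesFiniteLimits _ _

end TensorSheaf

/-! ### The factorization in sheaves of R-modules -/

section RModules

variable {R : CommRingCat.{u}} {Y : Scheme.{u}} (p : Y ⟶ Spec R) {n : ℕ}

/-- The structure sheaf as a sheaf of `R`-modules. -/
noncomputable abbrev structureSheafR : TopCat.Sheaf (ModuleCat.{u} R) Y :=
  (toSheafOfRModules p).obj (structureSheaf Y)

theorem structureSheafR_smul (V : Y.Opens) (r : R) (s : Γ(Y, V)) :
    (r • (show (structureSheafR p).obj.obj (.op V) from s) : (structureSheafR p).obj.obj (.op V)) =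
      (toSections p V r * s : Γ(Y, V)) := by
  have h : toSections p V r = Y.presheaf.map (homOfLE le_top).op (toGlobalSections p r) :=
    (toSections_map p (homOfLE le_top) r).symm
  rw [h]
  rfl

theorem eq_zero_of_locally_eq_zero {X : TopCat.{u}} {R : Type u} [CommRing R]
    (W : TopCat.Sheaf (ModuleCat.{u} R) X)
    (V : TopologicalSpace.Opens X) (x : W.obj.obj (.op V))
    (hx : ∀ y ∈ V, ∃ (V' : TopologicalSpace.Opens X) (h : V' ≤ V), y ∈ V' ∧
      (W.obj.map (homOfLE h).op).hom x = 0) : x = 0 := by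
  choose W' hW' hyW' hs using hx
  refine TopCat.Sheaf.eq_of_locally_eq' W (fun y : V => W' y.1 y.2) V
    (fun y => homOfLE (hW' y.1 y.2)) (fun y hy => ?_) _ _ fun y => ?_
  · exact TopologicalSpace.Opens.mem_iSup.mpr ⟨⟨y, hy⟩, hyW' y hy⟩
  · exact (hs y.1 y.2).trans (map_zero (W.obj.map _).hom).symm

theorem IsChartCover.isChartFamily_sheafTwist {f : Fin n → R} {U : Fin n → Y.Opens}
    (hU : IsChartCover p f U) :
    IsChartFamily f (sheafTwist (structureSheafR p))
      (fun t : Σ a, { V : Y.Opens // V ≤ U a } => sheafSectionsAb (R := R) (X := Y) t.2.1)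
      (fun t => t.1) where
  eq_zero {F G} h H := by
    refine sheaf_hom_ext fun V x => ?_
    refine eq_zero_of_locally_eq_zero G V.unop _ fun y hy => ?_
    have hy' : y ∈ ⨆ a, U a := by
      rw [hU.iSup_eq_top]
      trivial
    obtain ⟨a, ha⟩ := TopologicalSpace.Opens.mem_iSup.mp hy'
    refine ⟨V.unop ⊓ U a, inf_le_left, ⟨hy, ha⟩, ?_⟩
    have h1 := H ⟨a, V.unop ⊓ U a, inf_le_right⟩
      ((F.obj.map (homOfLE (inf_le_left : V.unop ⊓ U a ≤ V.unop)).op).hom x)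
    have h2 := ConcreteCategory.congr_hom
      (h.hom.naturality (homOfLE (inf_le_left : V.unop ⊓ U a ≤ V.unop)).op) x
    exact h2.symm.trans h1
  isPrincipalOn := by
    rintro ⟨a, V, hV⟩
    refine isPrincipalOn_moduleFunctor _ (toSections p V)
      (x := ((sheafSectionsAb (R := R) (X := Y) V).mapIso
        (sheafTwistSelf (structureSheafR p))).addCommGroupIsoToAddEquiv)
      (fun r x => ?_) (f a) (fun x => hU.eq_zero_of_mul_of_le hV x) (hU.exists_mul_of_le hV)
    have h1 := ConcreteCategory.congr_hom (congrArg (sheafSectionsAb (R := R) (X := Y) V).map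
      (sheafTwist_map_smul (structureSheafR p) r)) x
    refine h1.trans ?_
    exact structureSheafR_smul p V r _

/-- The abstract acyclicity argument again, now among sheaves of R-modules, where RΓ is computed. -/
theorem IsChartCover.exists_factorization_sheafTwist {f : Fin n → R} {U : Fin n → Y.Opens}
    (hU : IsChartCover p f U) {K : CochainComplex (ModuleCat.{u} R) ℤ} {w : ℤ → ℕ}
    (hK : IsWeightedContractible f K w)
    (e : (HomologicalComplex.single (ModuleCat.{u} R) (ComplexShape.up ℤ) 0).obj
      (ModuleCat.of R R) ⟶ K) :
    ∃ (M : CochainComplex (TopCat.Sheaf (ModuleCat.{u} R) Y) ℤ) (μ : M ⟶ _) (ψ' : _ ⟶ M),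
      Mono μ ∧ M.Acyclic ∧ ψ' ≫ μ = singleMap (sheafTwist (structureSheafR p)) e
        ((toSheafOfRModules p).map (minusTwistι p (idealJ f) (w 0)) ≫
          (sheafTwistSelf (structureSheafR p)).inv) := by
  refine hK.exists_factorization_of_single (hU.isChartFamily_sheafTwist p) e _ fun {W} h hh => ?_
  let g := (sheafTwistSelf (structureSheafR p)).inv ≫ h
  have hg (a) : sheafSMul (f a ^ w 0) _ ≫ g = 0 := by
    rw [← cancel_epi (sheafTwistSelf (structureSheafR p)).hom, ← Category.assoc,
      ← sheafTwist_map_smul, Category.assoc, Iso.hom_inv_id_assoc, hh, comp_zero]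
  refine (Category.assoc _ _ _).trans (sheaf_hom_ext fun V s => ?_)
  refine hU.apply_eq_zero_of_mem_idealSections p (G := fun V => W.obj.obj (.op V))
    (fun h => (W.obj.map (homOfLE h).op).hom) (fun V x hx => eq_zero_of_locally_eq_zero W V x hx)
    (fun V t => (g.hom.app (.op V)).hom t)
    (fun h t => (ConcreteCategory.congr_hom (g.hom.naturality (homOfLE h).op) t).symm) (w 0)
    (fun a V t => ?_) V.unop (show idealSections p (idealJ f ^ w 0) V.unop from s).1
    (show idealSections p (idealJ f ^ w 0) V.unop from s).2
  have h1 := congrArg (fun φ : structureSheafR p ⟶ W => (φ.hom.app (.op V)).hom t) (hg a)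
  refine Eq.trans ?_ h1
  exact congrArg (g.hom.app (.op V)).hom (structureSheafR_smul p V _ t).symm

end RModules


/-! ### Right derived functors on bounded below complexes -/

section RightDerived

open scoped ZeroObject

variable {C D : Type*} [Category* C] [Category* D] [Abelian C] [Abelian D]
  [HasDerivedCategory C] [HasDerivedCategory D] (F : C ⥤ D) [F.Additive] [EnoughInjectives C]

theorem isIso_rightDerivedFunctorPlusUnit_app (K : CochainComplex.Plus C)
    (hK : ∀ q, Injective (K.obj.X q)) :
    IsIso (F.rightDerivedFunctorPlusUnit.app ((HomotopyCategory.Plus.quotient C).obj K)) := by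
  obtain ⟨K, m, hm⟩ := K
  let K' : CochainComplex (InjectiveObject C) ℤ := HomologicalComplex.liftObjectProperty _ K hK
  have hK' : K'.IsStrictlyGE m := by
    rwa [← CochainComplex.isStrictlyGE_mapHomologicalComplex_obj_iff _ (InjectiveObject.ι _)]
  exact inferInstanceAs (IsIso (F.rightDerivedFunctorPlusUnit.app
    ((HomotopyCategory.Plus.quotient C).obj
      ((InjectiveObject.ι C).mapCochainComplexPlus.obj ⟨K', m, hK'⟩))))

/-- A zero map factors through the zero complex. This complex is injective in each degree, so its
image is F applied to it, which is zero. -/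
theorem rightDerivedFunctorPlus_map_zero (X Y : DerivedCategory.Plus C) :
    F.rightDerivedFunctorPlus.map (0 : X ⟶ Y) = 0 := by
  have hZ : IsZero (0 : CochainComplex C ℤ) := isZero_zero _
  have hZ' (q : ℤ) : IsZero ((0 : CochainComplex C ℤ).X q) :=
    (HomologicalComplex.eval _ _ q).map_isZero hZ
  let Z : CochainComplex.Plus C :=
    ⟨0, 0, (CochainComplex.isStrictlyGE_iff _ _).mpr fun q _ => hZ' q⟩
  have hu := isIso_rightDerivedFunctorPlusUnit_app F Z fun q => (hZ' q).injective
  let u : DerivedCategory.Plus.Q.obj (F.mapCochainComplexPlus.obj Z) ⟶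
    F.rightDerivedFunctorPlus.obj (DerivedCategory.Plus.Q.obj Z) :=
      F.rightDerivedFunctorPlusUnit.app ((HomotopyCategory.Plus.quotient C).obj Z)
  have h1 : IsZero (DerivedCategory.Q.obj ((F.mapHomologicalComplex (ComplexShape.up ℤ)).obj 0)) :=
    DerivedCategory.Q.map_isZero ((F.mapHomologicalComplex (ComplexShape.up ℤ)).map_isZero hZ)
  have h2 : IsZero (DerivedCategory.Plus.Q.obj (F.mapCochainComplexPlus.obj Z)) := by
    rw [IsZero.iff_id_eq_zero]
    exact DerivedCategory.Plus.ι.map_injective (h1.eq_of_src _ _)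
  have h3 : IsZero (F.rightDerivedFunctorPlus.obj (DerivedCategory.Plus.Q.obj Z)) :=
    h2.of_iso (@asIso _ _ _ _ u hu).symm
  have h4 : (0 : X ⟶ Y) = (0 : X ⟶ DerivedCategory.Plus.Q.obj Z) ≫ 0 := zero_comp.symm
  rw [h4, Functor.map_comp, h3.eq_of_tgt (F.rightDerivedFunctorPlus.map _) 0, zero_comp]

/-- A map from an object to a bounded below complex of injectives, which is zero in the derived
category, gives zero after applying a right derived functor. -/
theorem exists_iso_rightDerivedFunctorPlus {A O : C} (x : A ⟶ O) (I T : CochainComplex.Plus C)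
    (hI : ∀ q, Injective (I.obj.X q)) (hT : ∀ q, Injective (T.obj.X q))
    (γ : (HomologicalComplex.single C (ComplexShape.up ℤ) 0).obj O ⟶ I.obj) [QuasiIso γ]
    (η : I.obj ⟶ T.obj) (h : DerivedCategory.Q.map
      ((HomologicalComplex.single C (ComplexShape.up ℤ) 0).map x ≫ γ ≫ η) = 0) :
    ∃ a : (DerivedCategory.Plus.singleFunctor C 0 ⋙ F.rightDerivedFunctorPlus ⋙
        DerivedCategory.Plus.ι).obj O ≅
        DerivedCategory.Q.obj ((F.mapHomologicalComplex (ComplexShape.up ℤ)).obj I.obj),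
      ((DerivedCategory.Plus.singleFunctor C 0 ⋙ F.rightDerivedFunctorPlus ⋙
        DerivedCategory.Plus.ι).map x ≫ a.hom) ≫
        DerivedCategory.Q.map ((F.mapHomologicalComplex (ComplexShape.up ℤ)).map η) = 0 := by
  let G := F.rightDerivedFunctorPlus
  let q := HomotopyCategory.Plus.quotient C
  let A' : CochainComplex.Plus C :=
    ⟨(HomologicalComplex.single C (ComplexShape.up ℤ) 0).obj A, 0, inferInstance⟩
  let O' : CochainComplex.Plus C :=
    ⟨(HomologicalComplex.single C (ComplexShape.up ℤ) 0).obj O, 0, inferInstance⟩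
  let x' : A' ⟶ O' := ObjectProperty.homMk ((HomologicalComplex.single C (ComplexShape.up ℤ) 0).map x)
  let γ' : O' ⟶ I := ObjectProperty.homMk γ
  let η' : I ⟶ T := ObjectProperty.homMk η
  have h1 : DerivedCategory.Plus.Q.map x' ≫ DerivedCategory.Plus.Q.map γ' ≫
      DerivedCategory.Plus.Q.map η' = 0 := by
    rw [← Functor.map_comp, ← Functor.map_comp]
    refine DerivedCategory.Plus.ι.map_injective (Eq.trans ?_ (Functor.map_zero _ _ _).symm)
    exact h
  have hγ : IsIso (DerivedCategory.Plus.Q.map γ') := by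
    have h2 : IsIso (DerivedCategory.Q.map γ) := inferInstance
    have h3 : IsIso (DerivedCategory.Plus.ι.map (DerivedCategory.Plus.Q.map γ')) := h2
    exact isIso_of_fully_faithful DerivedCategory.Plus.ι _
  let uI : DerivedCategory.Plus.Q.obj (F.mapCochainComplexPlus.obj I) ⟶
    G.obj (DerivedCategory.Plus.Q.obj I) := F.rightDerivedFunctorPlusUnit.app (q.obj I)
  let uT : DerivedCategory.Plus.Q.obj (F.mapCochainComplexPlus.obj T) ⟶
    G.obj (DerivedCategory.Plus.Q.obj T) := F.rightDerivedFunctorPlusUnit.app (q.obj T)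
  have huI : IsIso uI := isIso_rightDerivedFunctorPlusUnit_app F I hI
  have huT : IsIso uT := isIso_rightDerivedFunctorPlusUnit_app F T hT
  have nat : DerivedCategory.Plus.Q.map (F.mapCochainComplexPlus.map η') ≫ uT =
      uI ≫ G.map (DerivedCategory.Plus.Q.map η') :=
    F.rightDerivedFunctorPlusUnit.naturality (q.map η')
  let a : G.obj (DerivedCategory.Plus.Q.obj O') ≅
      DerivedCategory.Plus.Q.obj (F.mapCochainComplexPlus.obj I) :=
    G.mapIso (asIso (DerivedCategory.Plus.Q.map γ')) ≪≫ (asIso uI).symm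
  have h2 : (G.map (DerivedCategory.Plus.Q.map x') ≫ a.hom) ≫
      DerivedCategory.Plus.Q.map (F.mapCochainComplexPlus.map η') = 0 := by
    -- T consists of injectives, so the unit at T is invertible; naturality turns F(η) into the
    -- derived functor of η, where the hypothesis applies.
    rw [← cancel_mono uT, zero_comp, Category.assoc, nat]
    have h3 : a.hom ≫ uI = G.map (DerivedCategory.Plus.Q.map γ') := by simp [a]
    rw [Category.assoc, ← Category.assoc a.hom, h3, ← G.map_comp, ← G.map_comp, h1]
    exact rightDerivedFunctorPlus_map_zero F _ _
  refine ⟨DerivedCategory.Plus.ι.mapIso a, ?_⟩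
  have h4 := congrArg DerivedCategory.Plus.ι.map h2
  rw [Functor.map_zero, Functor.map_comp, Functor.map_comp] at h4
  exact h4

end RightDerived


/-! ### Vanishing of the map on derived global sections -/

section CanonicalMapZero

variable {R : CommRingCat.{u}} {Y : Scheme.{u}} (p : Y ⟶ Spec R) {n : ℕ} {f : Fin n → R}
  {U : Fin n → Y.Opens} (hU : IsChartCover p f U) {L : CochainComplex (ModuleCat.{u} R) ℤ}
  {w : ℤ → ℕ} (hL : IsWeightedContractible f L w) {lo hi : ℤ} (B : DualBases L lo hi)
  (e : (HomologicalComplex.single (ModuleCat.{u} R) (ComplexShape.up ℤ) 0).obj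
    (ModuleCat.of R R) ⟶ L)
include hU hL

/-- The map to L ⊗ I is the map to L ⊗ 𝒪_Y followed by the comparison, and the former factors
through an acyclic complex. -/
theorem IsChartCover.Q_map_sheafUnit_eq_zero
    [HasDerivedCategory.{w'} (TopCat.Sheaf (ModuleCat.{u} R) Y)]
    (I : CochainComplex (TopCat.Sheaf (ModuleCat.{u} R) Y) ℤ)
    (γ : (HomologicalComplex.single _ (ComplexShape.up ℤ) 0).obj (structureSheafR p) ⟶ I) :
    DerivedCategory.Q.map ((HomologicalComplex.single _ (ComplexShape.up ℤ) 0).map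
      ((toSheafOfRModules p).map (minusTwistι p (idealJ f) (w 0))) ≫ γ ≫ B.sheafUnit I e) = 0 := by
  let O := structureSheafR p
  let x := (toSheafOfRModules p).map (minusTwistι p (idealJ f) (w 0))
  let γ0 : O ⟶ I.X 0 := (HomologicalComplex.singleObjXSelf (ComplexShape.up ℤ) 0 O).inv ≫ γ.f 0
  let φ : (sheafTwist O).obj (ModuleCat.of R R) ⟶ I.X 0 := (sheafTwistSelf O).hom ≫ γ0
  have hφ (r : R) : (sheafTwist O).map (r • 𝟙 (ModuleCat.of R R)) ≫ φ = φ ≫ sheafSMul r _ := by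
    rw [← Category.assoc, sheafTwist_map_smul, Category.assoc, sheafSMul_naturality]
    simp only [φ, γ0, Category.assoc]
  have h0 : φ ≫ I.d 0 1 = 0 := by
    rw [Category.assoc, Category.assoc, γ.comm, HomologicalComplex.single_obj_d, zero_comp,
      comp_zero, comp_zero]
  have hβ : (HomologicalComplex.singleObjXSelf (ComplexShape.up ℤ) 0 _).inv ≫
      ((HomologicalComplex.single _ (ComplexShape.up ℤ) 0).map x ≫ γ).f 0 =
        (x ≫ (sheafTwistSelf O).inv) ≫ φ := by
    rw [Category.assoc, Iso.inv_hom_id_assoc, HomologicalComplex.comp_f,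
      HomologicalComplex.single_map_f_self, Category.assoc, Iso.inv_hom_id_assoc, Category.assoc]
  obtain ⟨M, μ, ψ, -, hM, h⟩ := hU.exists_factorization_sheafTwist p hL e
  have h1 := B.singleMap_comparison I (sheafTwist O) φ hφ h0 e _ _ hβ
  rw [← Category.assoc, ← h1, ← h, Category.assoc]
  exact Q_map_eq_zero hM _ _

-- For an injective resolution I of 𝒪_Y the complex L ⊗ I is bounded below and injective. The
-- vanishing of the map to L ⊗ I therefore persists after RΓ, where it concerns L ⊗ Γ(I), a model of
-- L ⊗ᴸ RΓ(Y, 𝒪_Y).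
include B in
theorem IsChartCover.derivedMap_eq_zero [HasDerivedCategory.{w} (ModuleCat.{u} R)]
    [HasDerivedCategory.{w'} (TopCat.Sheaf (ModuleCat.{u} R) Y)] [HasDerivedTensor L] :
    derivedMap p e (minusTwistι p (idealJ f) (w 0)) = 0 := by
  let O := structureSheafR p
  let x := (toSheafOfRModules p).map (minusTwistι p (idealJ f) (w 0))
  obtain ⟨I', hI', γ', hγ'⟩ := CochainComplex.Plus.exists_quasiIso_injective
    ⟨(HomologicalComplex.single _ (ComplexShape.up ℤ) 0).obj O, 0, inferInstance⟩ 0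
  let I := (InjectiveObject.ι (TopCat.Sheaf (ModuleCat.{u} R) Y)).mapCochainComplexPlus.obj I'
  have hI (q : ℤ) : Injective (I.obj.X q) := (I'.obj.X q).property
  obtain ⟨m, hm⟩ := I.property
  have : I.obj.IsStrictlyGE m := hm
  let T : CochainComplex.Plus (TopCat.Sheaf (ModuleCat.{u} R) Y) :=
    ⟨B.tensorSheafCx I.obj, lo + m, B.isStrictlyGE_tensorSheafCx I.obj m⟩
  have : QuasiIso γ'.hom := hγ'
  obtain ⟨a, ha⟩ := exists_iso_rightDerivedFunctorPlus (globalSections R Y) x I T hI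
    (B.injective_tensorSheafCx I.obj hI) γ'.hom (B.sheafUnit I.obj e)
    (hU.Q_map_sheafUnit_eq_zero p hL B e I.obj γ'.hom)
  let K := ((globalSections R Y).mapHomologicalComplex (ComplexShape.up ℤ)).obj I.obj
  -- Global sections of the sheaf complex L ⊗ I are L ⊗ Γ(I) on the nose, so the two unit maps agree
  -- degree by degree.
  have h1 : ((globalSections R Y).mapHomologicalComplex (ComplexShape.up ℤ)).map
      (B.sheafUnit I.obj e) = (MonoidalCategory.leftUnitor K).inv ≫
        MonoidalCategory.whiskerRight (show MonoidalCategory.tensorUnit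
          (CochainComplex (ModuleCat.{u} R) ℤ) ⟶ L from e) K :=
    HomologicalComplex.hom_ext _ _ fun q => (leftUnitor_inv_whiskerRight_f e K q).symm
  have h2 := B.comp_toDerivedTensor_eq_zero e (K := K)
    ((RΓ p).map (minusTwistι p (idealJ f) (w 0)) ≫ a.hom)
    ((congrArg (fun t => ((RΓ p).map (minusTwistι p (idealJ f) (w 0)) ≫ a.hom) ≫
      DerivedCategory.Q.map t) h1.symm).trans ha)
  -- The vanishing is known for the model Γ(I); naturality along the isomorphism a carries it back
  -- to RΓ(Y, 𝒪_Y).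
  have h3 := (toDerivedTensor e).naturality a.hom
  have h4 : IsIso ((derivedTensor L).map a.hom) := inferInstance
  refine (cancel_mono ((derivedTensor L).map a.hom)).mp ?_
  refine Eq.trans ?_ (h2.trans zero_comp.symm)
  exact (Category.assoc _ _ _).trans ((congrArg ((RΓ p).map _ ≫ ·) h3.symm).trans
    (Category.assoc _ _ _).symm)

end CanonicalMapZero

end BrianconSkoda

theorem theorem2p1 (R : CommRingCat.{u}) (n k : ℕ) (hn : 1 ≤ n) (hk : 1 ≤ k) (f : Fin n → R)
    [HasDerivedCategory.{w} (ModuleCat.{u} R)]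
    [HasDerivedCategory.{w'} (TopCat.Sheaf (ModuleCat.{u} R) (schemeY f k))]
    [HasDerivedCategory.{w''} (schemeY f k).Modules] :
    -- `J·𝒪_Y = 𝒪_Y(-E)` for an effective Cartier divisor `E`
    IsEffectiveCartier (mapπ f k) (idealJ f) ∧
    -- the derived tensor product with `L^k(f)` is defined, and the canonical map
    -- `RΓ(Y, 𝒪_Y(-(n+k-1)E)) → L^k(f) ⊗ᴸ RΓ(Y, 𝒪_Y)` is zero in the derived category of `R`
    (∃ _ : HasDerivedTensor (beComplex f k),
      derivedMap (mapπ f k) (beUnit f k) (minusTwistι (mapπ f k) (idealJ f) (n + k - 1)) = 0) ∧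
    -- `𝒪_Y(-(n+k-1)E) → L^k(f) ⊗ 𝒪_Y` is zero in the derived category of `𝒪_Y`-modules
    DerivedCategory.Q.map (sheafLevelMap (mapπ f k) (beUnit f k)
      (minusTwistι (mapπ f k) (idealJ f) (n + k - 1))) = 0 := by

  have hU := isChartCover_chartOpen (f := f) (N := n + k - 1) (by omega)
  -- Its weight in degree 0 is n + k - 1 by definition, which is the exponent of the twist in both
  -- statements.
  have hL := isWeightedContractible_beComplex f hn hk
  refine ⟨hU.isEffectiveCartier, ?_, ?_⟩
  · obtain ⟨B⟩ := nonempty_dualBases (lo := -n) (hi := 0) hL.finite hL.projective fun i hi =>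
      hi.elim (isZero_beComplex_of_lt f k) (isZero_beComplex f k)
    exact ⟨B.hasDerivedTensor, letI := B.hasDerivedTensor (R := R)
      hU.derivedMap_eq_zero _ hL B (beUnit f k)⟩
  · exact sheafLevelMap_eq_zero_of_isChartCover _ hU hL (beUnit f k)
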